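/- **Round-based algorithms.** A round-based algorithm is a procedure $\mathrm{ComputeRound}(r,p)$. An input configuration consists of a finite set of processes and initial contents of a shared memory. In rounds $r=0,1,2,\dots$ every active process $p$ executes $\mathrm{ComputeRound}(r,p)$, which reads shared locations, writes shared locations, performs local steps, and may retire (it is then inactive in all later rounds). Writes become visible at the end of the round; only written locations may be read, and each location is written at most once (the input counts as written). The work of a round computation is the number of instructions it executes. The *initial work* is the total work of all round computations; the *round complexity* is the number of rounds in which some process is active; the *span* is the sum over all rounds of the maximum work of a round computation in that round. For two input configurations, the computation $(r,p)$ is *affected* if $p$ runs in round $r$ on exactly one of them, or it runs on both and reads a location whose value differs. The *computation distance* is the sum of the work of all affected computations with respect to both configurations. **Tree contraction.** Fix $t\in\mathbb N$. Let $F$ be a forest on a finite, linearly ordered set $V$ of $n$ vertices, all of degree at most $t$, given by adjacency lists with $t$ slots per vertex, where each slot is empty or holds a neighbor together with the position of the vertex in the list of that neighbor; also given is a flag telling for each vertex whether it is a leaf (has degree one). There is one process per vertex. Let $\mathrm{Heads}(i,v)$ ($i\in\mathbb N$, $v\in V$) be independent fair coins. In round $i$ of randomized Miller–Reif tree contraction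 an alive vertex $u$ reads its adjacency list and the leaf flags it needs and does the following: * if $u$ is isolated, it is deleted (finalizes); * if $u$ is a leaf with neighbor $v$, and $v$ is not a leaf or $u<v$, then $u$ is deleted (rakes) and its slot at $v$ is emptied; * if $u$ has exactly two neighbors $v,v'$, neither of them is a leaf, and $\mathrm{Heads}(i,u)\wedge\neg\mathrm{Heads}(i,v)\wedge\neg\mathrm{Heads}(i,v')$ holds, then $u$ is deleted (compresses), and $v$ and $v'$ become adjacent, in the slots that $u$ occupied; * otherwise $u$ stays alive and writes its entries in its neighbors' lists, its own empty slots and its own leaf flag for round $i+1$. A deleted vertex records the round of its deletion and its process retires. **Theorem.** For every $t$ there is a constant $C>0$, depending only on $t$, such that for every forest $F$ as above: 1. randomized Miller–Reif tree contraction on $F$ obeys the memory rules of round-based algorithms for all outcomes of the coins; 2. its initial work is at most $C\,n$ in expectation; 3. its round complexity is $O(\log n)$ with high probability: for every real $c\ge 1$, it exceeds $C\,c\ln n$ with probability at most $n^{-c}$; 4. its span is $O(\log n)$ with high probability, in the same sense; 5. for every $k\in\mathbb N$ and every forest $F'$ on $V$ of maximum degree at most $t$ whose edge set differs from that of $F$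 in at most $k$ edges (inserted or deleted), given by adjacency lists in which the common edges of $F$ and $F'$ occupy the same slots, the computation distance between the runs on $F$ and on $F'$ with the same coins is at most $C\,k\ln(1+n/k)$ in expectation (for $k=0$ this bound means $0$). -/

import Mathlib

open MeasureTheory ProbabilityTheory
open scoped ENNReal

/-! ## Round-based algorithms -/

namespace RoundBased

/-- The program of one round computation.  Shared memory consists of locations `Loc`, where
location `l` stores a value of type `Val l`.  The instructions are: reading a shared location,
writing a shared location, retiring, and one unit of purely local work (`step`). -/
inductive Prog (Loc : Type) (Val : Loc → Type) (α : Type) : Type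
  | done (a : α) : Prog Loc Val α
  | readThen (l : Loc) (k : Val l → Prog Loc Val α) : Prog Loc Val α
  | writeThen (l : Loc) (v : Val l) (k : Prog Loc Val α) : Prog Loc Val α
  | retireThen (k : Prog Loc Val α) : Prog Loc Val α
  | stepThen (k : Prog Loc Val α) : Prog Loc Val α

namespace Prog

variable {Loc : Type} {Val : Loc → Type} {α β : Type}

/-- Sequential composition. -/
def andThen : Prog Loc Val α → (α → Prog Loc Val β) → Prog Loc Val β
  | done a, f => f a
  | readThen l k, f => readThen l (fun v => (k v).andThen f)
  | writeThen l v k, f => writeThen l v (k.andThen f)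
  | retireThen k, f => retireThen (k.andThen f)
  | stepThen k, f => stepThen (k.andThen f)

instance : Monad (Prog Loc Val) where
  pure := done
  bind := andThen

/-- Read a shared location. -/
def read (l : Loc) : Prog Loc Val (Val l) := readThen l done
/-- Write a shared location. -/
def write (l : Loc) (v : Val l) : Prog Loc Val Unit := writeThen l v (done ())
/-- Retire at the end of the round. -/
def retire : Prog Loc Val Unit := retireThen (done ())
/-- `c` units of local work. -/
def steps : ℕ → Prog Loc Val Unit
  | 0 => done ()
  | c + 1 => stepThen (steps c)

end Prog

/-- A shared memory; `none` marks a location that has not been written. -/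
abbrev Memory (Loc : Type) (Val : Loc → Type) : Type := (l : Loc) → Option (Val l)

/-- One executed instruction. -/
inductive Event (Loc : Type) (Val : Loc → Type) : Type
  | read (l : Loc) : Event Loc Val
  | write (l : Loc) (v : Val l) : Event Loc Val
  | retire : Event Loc Val
  | step : Event Loc Val

/-- The location written by an instruction, if any. -/
def Event.written {Loc : Type} {Val : Loc → Type} : Event Loc Val → Option Loc
  | .write l _ => some l
  | _ => none

/-- The list of instructions executed by a round computation that sees shared memory `m`.
All reads see `m`: writes become visible only at the end of the round.  A computation that
reads an unwritten location gets stuck there (`Legal` below says that this does not happen). -/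
def Prog.trace {Loc : Type} {Val : Loc → Type} {α : Type} (m : Memory Loc Val) :
    Prog Loc Val α → List (Event Loc Val)
  | .done _ => []
  | .readThen l k =>
      .read l :: (match m l with
        | none => []
        | some v => (k v).trace m)
  | .writeThen l v k => .write l v :: k.trace m
  | .retireThen k => .retire :: k.trace m
  | .stepThen k => .step :: k.trace m

/-- A round-based algorithm: the procedure `ComputeRound(r, p)`. -/
abbrev Algorithm (Proc Loc : Type) (Val : Loc → Type) : Type :=
  ℕ → Proc → Prog Loc Val Unit

/-- A set of processes together with the contents of shared memory.  Used both for input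
configurations and for the situation at the beginning of a round. -/
structure Config (Proc Loc : Type) (Val : Loc → Type) where
  procs : Finset Proc
  memory : Memory Loc Val

section Execution

variable {Proc Loc : Type} {Val : Loc → Type}

/-- The instructions executed by `p` in round `r` when the round starts in `S`. -/
def roundTrace (A : Algorithm Proc Loc Val) (r : ℕ) (S : Config Proc Loc Val) (p : Proc) :
    List (Event Loc Val) :=
  (A r p).trace S.memory

open Classical in
/-- All active processes perform their round computation; then the processes that retired are
removed and the writes become visible. -/
noncomputable def nextConfig (A : Algorithm Proc Loc Val) (r : ℕ) (S : Config Proc Loc Val) :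
    Config Proc Loc Val where
  procs := S.procs.filter (fun p => Event.retire ∉ roundTrace A r S p)
  memory := fun l =>
    if h : ∃ v : Val l, ∃ p ∈ S.procs, Event.write l v ∈ roundTrace A r S p then
      some h.choose
    else S.memory l

/-- The active processes and the shared memory at the beginning of round `r`. -/
noncomputable def configAt (A : Algorithm Proc Loc Val) (I : Config Proc Loc Val) :
    ℕ → Config Proc Loc Val
  | 0 => I
  | r + 1 => nextConfig A r (configAt A I r)

/-- The active processes at round `r`. -/
noncomputable def activeAt (A : Algorithm Proc Loc Val) (I : Config Proc Loc Val) (r : ℕ) :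
    Finset Proc :=
  (configAt A I r).procs

/-- The shared memory at the beginning of round `r`. -/
noncomputable def memoryAt (A : Algorithm Proc Loc Val) (I : Config Proc Loc Val) (r : ℕ) :
    Memory Loc Val :=
  (configAt A I r).memory

/-- The instructions executed by process `p` in round `r` of the run on input `I`. -/
noncomputable def traceAt (A : Algorithm Proc Loc Val) (I : Config Proc Loc Val) (r : ℕ)
    (p : Proc) : List (Event Loc Val) :=
  roundTrace A r (configAt A I r) p

/-- The work (time) of the round computation of `p` in round `r`: the number of executed
instructions. -/
noncomputable def costAt (A : Algorithm Proc Loc Val) (I : Config Proc Loc Val) (r : ℕ)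
    (p : Proc) : ℕ :=
  (traceAt A I r p).length

/-- The memory discipline of round-based algorithms: only written locations are read, and every
location is written at most once (the input counts as written; in particular there are no
concurrent writes). -/
def Legal (A : Algorithm Proc Loc Val) (I : Config Proc Loc Val) : Prop :=
  ∀ r : ℕ, ∀ p ∈ activeAt A I r,
    (∀ l, Event.read l ∈ traceAt A I r p → memoryAt A I r l ≠ none) ∧
    (∀ l v, Event.write l v ∈ traceAt A I r p → memoryAt A I r l = none) ∧
    ((traceAt A I r p).filterMap Event.written).Nodup ∧
    (∀ q ∈ activeAt A I r, q ≠ p → ∀ l v w,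
      Event.write l v ∈ traceAt A I r p → Event.write l w ∉ traceAt A I r q)

/-- Initial work: the total work of all round computations. -/
noncomputable def initialWork (A : Algorithm Proc Loc Val) (I : Config Proc Loc Val) : ℝ≥0∞ :=
  ∑' r : ℕ, ∑ p ∈ activeAt A I r, (costAt A I r p : ℝ≥0∞)

/-- Round complexity: the number of rounds performed. -/
noncomputable def roundComplexity (A : Algorithm Proc Loc Val) (I : Config Proc Loc Val) : ℕ∞ :=
  {r : ℕ | (activeAt A I r).Nonempty}.encard

/-- Span: the sum over all rounds of the maximum cost of a round computation. -/
noncomputable def span (A : Algorithm Proc Loc Val) (I : Config Proc Loc Val) : ℝ≥0∞ :=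
  ∑' r : ℕ, (((activeAt A I r).sup (costAt A I r) : ℕ) : ℝ≥0∞)

/-- `(r, p)` is an affected computation for the two input configurations: it runs on exactly one
of them, or it runs on both and reads a location whose value differs. -/
def Affected (A : Algorithm Proc Loc Val) (I J : Config Proc Loc Val) (r : ℕ) (p : Proc) : Prop :=
  Xor (p ∈ activeAt A I r) (p ∈ activeAt A J r) ∨
    (p ∈ activeAt A I r ∧ p ∈ activeAt A J r ∧
      ∃ l, (Event.read l ∈ traceAt A I r p ∨ Event.read l ∈ traceAt A J r p) ∧
        memoryAt A I r l ≠ memoryAt A J r l)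

open Classical in
/-- Computation distance: the total work of the affected computations with respect to both
input configurations. -/
noncomputable def computationDistance (A : Algorithm Proc Loc Val) (I J : Config Proc Loc Val) :
    ℝ≥0∞ :=
  ∑' r : ℕ,
    ((∑ p ∈ (activeAt A I r).filter (Affected A I J r), (costAt A I r p : ℝ≥0∞)) +
      ∑ p ∈ (activeAt A J r).filter (Affected A I J r), (costAt A J r p : ℝ≥0∞))

end Execution

end RoundBased

/-! ## Randomized Miller–Reif tree contraction -/

namespace TreeContraction

open RoundBased RoundBased.Prog

/-- Shared locations: `adj i u j` is `A[i][u][j]`, the `j`-th slot of the adjacency list of `u` in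
round `i`; `leaf i u` records whether `u` is a leaf in round `i`; `del u` is `D[u]`, the round in
which `u` is deleted. -/
inductive Loc (V : Type) (t : ℕ) : Type
  | adj (i : ℕ) (u : V) (j : Fin t) : Loc V t
  | leaf (i : ℕ) (u : V) : Loc V t
  | del (u : V) : Loc V t

/-- The types of the values.  The slot `A[i][u][j]` is null or a pair `(v, p)`: a neighbor `v` of
`u` and the position `p` of `u` in the adjacency list of `v`. -/
abbrev Val {V : Type} {t : ℕ} : Loc V t → Type
  | .adj _ _ _ => Option (V × Fin t)
  | .leaf _ _ => Bool
  | .del _ => ℕ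

section Algorithm

variable {V : Type} {t : ℕ}

/-- Read the given slots of the adjacency list of `u` in round `i`. -/
def readSlots (i : ℕ) (u : V) :
    List (Fin t) → Prog (Loc V t) Val (List (Fin t × Option (V × Fin t)))
  | [] => pure []
  | j :: js => do
      let s ← read (.adj i u j)
      let rest ← readSlots i u js
      pure ((j, s) :: rest)

def doRake (i : ℕ) (u v : V) (p : Fin t) : Prog (Loc V t) Val Unit := do
  write (.adj (i + 1) v p) none
  write (.del u) i
  retire

def doFinalize (i : ℕ) (u : V) : Prog (Loc V t) Val Unit := do
  write (.del u) i
  retire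

def doCompress (i : ℕ) (u v : V) (p : Fin t) (v' : V) (p' : Fin t) :
    Prog (Loc V t) Val Unit := do
  write (.adj (i + 1) v p) (some (v', p'))
  write (.adj (i + 1) v' p') (some (v, p))
  write (.del u) i
  retire

/-- The loop of `doAlive`; it returns the number of neighbors that are not leaves. -/
def aliveLoop (i : ℕ) (u : V) :
    List (Fin t × Option (V × Fin t)) → ℕ → Prog (Loc V t) Val ℕ
  | [], nonleaves => pure nonleaves
  | (j, some (v, p)) :: rest, nonleaves => do
      steps 1
      write (.adj (i + 1) v p) (some (u, j))
      let b ← read (.leaf i v)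
      steps 1
      aliveLoop i u rest (if b then nonleaves else nonleaves + 1)
  | (j, none) :: rest, nonleaves => do
      steps 1
      write (.adj (i + 1) u j) none
      aliveLoop i u rest nonleaves

def doAlive (i : ℕ) (u : V) (slots : List (Fin t × Option (V × Fin t))) :
    Prog (Loc V t) Val Unit := do
  steps 1
  let nonleaves ← aliveLoop i u slots 0
  steps 1
  write (.leaf (i + 1) u) (decide (nonleaves = 1))

/-- `ComputeRound(i, u)`.  `heads i v` is the coin of vertex `v` in round `i`.
The local work charged is one unit per slot for inspecting the slots, one unit per test, and one
unit per coin. -/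
def computeRound [LinearOrder V] (heads : ℕ → V → Bool) :
    RoundBased.Algorithm V (Loc V t) Val := fun i u => do
  let slots ← readSlots i u (List.finRange t)
  let isLeaf ← read (.leaf i u)
  steps t
  match slots.filterMap Prod.snd with
  | [] => doFinalize i u
  | (v, p) :: others => do
      steps 1
      if isLeaf then do
        let vLeaf ← read (.leaf i v)
        steps 1
        if vLeaf = false ∨ u < v then doRake i u v p else doAlive i u slots
      else
        match others with
        | [(v', p')] => do
            let vLeaf ← read (.leaf i v)
            let vLeaf' ← read (.leaf i v')
            steps 4
            if vLeaf = false ∧ vLeaf' = false ∧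
                (heads i u = true ∧ heads i v = false ∧ heads i v' = false) then
              doCompress i u v p v' p'
            else doAlive i u slots
        | _ => doAlive i u slots

end Algorithm

/-- Adjacency lists with `t` slots per vertex for the graph `F`.  `slot u j = some (v, p)` means
that the `j`-th slot of `u` holds the neighbor `v`, and that `u` is in the `p`-th slot of `v`.
Every neighbor occupies exactly one slot, so all degrees are at most `t`. -/
structure AdjacencyLists {V : Type} (F : SimpleGraph V) (t : ℕ) where
  slot : V → Fin t → Option (V × Fin t)
  symm : ∀ u j v p, slot u j = some (v, p) → slot v p = some (u, j)
  adj_iff : ∀ u v, F.Adj u v ↔ ∃ j p, slot u j = some (v, p)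
  unique : ∀ u v j j' p p', slot u j = some (v, p) → slot u j' = some (v, p') → j = j'

/-- The input configuration of tree contraction: the adjacency lists and leaf flags of round `0`,
and one process per vertex. -/
def input {V : Type} [Fintype V] {t : ℕ} {F : SimpleGraph V} (L : AdjacencyLists F t) :
    Config V (Loc V t) Val where
  procs := Finset.univ
  memory := fun l =>
    match l with
    | .adj 0 u j => some (L.slot u j)
    | .leaf 0 u => some (decide ((Finset.univ.filter (fun j => (L.slot u j).isSome)).card = 1))
    | _ => none

/-- The adjacency lists of two graphs agree on the edges that the graphs have in common: an update
of the edge set touches only the slots of inserted and deleted edges. -/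
def SameSlots {V : Type} {t : ℕ} {F F' : SimpleGraph V} (L : AdjacencyLists F t)
    (L' : AdjacencyLists F' t) : Prop :=
  ∀ u v j p, F.Adj u v → F'.Adj u v → (L.slot u j = some (v, p) ↔ L'.slot u j = some (v, p))

end TreeContraction

set_option linter.unusedSectionVars false

namespace TreeContraction
open RoundBased RoundBased.Prog

/-! ## Rankings of forests -/

section Ranking

variable {V : Type} [Fintype V]

/-! A forest can be ranked so that every vertex has at most one neighbor of higher rank
(`exists_ranking`). This is a local condition on adjacency slots, and a contraction round preserves
it with the same ranks (`IsForest.next`), so it replaces acyclicity everywhere. The execution on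
shared memory simulates the deterministic map `nextState` on such tables (`matches_configAt`).
Legality holds because every location has only one possible writer in a round
(`Matches.writer_unique`) and writes go to fresh locations. Every round computation costs at most `6
* t + 14`, so all bounds reduce to counting vertices.

Progress: call a vertex doomed if it is deleted whatever the coins show, and eligible if it
compresses under one pattern of three coins, which has probability 1/8. A forest on a set `D` has
average degree at most two, so few vertices branch, and up to constants `D` is covered by its doomed
vertices, its eligible vertices and its frontier, the vertices with a neighbor outside `D`
(`card_le_of_isForest`). Hence the expected number of alive vertices in `D` shrinks by the factor
7/8 in a round, up to an error from the frontier and from newly added vertices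
(`FairCoins.integral_card_inter_succ_le`). For the set of all vertices there is no error: this gives
the work by summing a geometric series, and rounds and span by Markov's inequality.

Distance: two runs with the same coins are compared through a dirty set outside of which they agree.
It is split into blocks, one per vertex whose adjacency list changes, hence at most `2 * k` of them.
Each block is connected in both forests and has at most two frontier vertices (`Dirty`). Differences
spread only through vertices that have degree at most two in one of the runs. Such a frontier vertex
either hands its role to a single outside neighbor, or has two outside neighbors and is then the
only alive vertex of its block. So blocks keep at most two frontier vertices, and the dirty set
gains at most eight vertices per block in a round (`Dirty.next`, `card_nextDirty_le`). Growth at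
this rate against decay by 7/8 keeps the expected number of alive dirty vertices at `O(k)` in every
round (`FairCoins.integral_card_dirtyAt_le`). The affected vertices are also at most the alive ones,
so the distance is of the order of the sum over `r` of `min k (n * (7/8)^r)`, which is `O(k log (1 +
n/k))` (`tsum_min_le`). -/

/-- A nonempty vertex set of a forest contains a vertex with at most one neighbor in the set. -/
theorem exists_subsingleton_neighbors {F : SimpleGraph V} (hF : F.IsAcyclic) (S : Finset V)
    (hS : S.Nonempty) :
    ∃ u ∈ S, ∀ v ∈ S, ∀ w ∈ S, F.Adj u v → F.Adj u w → v = w := by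
  classical
  set H := F.induce (S : Set V) with hH
  have hHa : H.IsAcyclic := hF.induce _
  obtain ⟨s, hs⟩ := hS
  let Q : ℕ → Prop := fun m => ∃ (a b : (S : Set V)) (p : H.Walk a b), p.IsPath ∧ p.length = m
  have hQ0 : Q 0 := ⟨⟨s, hs⟩, ⟨s, hs⟩, SimpleGraph.Walk.nil, by simp, by simp⟩
  have hbound : ∀ m, Q m → m ≤ Fintype.card (S : Set V) := by
    rintro m ⟨a, b, p, hp, rfl⟩
    exact hp.length_lt.le
  -- The start `a` of a longest path works: a neighbor off the path would prolong it, and by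
  -- acyclicity a neighbor on the path can only be its second vertex.
  obtain ⟨a, b, p, hp, hlen⟩ : Q (Nat.findGreatest Q (Fintype.card (S : Set V))) :=
    Nat.findGreatest_spec (Nat.zero_le _) hQ0
  have hmem : ∀ v (hv : v ∈ S), F.Adj a v → (⟨v, hv⟩ : (S : Set V)) = p.snd := by
    intro v hv hav
    have hadj : H.Adj a ⟨v, hv⟩ := hav
    by_cases hsup : (⟨v, hv⟩ : (S : Set V)) ∈ p.support
    · exact hHa.eq_snd_of_adj_start hp hadj hsup
    · exfalso
      have hQ : Q (p.length + 1) :=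
        ⟨_, b, SimpleGraph.Walk.cons hadj.symm p, hp.cons hsup, by simp⟩
      have := Nat.le_findGreatest (hbound _ hQ) hQ
      omega
  refine ⟨a, a.2, fun v hv w hw hav haw => ?_⟩
  have := (hmem v hv hav).trans (hmem w hw haw).symm
  exact congrArg Subtype.val this

/-- The vertices of a forest can be ranked so that every vertex has at most one neighbor of
higher rank. -/
theorem exists_ranking {F : SimpleGraph V} (hF : F.IsAcyclic) :
    ∃ ρ : V → ℕ, Function.Injective ρ ∧
      ∀ u v w, F.Adj u v → F.Adj u w → ρ u < ρ v → ρ u < ρ w → v = w := by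
  classical
  suffices h : ∀ m, ∀ S : Finset V, S.card = m → ∃ ρ : V → ℕ, Set.InjOn ρ S ∧
      ∀ u ∈ S, ∀ v ∈ S, ∀ w ∈ S, F.Adj u v → F.Adj u w → ρ u < ρ v → ρ u < ρ w → v = w by
    obtain ⟨ρ, h1, h2⟩ := h _ Finset.univ rfl
    exact ⟨ρ, by simpa [Set.injOn_univ] using h1, fun u v w => h2 u (by simp) v (by simp) w (by simp)⟩
  intro m
  induction m with
  | zero =>
    intro S hS
    rw [Finset.card_eq_zero] at hS
    subst hS
    exact ⟨fun _ => 0, by simp, by simp⟩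
  | succ m ih =>
    intro S hS
    obtain ⟨x, hx, hxu⟩ := exists_subsingleton_neighbors hF S (Finset.card_pos.mp (by omega))
    obtain ⟨ρ, h1, h2⟩ := ih (S.erase x) (by rw [Finset.card_erase_of_mem hx]; omega)
    -- The peeled vertex `x` gets the lowest rank: its higher neighbors are among its at most one
    -- neighbor in `S`, and it is a higher neighbor of nobody.
    refine ⟨fun v => if v = x then 0 else ρ v + 1, ?_, ?_⟩
    · intro a ha b hb hab
      by_cases hax : a = x <;> by_cases hbx : b = x <;> simp [hax, hbx] at hab ⊢
      exact h1 (by simpa [hax] using ha) (by simpa [hbx] using hb) hab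
    · intro u hu v hv w hw huv huw h3 h4
      by_cases hux : u = x
      · subst hux
        exact hxu v hv w hw huv huw
      · have hvx : v ≠ x := by rintro rfl; simp at h3
        have hwx : w ≠ x := by rintro rfl; simp at h4
        simp only [hux, hvx, hwx, if_false, add_lt_add_iff_right] at h3 h4
        exact h2 u (by simp [*]) v (by simp [*]) w (by simp [*]) huv huw h3 h4

end Ranking

/-! ## The contraction as a process on adjacency lists -/

/-- A table of adjacency lists. -/
abbrev Slots (V : Type) (t : ℕ) : Type := V → Fin t → Option (V × Fin t)

/-- What happens to a vertex in a round. -/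
inductive Fate (V : Type) (t : ℕ) : Type
  | keep : Fate V t
  | finalize : Fate V t
  | rake (v : V) (p : Fin t) : Fate V t
  | compress (v : V) (p : Fin t) (v' : V) (p' : Fin t) : Fate V t

section Slots

variable {V : Type} {t : ℕ}

/-- The filled slots of `u`. -/
def nbrs (σ : Slots V t) (u : V) : List (V × Fin t) := (List.finRange t).filterMap (σ u)

/-- The number of filled slots of `u`. -/
def deg (σ : Slots V t) (u : V) : ℕ := (Finset.univ.filter (fun j => (σ u j).isSome)).card

theorem mem_nbrs {σ : Slots V t} {u : V} {x : V × Fin t} :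
    x ∈ nbrs σ u ↔ ∃ j, σ u j = some x := by
  simp [nbrs]

theorem length_nbrs (σ : Slots V t) (u : V) : (nbrs σ u).length = deg σ u := by
  rw [nbrs, List.length_filterMap_eq_countP, deg, List.countP_eq_length_filter]
  rw [← List.toFinset_card_of_nodup ((List.nodup_finRange t).filter _)]
  congr 1
  ext j
  simp

theorem deg_congr {σ σ' : Slots V t} {u : V} (h : σ u = σ' u) : deg σ u = deg σ' u := by
  simp [deg, h]

theorem nbrs_congr {σ σ' : Slots V t} {u : V} (h : σ u = σ' u) : nbrs σ u = nbrs σ' u := by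
  simp [nbrs, h]

theorem deg_eq_one {σ : Slots V t} {u : V} :
    deg σ u = 1 ↔ ∃ j x, σ u j = some x ∧ ∀ i y, σ u i = some y → i = j := by
  rw [deg, Finset.card_eq_one]
  constructor
  · rintro ⟨j, hj⟩
    have h1 : j ∈ Finset.univ.filter (fun j => (σ u j).isSome) := by rw [hj]; simp
    obtain ⟨x, hx⟩ := Option.isSome_iff_exists.mp (Finset.mem_filter.mp h1).2
    refine ⟨j, x, hx, fun i y hy => ?_⟩
    have : i ∈ Finset.univ.filter (fun j => (σ u j).isSome) := by simp [hy]
    rw [hj] at this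
    simpa using this
  · rintro ⟨j, x, hx, h⟩
    refine ⟨j, ?_⟩
    ext i
    simp only [Finset.mem_filter, Finset.mem_univ, true_and, Finset.mem_singleton,
      Option.isSome_iff_exists]
    constructor
    · rintro ⟨y, hy⟩; exact h i y hy
    · rintro rfl; exact ⟨x, hx⟩

variable [LinearOrder V]

/-- The fate of vertex `u` in a round with adjacency lists `σ` and coins `h`. -/
def fate (σ : Slots V t) (h : V → Bool) (u : V) : Fate V t :=
  match nbrs σ u with
  | [] => .finalize
  | [(v, p)] => if deg σ v ≠ 1 ∨ u < v then .rake v p else .keep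
  | [(v, p), (v', p')] =>
      if deg σ v ≠ 1 ∧ deg σ v' ≠ 1 ∧ (h u = true ∧ h v = false ∧ h v' = false) then
        .compress v p v' p'
      else .keep
  | _ => .keep

/-- The content of slot `j` of a surviving vertex `u` after a round. -/
def newSlot (σ : Slots V t) (h : V → Bool) (u : V) (j : Fin t) : Option (V × Fin t) :=
  match σ u j with
  | none => none
  | some (x, q) =>
      match fate σ h x with
      | .keep => some (x, q)
      | .finalize => none
      | .rake _ _ => none
      | .compress v p v' p' => if (v, p) = (u, j) then some (v', p') else some (v, p)

/-- The alive vertices and the adjacency lists (empty for deleted vertices). -/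
abbrev State (V : Type) (t : ℕ) : Type := Finset V × Slots V t

noncomputable instance : DecidableEq (Fate V t) := Classical.decEq _

/-- One round of tree contraction. -/
noncomputable def nextState (s : State V t) (h : V → Bool) : State V t :=
  (s.1.filter (fun u => fate s.2 h u = .keep),
    fun u j => if u ∈ s.1 ∧ fate s.2 h u = .keep then newSlot s.2 h u j else none)

/-- The adjacency lists describe a forest in which every vertex has at most one neighbor of higher
rank. -/
structure IsForest (ρ : V → ℕ) (s : State V t) : Prop where
  inj : Function.Injective ρ
  symm : ∀ {u j v p}, s.2 u j = some (v, p) → s.2 v p = some (u, j)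
  irrefl : ∀ {u j v p}, s.2 u j = some (v, p) → v ≠ u
  up : ∀ {u j j' v v' p p'}, s.2 u j = some (v, p) → s.2 u j' = some (v', p') →
    ρ u < ρ v → ρ u < ρ v' → j = j'
  alive : ∀ {u j v p}, s.2 u j = some (v, p) → u ∈ s.1

/-! ### Ranked forests and the effect of one contraction round -/

namespace IsForest

variable {ρ : V → ℕ} {s : State V t} {h : V → Bool}

theorem alive' (hs : IsForest ρ s) {u j v p} (e : s.2 u j = some (v, p)) : v ∈ s.1 :=
  hs.alive (hs.symm e)

theorem slot_inj (hs : IsForest ρ s) {u j u' j' x} (e : s.2 u j = some x)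
    (e' : s.2 u' j' = some x) : u = u' ∧ j = j' := by
  obtain ⟨v, p⟩ := x
  have := (hs.symm e).symm.trans (hs.symm e')
  simpa using this

/-- Multiple edges are excluded by `up`, which is stated for slots and not for vertices: the lower
end of a doubled edge would have two upward slots. So simplicity is no separate invariant. -/
theorem unique (hs : IsForest ρ s) {u j j' v p p'} (e : s.2 u j = some (v, p))
    (e' : s.2 u j' = some (v, p')) : j = j' := by
  rcases lt_trichotomy (ρ u) (ρ v) with hlt | heq | hgt
  · exact hs.up e e' hlt hlt
  · exact absurd (hs.inj heq).symm (hs.irrefl e)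
  · obtain rfl := hs.up (hs.symm e) (hs.symm e') hgt hgt
    exact (hs.slot_inj e e').2

theorem fate_finalize (hf : fate s.2 h u = .finalize) : ∀ j, s.2 u j = none := by
  intro j
  have hn : nbrs s.2 u = [] := by
    rw [fate] at hf
    split at hf <;> try split at hf
    all_goals simp_all
  by_contra hj
  obtain ⟨x, hx⟩ := Option.ne_none_iff_exists'.mp hj
  have := mem_nbrs.mpr ⟨j, hx⟩
  simp [hn] at this

theorem nbrs_singleton {u : V} {x} (hn : nbrs s.2 u = [x]) :
    deg s.2 u = 1 ∧ ∃ j, s.2 u j = some x ∧ ∀ i y, s.2 u i = some y → i = j := by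
  have h1 : deg s.2 u = 1 := by rw [← length_nbrs, hn]; rfl
  refine ⟨h1, ?_⟩
  obtain ⟨j, y, hy, hj⟩ := deg_eq_one.mp h1
  have : y ∈ nbrs s.2 u := mem_nbrs.mpr ⟨j, hy⟩
  rw [hn, List.mem_singleton] at this
  exact ⟨j, this ▸ hy, hj⟩

theorem nbrs_pair (hs : IsForest ρ s) {u : V} {x y} (hn : nbrs s.2 u = [x, y]) :
    deg s.2 u = 2 ∧ ∃ j j', j ≠ j' ∧ s.2 u j = some x ∧ s.2 u j' = some y ∧
      ∀ i z, s.2 u i = some z → i = j ∨ i = j' := by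
  have h1 : deg s.2 u = 2 := by rw [← length_nbrs, hn]; rfl
  refine ⟨h1, ?_⟩
  obtain ⟨a, b, hab, heq⟩ := Finset.card_eq_two.mp h1
  have hmem : ∀ i z, s.2 u i = some z → i = a ∨ i = b := by
    intro i z hz
    have : i ∈ Finset.univ.filter (fun j => (s.2 u j).isSome) := by simp [hz]
    rw [heq] at this
    simpa using this
  have ha : a ∈ Finset.univ.filter (fun j => (s.2 u j).isSome) := by rw [heq]; simp
  have hb : b ∈ Finset.univ.filter (fun j => (s.2 u j).isSome) := by rw [heq]; simp
  obtain ⟨xa, hxa⟩ := Option.isSome_iff_exists.mp (Finset.mem_filter.mp ha).2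
  obtain ⟨xb, hxb⟩ := Option.isSome_iff_exists.mp (Finset.mem_filter.mp hb).2
  have hne : xa ≠ xb := by
    rintro rfl
    exact hab (hs.slot_inj hxa hxb).2
  have h2 : xa ∈ nbrs s.2 u := mem_nbrs.mpr ⟨a, hxa⟩
  have h3 : xb ∈ nbrs s.2 u := mem_nbrs.mpr ⟨b, hxb⟩
  rw [hn] at h2 h3
  simp only [List.mem_cons, List.not_mem_nil, or_false] at h2 h3
  rcases h2 with rfl | rfl <;> rcases h3 with rfl | rfl
  · exact absurd rfl hne
  · exact ⟨a, b, hab, hxa, hxb, hmem⟩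
  · exact ⟨b, a, hab.symm, hxb, hxa, fun i z hz => (hmem i z hz).symm⟩
  · exact absurd rfl hne

theorem fate_rake {u v p} (hf : fate s.2 h u = .rake v p) :
    deg s.2 u = 1 ∧ (deg s.2 v ≠ 1 ∨ u < v) ∧
      ∃ j, s.2 u j = some (v, p) ∧ ∀ i y, s.2 u i = some y → i = j := by
  rw [fate] at hf
  split at hf <;> try split at hf
  all_goals try (simp at hf; done)
  rename_i hn hc
  simp only [Fate.rake.injEq] at hf
  obtain ⟨rfl, rfl⟩ := hf
  exact ⟨(nbrs_singleton hn).1, hc, (nbrs_singleton hn).2⟩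

theorem nbrs_of_compress {u v p v' p'} (hf : fate s.2 h u = .compress v p v' p') :
    nbrs s.2 u = [(v, p), (v', p')] ∧ deg s.2 v ≠ 1 ∧ deg s.2 v' ≠ 1 ∧
      h u = true ∧ h v = false ∧ h v' = false := by
  rw [fate] at hf
  split at hf <;> try split at hf
  all_goals try (simp at hf; done)
  rename_i hn hc
  simp only [Fate.compress.injEq] at hf
  obtain ⟨rfl, rfl, rfl, rfl⟩ := hf
  exact ⟨hn, hc⟩

theorem fate_compress (hs : IsForest ρ s) {u v p v' p'}
    (hf : fate s.2 h u = .compress v p v' p') :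
    deg s.2 u = 2 ∧ h u = true ∧
      (∃ j j', j ≠ j' ∧ s.2 u j = some (v, p) ∧ s.2 u j' = some (v', p') ∧
        ∀ i z, s.2 u i = some z → i = j ∨ i = j') ∧
      ∀ i x q, s.2 u i = some (x, q) → deg s.2 x ≠ 1 ∧ h x = false := by
  obtain ⟨hn, h1, h2, h3, h4, h5⟩ := nbrs_of_compress hf
  refine ⟨(hs.nbrs_pair hn).1, h3, (hs.nbrs_pair hn).2, fun i x q e => ?_⟩
  have := mem_nbrs.mpr ⟨i, e⟩
  rw [hn] at this
  simp only [List.mem_cons, Prod.mk.injEq, List.not_mem_nil, or_false] at this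
  rcases this with ⟨rfl, rfl⟩ | ⟨rfl, rfl⟩
  · exact ⟨h1, h4⟩
  · exact ⟨h2, h5⟩

theorem deg_le_two_of_ne_keep (hs : IsForest ρ s) {u} (hf : fate s.2 h u ≠ .keep) :
    deg s.2 u ≤ 2 := by
  cases hfu : fate s.2 h u with
  | keep => exact absurd hfu hf
  | finalize =>
    have := fate_finalize hfu
    simp [deg, this]
  | rake v p => rw [(fate_rake hfu).1]; omega
  | compress v p v' p' => rw [(hs.fate_compress hfu).1]

/-- A vertex with a filled slot that is neither a leaf nor flips heads survives. -/
theorem keep_of_tails (hs : IsForest ρ s) {x b y} (e : s.2 x b = some y) (hd : deg s.2 x ≠ 1)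
    (hh : h x = false) : fate s.2 h x = .keep := by
  cases hfx : fate s.2 h x with
  | keep => rfl
  | finalize => simp [fate_finalize hfx] at e
  | rake v p => exact absurd (fate_rake hfx).1 hd
  | compress v p v' p' =>
    have := (hs.fate_compress hfx).2.1
    simp [hh] at this

/-- The neighbors of a deleted vertex survive. -/
theorem nbr_keep (hs : IsForest ρ s) {x b y q} (hf : fate s.2 h x ≠ .keep)
    (e : s.2 x b = some (y, q)) : fate s.2 h y = .keep := by
  cases hfx : fate s.2 h x with
  | keep => exact absurd hfx hf
  | finalize => simp [fate_finalize hfx] at e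
  | rake v p =>
    obtain ⟨h1, h2, j, hj, hall⟩ := fate_rake hfx
    obtain rfl := hall _ _ e
    obtain ⟨rfl, rfl⟩ : v = y ∧ p = q := by simpa using hj.symm.trans e
    cases hfy : fate s.2 h v with
    | keep => rfl
    | finalize =>
      have := hs.symm e
      simp [fate_finalize hfy] at this
    | rake w r =>
      obtain ⟨h3, h4, j', hj', hall'⟩ := fate_rake hfy
      obtain rfl := hall' _ _ (hs.symm e)
      -- Two adjacent leaves cannot both rake, because each would have to precede the other.
      obtain ⟨rfl, rfl⟩ : x = w ∧ b = r := by simpa using (hs.symm e).symm.trans hj'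
      rcases h2 with h2 | h2
      · exact absurd h3 h2
      · rcases h4 with h4 | h4
        · exact absurd h1 h4
        · exact absurd h2 (lt_asymm h4)
    | compress w r w' r' =>
      exact absurd h1 ((hs.fate_compress hfy).2.2.2 _ _ _ (hs.symm e)).1
  | compress v p v' p' =>
    obtain ⟨h1, h2⟩ := (hs.fate_compress hfx).2.2.2 _ _ _ e
    -- The conditions for compressing `x` make each neighbor a non-leaf showing tails, which rules
    -- out every deletion rule for it.
    exact hs.keep_of_tails (hs.symm e) h1 h2

/-- The fate of a leaf. -/
theorem fate_leaf {x b u j} (hd : deg s.2 x = 1)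
    (e : s.2 x b = some (u, j)) :
    fate s.2 h x = if deg s.2 u ≠ 1 ∨ x < u then .rake u j else .keep := by
  have hl : (nbrs s.2 x).length = 1 := by rw [length_nbrs, hd]
  obtain ⟨y, hy⟩ := List.length_eq_one_iff.mp hl
  have : (u, j) ∈ nbrs s.2 x := mem_nbrs.mpr ⟨b, e⟩
  rw [hy, List.mem_singleton] at this
  subst this
  rw [fate, hy]

theorem mem_next {u} : u ∈ (nextState s h).1 ↔ u ∈ s.1 ∧ fate s.2 h u = .keep := by
  simp [nextState]

/-- The slots of surviving vertices after a round: an edge either persists or arises by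
compressing a common neighbor. -/
theorem next_slot (hs : IsForest ρ s) {u j y q} :
    (nextState s h).2 u j = some (y, q) ↔ u ∈ s.1 ∧ fate s.2 h u = .keep ∧
      ((s.2 u j = some (y, q) ∧ fate s.2 h y = .keep) ∨
        ∃ x a b, s.2 u j = some (x, a) ∧ s.2 x b = some (y, q) ∧ a ≠ b ∧
          fate s.2 h x ≠ .keep) := by
  by_cases hu : u ∈ s.1 ∧ fate s.2 h u = .keep
  swap
  · simp only [nextState, if_neg hu]
    constructor
    · intro h'; simp at h'
    · rintro ⟨h1, h2, -⟩; exact absurd ⟨h1, h2⟩ hu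
  obtain ⟨hu1, hu2⟩ := hu
  simp only [nextState, hu1, hu2, and_self, if_true, true_and]
  cases hj : s.2 u j with
  | none => simp [newSlot, hj]
  | some xa =>
    obtain ⟨x, a⟩ := xa
    have hx := hs.symm hj
    simp only [newSlot, hj]
    cases hfx : fate s.2 h x with
    | keep =>
      simp only [Option.some.injEq, Prod.mk.injEq]
      constructor
      · rintro ⟨rfl, rfl⟩; exact Or.inl ⟨⟨rfl, rfl⟩, hfx⟩
      · rintro (⟨h1, -⟩ | ⟨x', a', b, ⟨rfl, rfl⟩, -, -, h4⟩)
        · exact h1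
        · exact absurd hfx h4
    | finalize => simp [fate_finalize hfx] at hx
    | rake v p =>
      simp only [Option.some.injEq, Prod.mk.injEq, reduceCtorEq, false_iff, not_or]
      refine ⟨?_, ?_⟩
      · rintro ⟨⟨rfl, rfl⟩, h1⟩
        simp [hfx] at h1
      · rintro ⟨x', a', b, ⟨rfl, rfl⟩, h2, h3, -⟩
        obtain ⟨-, -, i, -, hall⟩ := fate_rake hfx
        exact h3 ((hall _ _ hx).trans (hall _ _ h2).symm)
    | compress v p v' p' =>
      obtain ⟨-, -, ⟨j1, j2, h12, e1, e2, hall⟩, -⟩ := hs.fate_compress hfx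
      simp only [Option.some.injEq, Prod.mk.injEq]
      by_cases hvu : v = u ∧ p = j
      · obtain ⟨rfl, rfl⟩ := hvu
        have ha : a = j1 := (hs.slot_inj hx e1).2
        subst ha
        simp only [and_self, if_true, Option.some.injEq, Prod.mk.injEq]
        constructor
        · rintro ⟨rfl, rfl⟩
          exact Or.inr ⟨x, a, j2, ⟨rfl, rfl⟩, e2, h12, by simp [hfx]⟩
        · rintro (⟨⟨rfl, rfl⟩, h1⟩ | ⟨x', a', b, ⟨rfl, rfl⟩, h2, h3, -⟩)
          · simp [hfx] at h1
          · rcases hall _ _ h2 with rfl | rfl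
            · exact absurd rfl h3
            · simpa using e2.symm.trans h2
      · have ha : a = j2 := by
          rcases hall _ _ hx with rfl | rfl
          · have := e1.symm.trans hx
            simp only [Option.some.injEq, Prod.mk.injEq] at this
            exact absurd this hvu
          · rfl
        subst ha
        simp only [hvu, if_false, Option.some.injEq, Prod.mk.injEq]
        constructor
        · rintro ⟨rfl, rfl⟩
          exact Or.inr ⟨x, a, j1, ⟨rfl, rfl⟩, e1, h12.symm, by simp [hfx]⟩
        · rintro (⟨⟨rfl, rfl⟩, h1⟩ | ⟨x', a', b, ⟨rfl, rfl⟩, h2, h3, -⟩)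
          · simp [hfx] at h1
          · rcases hall _ _ h2 with rfl | rfl
            · simpa using e1.symm.trans h2
            · exact absurd rfl h3

/-- A higher neighbor after a round sits in a slot that held a higher neighbor before. -/
theorem next_up (hs : IsForest ρ s) {u j y q} (e : (nextState s h).2 u j = some (y, q))
    (hlt : ρ u < ρ y) : ∃ x a, s.2 u j = some (x, a) ∧ ρ u < ρ x := by
  obtain ⟨hu, hk, ⟨h1, h2⟩ | ⟨x, a, b, h1, h2, h3, h4⟩⟩ := hs.next_slot.mp e
  · exact ⟨y, q, h1, hlt⟩
  · refine ⟨x, a, h1, ?_⟩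
    -- If the removed vertex `x` ranked below `u`, both `u` and `y` would be higher neighbors of
    -- `x`.
    by_contra hle
    have hne : ρ x ≠ ρ u := fun h' => hs.irrefl h1 (hs.inj h')
    have hlt' : ρ x < ρ u := by omega
    exact h3 (hs.up (hs.symm h1) h2 hlt' (hlt'.trans hlt))

/-- Deleted vertices have surviving neighbors, so a new edge comes from compressing exactly one
vertex. A loop would need two slots of that vertex to hold the same neighbor. By `next_up` every
upward slot was upward before, so a vertex still has at most one. -/
theorem next (hs : IsForest ρ s) : IsForest ρ (nextState s h) where
  inj := hs.inj
  symm := by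
    intro u j v p e
    obtain ⟨hu, hk, ⟨h1, h2⟩ | ⟨x, a, b, h1, h2, h3, h4⟩⟩ := hs.next_slot.mp e
    · exact hs.next_slot.mpr ⟨hs.alive' h1, h2, Or.inl ⟨hs.symm h1, hk⟩⟩
    · exact hs.next_slot.mpr ⟨hs.alive' h2, hs.nbr_keep h4 h2,
        Or.inr ⟨x, b, a, hs.symm h2, hs.symm h1, h3.symm, h4⟩⟩
  irrefl := by
    rintro u j v p e rfl
    obtain ⟨hu, hk, ⟨h1, h2⟩ | ⟨x, a, b, h1, h2, h3, h4⟩⟩ := hs.next_slot.mp e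
    · exact hs.irrefl h1 rfl
    · exact h3 (hs.unique (hs.symm h1) h2)
  up := by
    intro u j j' v v' p p' e e' hlt hlt'
    obtain ⟨x, a, h1, h2⟩ := hs.next_up e hlt
    obtain ⟨x', a', h1', h2'⟩ := hs.next_up e' hlt'
    exact hs.up h1 h1' h2 h2'
  alive := by
    intro u j v p e
    obtain ⟨hu, hk, -⟩ := hs.next_slot.mp e
    exact mem_next.mpr ⟨hu, hk⟩

/-- A leaf adjacent to a surviving vertex always rakes: otherwise both ends would be leaves and the
survivor, being the smaller, would itself have raked. A neighbor that is not a leaf either stays or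
is compressed, which refills the slot. This is why counting non-leaf neighbors yields the next leaf
flag. -/
theorem next_isSome (hs : IsForest ρ s) {u j} (hu : u ∈ s.1) (hk : fate s.2 h u = .keep) :
    ((nextState s h).2 u j).isSome ↔ ∃ x q, s.2 u j = some (x, q) ∧ deg s.2 x ≠ 1 := by
  cases hj : s.2 u j with
  | none => simp [nextState, newSlot, hj]
  | some xa =>
    obtain ⟨x, a⟩ := xa
    have hx := hs.symm hj
    have hrhs : (∃ x' q, some (x, a) = some (x', q) ∧ deg s.2 x' ≠ 1) ↔ deg s.2 x ≠ 1 := by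
      constructor
      · rintro ⟨x', q, h1, h2⟩
        simp only [Option.some.injEq, Prod.mk.injEq] at h1
        rwa [h1.1]
      · intro h1; exact ⟨x, a, rfl, h1⟩
    rw [hrhs]
    simp only [nextState, hu, hk, and_self, if_true, newSlot, hj]
    by_cases hd : deg s.2 x = 1
    · have hux : deg s.2 u ≠ 1 ∨ x < u := by
        by_contra hcon
        push Not at hcon
        have hlt : u < x := lt_of_le_of_ne hcon.2 (hs.irrefl hj).symm
        have := fate_leaf (h := h) hcon.1 hj
        rw [if_pos (Or.inr hlt), hk] at this
        simp at this
      rw [fate_leaf hd hx, if_pos hux]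
      simp [hd]
    · simp only [ne_eq, hd, not_false_eq_true, iff_true]
      cases hfx : fate s.2 h x with
      | keep => rfl
      | finalize => simp [fate_finalize hfx] at hx
      | rake v p => exact absurd (fate_rake hfx).1 hd
      | compress v p v' p' => simp only; split <;> rfl

end IsForest
end Slots
end TreeContraction

/-! ### Traces and results of composed programs -/

namespace RoundBased.Prog

variable {Loc : Type} {Val : Loc → Type} {α β : Type}

/-- The value returned by a round computation that sees memory `m`; `none` if it gets stuck. -/
def result (m : Memory Loc Val) : Prog Loc Val α → Option α
  | .done a => some a
  | .readThen l k => match m l with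
    | none => none
    | some v => (k v).result m
  | .writeThen _ _ k => k.result m
  | .retireThen k => k.result m
  | .stepThen k => k.result m

theorem trace_bind {m : Memory Loc Val} {p : Prog Loc Val α} {a : α} (f : α → Prog Loc Val β)
    (h : p.result m = some a) : (p >>= f).trace m = p.trace m ++ (f a).trace m := by
  change (p.andThen f).trace m = _
  induction p with
  | done b => simp only [result, Option.some.injEq] at h; subst h; simp [andThen, trace]
  | readThen l k ih =>
    simp only [result] at h
    cases hl : m l with
    | none => simp [hl] at h
    | some v =>
      rw [hl] at h
      simp [andThen, trace, hl, ih v h]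
  | writeThen l v k ih => simp only [result] at h; simp [andThen, trace, ih h]
  | retireThen k ih => simp only [result] at h; simp [andThen, trace, ih h]
  | stepThen k ih => simp only [result] at h; simp [andThen, trace, ih h]

theorem result_bind {m : Memory Loc Val} {p : Prog Loc Val α} {a : α} (f : α → Prog Loc Val β)
    (h : p.result m = some a) : (p >>= f).result m = (f a).result m := by
  change (p.andThen f).result m = _
  induction p with
  | done b => simp only [result, Option.some.injEq] at h; subst h; simp [andThen]
  | readThen l k ih =>
    simp only [result] at h
    cases hl : m l with
    | none => simp [hl] at h
    | some v =>
      rw [hl] at h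
      simp [andThen, result, hl, ih v h]
  | writeThen l v k ih => simp only [result] at h; simp [andThen, result, ih h]
  | retireThen k ih => simp only [result] at h; simp [andThen, result, ih h]
  | stepThen k ih => simp only [result] at h; simp [andThen, result, ih h]

theorem trace_pure (m : Memory Loc Val) (a : α) : (pure a : Prog Loc Val α).trace m = [] := rfl

theorem trace_steps (m : Memory Loc Val) (c : ℕ) :
    (steps c : Prog Loc Val Unit).trace m = List.replicate c .step := by
  induction c with
  | zero => rfl
  | succ c ih => simp [steps, trace, ih, List.replicate_succ]

theorem result_steps (m : Memory Loc Val) (c : ℕ) :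
    (steps c : Prog Loc Val Unit).result m = some () := by
  induction c with
  | zero => rfl
  | succ c ih => simp [steps, result, ih]

theorem trace_read {m : Memory Loc Val} {l : Loc} {v : Val l} (h : m l = some v) :
    (read l : Prog Loc Val (Val l)).trace m = [.read l] := by
  simp [read, trace, h]

theorem result_read {m : Memory Loc Val} {l : Loc} {v : Val l} (h : m l = some v) :
    (read l : Prog Loc Val (Val l)).result m = some v := by
  simp [read, result, h]

theorem trace_steps_bind (m : Memory Loc Val) (c : ℕ) (f : Unit → Prog Loc Val β) :
    (steps c >>= f).trace m = List.replicate c .step ++ (f ()).trace m := by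
  rw [trace_bind f (result_steps m c), trace_steps]

theorem result_steps_bind (m : Memory Loc Val) (c : ℕ) (f : Unit → Prog Loc Val β) :
    (steps c >>= f).result m = (f ()).result m :=
  result_bind f (result_steps m c)

theorem trace_read_bind {m : Memory Loc Val} {l : Loc} {v : Val l} (h : m l = some v)
    (f : Val l → Prog Loc Val β) :
    (read l >>= f).trace m = .read l :: (f v).trace m := by
  rw [trace_bind f (result_read h), trace_read h]; rfl

theorem result_read_bind {m : Memory Loc Val} {l : Loc} {v : Val l} (h : m l = some v)
    (f : Val l → Prog Loc Val β) :
    (read l >>= f).result m = (f v).result m :=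
  result_bind f (result_read h)

theorem trace_write_bind (m : Memory Loc Val) (l : Loc) (v : Val l)
    (f : Unit → Prog Loc Val β) :
    (write l v >>= f).trace m = .write l v :: (f ()).trace m := rfl

theorem result_write_bind (m : Memory Loc Val) (l : Loc) (v : Val l)
    (f : Unit → Prog Loc Val β) :
    (write l v >>= f).result m = (f ()).result m := rfl

end RoundBased.Prog

/-! ### The trace of a contraction round -/

namespace TreeContraction
open RoundBased RoundBased.Prog

section Semantics

variable {V : Type} {t : ℕ}

/-- The instructions of the loop of `doAlive` for one slot. -/
def slotEvents (r : ℕ) (u : V) : Fin t × Option (V × Fin t) → List (Event (Loc V t) Val)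
  | (j, some (v, p)) =>
      [.step, .write (.adj (r + 1) v p) (some (u, j)), .read (.leaf r v), .step]
  | (j, none) => [.step, .write (.adj (r + 1) u j) none]

/-- Whether a slot holds a neighbor that is not a leaf. -/
def holdsNonleaf (σ : Slots V t) : Option (V × Fin t) → Bool
  | some (v, _) => decide (deg σ v ≠ 1)
  | none => false

/-- The instructions of `doAlive`. -/
def aliveEvents (r : ℕ) (u : V) (σ : Slots V t) : List (Event (Loc V t) Val) :=
  .step :: ((List.finRange t).flatMap (fun j => slotEvents r u (j, σ u j)) ++
    [.step, .write (.leaf (r + 1) u)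
      (decide ((List.finRange t).countP (fun j => holdsNonleaf σ (σ u j)) = 1))])

/-- The final instructions of a round computation, according to the fate of the vertex. -/
def fateEvents (r : ℕ) (u : V) (σ : Slots V t) : Fate V t → List (Event (Loc V t) Val)
  | .keep => aliveEvents r u σ
  | .finalize => [.write (.del u) r, .retire]
  | .rake v p => [.write (.adj (r + 1) v p) none, .write (.del u) r, .retire]
  | .compress v p v' p' =>
      [.write (.adj (r + 1) v p) (some (v', p')), .write (.adj (r + 1) v' p') (some (v, p)),
        .write (.del u) r, .retire]

/-- The shared memory at the beginning of round `r` represents the state `s`. -/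
structure Represents (m : Memory (Loc V t) Val) (r : ℕ) (s : State V t) : Prop where
  adj : ∀ u ∈ s.1, ∀ j, m (.adj r u j) = some (s.2 u j)
  leaf : ∀ u ∈ s.1, m (.leaf r u) = some (decide (deg s.2 u = 1))
  adj_fresh : ∀ i, r < i → ∀ u j, m (.adj i u j) = none
  leaf_fresh : ∀ i, r < i → ∀ u, m (.leaf i u) = none
  del_fresh : ∀ u ∈ s.1, m (.del u) = none

theorem readSlots_spec {m : Memory (Loc V t) Val} {r : ℕ} {u : V} {σ : Slots V t}
    (h : ∀ j, m (.adj r u j) = some (σ u j)) (js : List (Fin t)) :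
    (readSlots r u js).trace m = js.map (fun j => .read (.adj r u j)) ∧
      (readSlots r u js).result m = some (js.map (fun j => (j, σ u j))) := by
  induction js with
  | nil => exact ⟨rfl, rfl⟩
  | cons j js ih =>
    constructor
    · rw [readSlots, trace_read_bind (h j), trace_bind _ ih.2, ih.1]
      simp [trace_pure]
    · rw [readSlots, result_read_bind (h j), result_bind _ ih.2]
      rfl

theorem aliveLoop_spec {m : Memory (Loc V t) Val} {r : ℕ} {u : V} {σ : Slots V t}
    (h : ∀ j v p, σ u j = some (v, p) → m (.leaf r v) = some (decide (deg σ v = 1)))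
    (js : List (Fin t)) (c : ℕ) :
    (aliveLoop r u (js.map (fun j => (j, σ u j))) c).trace m =
        js.flatMap (fun j => slotEvents r u (j, σ u j)) ∧
      (aliveLoop r u (js.map (fun j => (j, σ u j))) c).result m =
        some (c + js.countP (fun j => holdsNonleaf σ (σ u j))) := by
  induction js generalizing c with
  | nil => exact ⟨rfl, rfl⟩
  | cons j js ih =>
    simp only [List.map_cons, List.flatMap_cons, List.countP_cons]
    cases hj : σ u j with
    | none =>
      simp only [aliveLoop, trace_steps_bind, trace_write_bind, result_steps_bind,
        result_write_bind, (ih c).1, (ih c).2, slotEvents, holdsNonleaf]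
      simp
    | some x =>
      obtain ⟨v, p⟩ := x
      have hl := h j v p hj
      simp only [aliveLoop, trace_steps_bind, trace_write_bind, result_steps_bind,
        result_write_bind, trace_read_bind hl, result_read_bind hl, (ih _).1, (ih _).2,
        slotEvents, holdsNonleaf]
      constructor
      · simp
      · by_cases hd : deg σ v = 1
        · simp [hd]
        · simp [hd]; omega

variable [LinearOrder V]

theorem doAlive_trace {m : Memory (Loc V t) Val} {r : ℕ} {u : V} {σ : Slots V t}
    (h : ∀ j v p, σ u j = some (v, p) → m (.leaf r v) = some (decide (deg σ v = 1))) :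
    (doAlive r u ((List.finRange t).map (fun j => (j, σ u j)))).trace m = aliveEvents r u σ := by
  have := aliveLoop_spec h (List.finRange t) 0
  rw [doAlive, trace_steps_bind, trace_bind _ this.2, this.1, trace_steps_bind]
  simp [aliveEvents, write, trace]

variable {ρ : V → ℕ} {s : State V t} {h : V → Bool}

/-- A round computation consists of steps and reads of its own and its neighbors' data, followed
by the instructions that belong to its fate. -/
theorem trace_computeRound {m : Memory (Loc V t) Val} {heads : ℕ → V → Bool} {r : ℕ} {u : V}
    (hm : Represents m r s) (hs : IsForest ρ s) (hu : u ∈ s.1) :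
    ∃ pre : List (Event (Loc V t) Val),
      (∀ e ∈ pre, e = .step ∨ (∃ j, e = .read (.adj r u j)) ∨ e = .read (.leaf r u) ∨
        ∃ j v p, s.2 u j = some (v, p) ∧ e = .read (.leaf r v)) ∧
      pre.length ≤ 2 * t + 10 ∧
      (computeRound heads r u).trace m =
        pre ++ fateEvents r u s.2 (fate s.2 (heads r) u) := by
  have hspec := readSlots_spec (hm.adj u hu) (List.finRange t)
  have hleaf : ∀ j v p, s.2 u j = some (v, p) →
      m (.leaf r v) = some (decide (deg s.2 v = 1)) :=
    fun j v p e => hm.leaf v (hs.alive' e)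
  have hal := doAlive_trace hleaf
  have hl := hm.leaf u hu
  have hnb : ((List.finRange t).map (fun j => (j, s.2 u j))).filterMap Prod.snd = nbrs s.2 u := by
    rw [List.filterMap_map]; rfl
  have hlen := length_nbrs s.2 u
  rw [computeRound, trace_bind _ hspec.2, hspec.1, trace_read_bind hl, trace_steps_bind, hnb]
  -- The common beginning has length `2 * t + 1`; the tests that depend on the number of neighbors
  -- add at most nine further instructions.
  set base : List (Event (Loc V t) Val) :=
    (List.finRange t).map (fun j => .read (.adj r u j)) ++ .read (.leaf r u) ::
      List.replicate t .step with hbase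
  have hb1 : ∀ e ∈ base, e = .step ∨ (∃ j, e = .read (.adj r u j)) ∨ e = .read (.leaf r u) ∨
        ∃ j v p, s.2 u j = some (v, p) ∧ e = .read (.leaf r v) := by
    intro e he
    simp only [hbase, List.mem_append, List.mem_map, List.mem_cons, List.mem_replicate] at he
    rcases he with ⟨j, -, rfl⟩ | rfl | ⟨-, rfl⟩
    · exact Or.inr (Or.inl ⟨j, rfl⟩)
    · exact Or.inr (Or.inr (Or.inl rfl))
    · exact Or.inl rfl
  have hb2 : base.length = 2 * t + 1 := by simp [hbase]; omega
  have hmem : ∀ v p, (v, p) ∈ nbrs s.2 u → ∃ j v' p', s.2 u j = some (v', p') ∧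
      (Event.read (.leaf r v) : Event (Loc V t) Val) = .read (.leaf r v') := by
    intro v p hvp
    obtain ⟨j, hj⟩ := mem_nbrs.mp hvp
    exact ⟨j, v, p, hj, rfl⟩
  have hlf : ∀ v p, (v, p) ∈ nbrs s.2 u → m (.leaf r v) = some (decide (deg s.2 v = 1)) := by
    intro v p hvp
    obtain ⟨j, hj⟩ := mem_nbrs.mp hvp
    exact hleaf j v p hj
  suffices hrest : ∀ tr : List (Event (Loc V t) Val), (∃ mid : List (Event (Loc V t) Val),
      (∀ e ∈ mid, e = .step ∨ ∃ v p, (v, p) ∈ nbrs s.2 u ∧ e = .read (.leaf r v)) ∧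
      mid.length ≤ 9 ∧ tr = mid ++ fateEvents r u s.2 (fate s.2 (heads r) u)) →
      ∃ pre : List (Event (Loc V t) Val),
      (∀ e ∈ pre, e = .step ∨ (∃ j, e = .read (.adj r u j)) ∨ e = .read (.leaf r u) ∨
        ∃ j v p, s.2 u j = some (v, p) ∧ e = .read (.leaf r v)) ∧
      pre.length ≤ 2 * t + 10 ∧
      (List.finRange t).map (fun j => .read (.adj r u j)) ++ .read (.leaf r u) ::
      (List.replicate t .step ++ tr) = pre ++ fateEvents r u s.2 (fate s.2 (heads r) u) by
    apply hrest
    cases hn : nbrs s.2 u with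
    | nil => exact ⟨[], by simp, by simp, by simp only [fate, hn]; rfl⟩
    | cons x others =>
      obtain ⟨v, p⟩ := x
      have hv := hlf v p (by simp [hn])
      cases others with
      | nil =>
        have hd : deg s.2 u = 1 := by rw [← hlen, hn]; rfl
        refine ⟨[.step, .read (.leaf r v), .step], by simp, by simp, ?_⟩
        simp only [trace_steps_bind, hd, decide_true, if_true, trace_read_bind hv]
        by_cases hc : deg s.2 v ≠ 1 ∨ u < v
        · have hc' : decide (deg s.2 v = 1) = false ∨ u < v := by simpa using hc
          simp only [fate, hn, if_pos hc, if_pos hc']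
          rfl
        · have hc' : ¬ (decide (deg s.2 v = 1) = false ∨ u < v) := by simpa using hc
          simp only [fate, hn, if_neg hc, if_neg hc', hal, fateEvents]
          rfl
      | cons y others =>
        obtain ⟨v', p'⟩ := y
        have hv' := hlf v' p' (by simp [hn])
        have hd : deg s.2 u ≠ 1 := by rw [← hlen, hn]; simp
        cases others with
        | nil =>
          refine ⟨[.step, .read (.leaf r v), .read (.leaf r v')] ++ List.replicate 4 .step,
            ?_, by simp, ?_⟩
          · intro e he
            simp only [List.mem_append, List.mem_cons, List.not_mem_nil, or_false,
              List.mem_replicate] at he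
            rcases he with (rfl | rfl | rfl) | ⟨-, rfl⟩ <;> simp
          simp only [trace_steps_bind, hd, decide_false, Bool.false_eq_true, if_false,
            trace_read_bind hv, trace_read_bind hv']
          by_cases hc : deg s.2 v ≠ 1 ∧ deg s.2 v' ≠ 1 ∧
              (heads r u = true ∧ heads r v = false ∧ heads r v' = false)
          · have hc' : decide (deg s.2 v = 1) = false ∧ decide (deg s.2 v' = 1) = false ∧
              (heads r u = true ∧ heads r v = false ∧ heads r v' = false) := by simpa using hc
            simp only [fate, hn, if_pos hc, if_pos hc']
            rfl
          · have hc' : ¬ (decide (deg s.2 v = 1) = false ∧ decide (deg s.2 v' = 1) = false ∧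
              (heads r u = true ∧ heads r v = false ∧ heads r v' = false)) := by simpa using hc
            simp only [fate, hn, if_neg hc, if_neg hc', hal, fateEvents]
            rfl
        | cons z others =>
          refine ⟨[.step], by simp, by simp, ?_⟩
          simp only [trace_steps_bind, hd, decide_false, Bool.false_eq_true, if_false, fate, hn,
            hal, fateEvents]
          rfl
  rintro tr ⟨mid, h1, h2, rfl⟩
  refine ⟨base ++ mid, ?_, by simp only [List.length_append]; omega, by simp [hbase]⟩
  intro e he
  rcases List.mem_append.mp he with he | he
  · exact hb1 e he
  · rcases h1 e he with rfl | ⟨v, p, hvp, rfl⟩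
    · exact Or.inl rfl
    · exact Or.inr (Or.inr (Or.inr (hmem v p hvp)))

end Semantics
end TreeContraction

/-! ### Simulation of the shared-memory execution by the state map -/

namespace TreeContraction
open RoundBased RoundBased.Prog

section Execution

variable {V : Type} {t : ℕ} [LinearOrder V] {ρ : V → ℕ} {s : State V t} {h : V → Bool}

theorem length_fateEvents_le (r : ℕ) (u : V) (σ : Slots V t) (f : Fate V t) :
    (fateEvents r u σ f).length ≤ 4 * t + 4 := by
  cases f with
  | keep =>
    have hle : ∀ js : List (Fin t),
        (js.flatMap (fun j => slotEvents r u (j, σ u j))).length ≤ 4 * js.length := by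
      intro js
      induction js with
      | nil => simp
      | cons j js ih =>
        have : (slotEvents r u (j, σ u j)).length ≤ 4 := by
          cases σ u j with
          | none => simp [slotEvents]
          | some x => simp [slotEvents]
        simp only [List.flatMap_cons, List.length_append, List.length_cons]
        omega
    have := hle (List.finRange t)
    simp only [List.length_finRange] at this
    simp only [fateEvents, aliveEvents, List.length_cons, List.length_append, List.length_nil]
    omega
  | finalize => simp [fateEvents]
  | rake v p => simp [fateEvents]
  | compress v p v' p' => simp [fateEvents]

theorem mem_flatMap_slotEvents {r : ℕ} {u : V} {σ : Slots V t} {e : Event (Loc V t) Val} :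
    e ∈ (List.finRange t).flatMap (fun j => slotEvents r u (j, σ u j)) ↔
      (∃ j v p, σ u j = some (v, p) ∧ (e = .step ∨ e = .write (.adj (r + 1) v p) (some (u, j)) ∨
        e = .read (.leaf r v))) ∨
      ∃ j, σ u j = none ∧ (e = .step ∨ e = .write (.adj (r + 1) u j) none) := by
  rw [List.mem_flatMap]
  constructor
  · rintro ⟨j, -, hj⟩
    cases hu : σ u j with
    | none =>
      rw [hu] at hj
      exact Or.inr ⟨j, hu, by simpa [slotEvents] using hj⟩
    | some x =>
      rw [hu] at hj
      refine Or.inl ⟨j, x.1, x.2, hu, ?_⟩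
      simp only [slotEvents, List.mem_cons, List.not_mem_nil, or_false] at hj
      tauto
  · rintro (⟨j, v, p, hu, hj⟩ | ⟨j, hu, hj⟩)
    · refine ⟨j, List.mem_finRange j, ?_⟩
      simp only [hu, slotEvents, List.mem_cons, List.not_mem_nil, or_false]
      tauto
    · refine ⟨j, List.mem_finRange j, ?_⟩
      simpa [hu, slotEvents] using hj

/-- The slots written by `u` get the content that they have after the round. -/
theorem write_adj_mem (hs : IsForest ρ s) {r i : ℕ} {u w : V} {q : Fin t}
    {val : Option (V × Fin t)}
    (hw : (Event.write (.adj i w q) val : Event (Loc V t) Val) ∈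
      fateEvents r u s.2 (fate s.2 h u)) :
    i = r + 1 ∧ val = newSlot s.2 h w q ∧
      ((w = u ∧ s.2 u q = none) ∨ ∃ j, s.2 w q = some (u, j)) := by
  cases hf : fate s.2 h u with
  | keep =>
    rw [hf] at hw
    simp only [fateEvents, aliveEvents, List.mem_cons, List.mem_append, mem_flatMap_slotEvents,
      List.not_mem_nil, or_false, reduceCtorEq, false_or, Event.write.injEq] at hw
    rcases hw with (⟨j, v, p, e, h1⟩ | ⟨j, e, h1⟩) | h1
    · simp only [Loc.adj.injEq] at h1
      obtain ⟨⟨rfl, rfl, rfl⟩, h2⟩ := h1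
      have := hs.symm e
      refine ⟨rfl, ?_, Or.inr ⟨j, this⟩⟩
      rw [eq_of_heq h2]
      simp [newSlot, this, hf]
    · simp only [Loc.adj.injEq] at h1
      obtain ⟨⟨rfl, rfl, rfl⟩, h2⟩ := h1
      refine ⟨rfl, ?_, Or.inl ⟨rfl, e⟩⟩
      rw [eq_of_heq h2]
      simp [newSlot, e]
    · simp at h1
  | finalize => rw [hf] at hw; simp [fateEvents] at hw
  | rake v p =>
    rw [hf] at hw
    simp only [fateEvents, List.mem_cons, Event.write.injEq, Loc.adj.injEq, reduceCtorEq,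
      List.not_mem_nil, or_false, false_and] at hw
    obtain ⟨⟨rfl, rfl, rfl⟩, h2⟩ := hw
    obtain ⟨-, -, j, hj, -⟩ := IsForest.fate_rake hf
    have := hs.symm hj
    refine ⟨rfl, ?_, Or.inr ⟨j, this⟩⟩
    rw [eq_of_heq h2]
    simp [newSlot, this, hf]
  | compress v p v' p' =>
    rw [hf] at hw
    simp only [fateEvents, List.mem_cons, Event.write.injEq, Loc.adj.injEq, reduceCtorEq,
      List.not_mem_nil, or_false, false_and] at hw
    obtain ⟨-, -, ⟨j, j', hjj, e1, e2, -⟩, -⟩ := hs.fate_compress hf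
    rcases hw with ⟨⟨rfl, rfl, rfl⟩, h2⟩ | ⟨⟨rfl, rfl, rfl⟩, h2⟩
    · have := hs.symm e1
      refine ⟨rfl, ?_, Or.inr ⟨j, this⟩⟩
      rw [eq_of_heq h2]
      simp [newSlot, this, hf]
    · have := hs.symm e2
      refine ⟨rfl, ?_, Or.inr ⟨j', this⟩⟩
      rw [eq_of_heq h2]
      have hne : ¬ (v = w ∧ p = q) := by
        rintro ⟨rfl, rfl⟩
        exact hjj (hs.slot_inj e1 e2).2
      simp [newSlot, this, hf, hne]

theorem mem_write_adj_none {r : ℕ} {u : V} {q : Fin t} (hf : fate s.2 h u = .keep)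
    (e : s.2 u q = none) :
    (Event.write (.adj (r + 1) u q) (newSlot s.2 h u q) : Event (Loc V t) Val) ∈
      fateEvents r u s.2 (fate s.2 h u) := by
  simp only [hf, fateEvents, aliveEvents, List.mem_cons, List.mem_append, mem_flatMap_slotEvents]
  refine Or.inr (Or.inl (Or.inr ⟨q, e, Or.inr ?_⟩))
  simp [newSlot, e]

theorem mem_write_adj_some (hs : IsForest ρ s) {r : ℕ} {u w : V} {q j : Fin t}
    (e : s.2 w q = some (u, j)) :
    (Event.write (.adj (r + 1) w q) (newSlot s.2 h w q) : Event (Loc V t) Val) ∈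
      fateEvents r u s.2 (fate s.2 h u) := by
  have e' := hs.symm e
  cases hf : fate s.2 h u with
  | keep =>
    simp only [fateEvents, aliveEvents, List.mem_cons, List.mem_append, mem_flatMap_slotEvents]
    refine Or.inr (Or.inl (Or.inl ⟨j, w, q, e', Or.inr (Or.inl ?_)⟩))
    simp [newSlot, e, hf]
  | finalize => simp [IsForest.fate_finalize hf] at e'
  | rake v p =>
    obtain ⟨-, -, i, hi, hall⟩ := IsForest.fate_rake hf
    obtain rfl := hall _ _ e'
    obtain ⟨rfl, rfl⟩ : v = w ∧ p = q := by simpa using hi.symm.trans e'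
    simp [fateEvents, newSlot, e, hf]
  | compress v p v' p' =>
    obtain ⟨-, -, ⟨i, i', hii, e1, e2, hall⟩, -⟩ := hs.fate_compress hf
    rcases hall _ _ e' with rfl | rfl
    · obtain ⟨rfl, rfl⟩ : v = w ∧ p = q := by simpa using e1.symm.trans e'
      simp [fateEvents, newSlot, e, hf]
    · obtain ⟨rfl, rfl⟩ : v' = w ∧ p' = q := by simpa using e2.symm.trans e'
      have hne : ¬ (v = v' ∧ p = p') := by
        rintro ⟨rfl, rfl⟩
        exact hii (hs.slot_inj e1 e2).2
      simp [fateEvents, newSlot, e, hf, hne]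

theorem countP_finRange (p : Fin t → Bool) :
    (List.finRange t).countP p = (Finset.univ.filter (fun j => p j = true)).card := by
  rw [List.countP_eq_length_filter, ← List.toFinset_card_of_nodup ((List.nodup_finRange t).filter _)]
  congr 1
  ext j
  simp

/-- The leaf flag computed by a surviving vertex is correct. -/
theorem countP_holdsNonleaf (hs : IsForest ρ s) {u : V} (hu : u ∈ s.1)
    (hk : fate s.2 h u = .keep) :
    (List.finRange t).countP (fun j => holdsNonleaf s.2 (s.2 u j)) = deg (nextState s h).2 u := by
  rw [countP_finRange, deg]
  congr 1
  ext j
  simp only [Finset.mem_filter, Finset.mem_univ, true_and]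
  rw [hs.next_isSome hu hk]
  cases s.2 u j with
  | none => simp [holdsNonleaf]
  | some x =>
    simp only [holdsNonleaf, decide_eq_true_eq, Option.some.injEq]
    constructor
    · intro hd; exact ⟨x.1, x.2, rfl, hd⟩
    · rintro ⟨y, q, rfl, hd⟩; exact hd

theorem write_leaf_mem {r i : ℕ} {u w : V} {b : Bool} {σ : Slots V t} {f : Fate V t}
    (hw : (Event.write (.leaf i w) b : Event (Loc V t) Val) ∈ fateEvents r u σ f) :
    i = r + 1 ∧ w = u ∧ f = .keep ∧
      b = decide ((List.finRange t).countP (fun j => holdsNonleaf σ (σ u j)) = 1) := by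
  cases f with
  | keep =>
    simp only [fateEvents, aliveEvents, List.mem_cons, List.mem_append, mem_flatMap_slotEvents,
      List.not_mem_nil, or_false, reduceCtorEq, false_or, Event.write.injEq, Loc.leaf.injEq] at hw
    rcases hw with (⟨j, v, p, e, h1⟩ | ⟨j, e, h1⟩) | h1
    · simp at h1
    · simp at h1
    · exact ⟨h1.1.1, h1.1.2, rfl, eq_of_heq h1.2⟩
  | finalize => simp [fateEvents] at hw
  | rake v p => simp [fateEvents] at hw
  | compress v p v' p' => simp [fateEvents] at hw

theorem write_del_mem {r : ℕ} {u w : V} {x : ℕ} {σ : Slots V t} {f : Fate V t}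
    (hw : (Event.write (.del w) x : Event (Loc V t) Val) ∈ fateEvents r u σ f) :
    w = u ∧ f ≠ .keep := by
  cases f with
  | keep =>
    simp only [fateEvents, aliveEvents, List.mem_cons, List.mem_append, mem_flatMap_slotEvents,
      List.not_mem_nil, or_false, reduceCtorEq, false_or, Event.write.injEq] at hw
    rcases hw with (⟨j, v, p, e, h1⟩ | ⟨j, e, h1⟩) | h1 <;> simp at h1
  | finalize => simp [fateEvents] at hw; simp [hw.1]
  | rake v p => simp [fateEvents] at hw; simp [hw.1]
  | compress v p v' p' => simp [fateEvents] at hw; simp [hw.1]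

theorem retire_mem_fateEvents {r : ℕ} {u : V} {σ : Slots V t} {f : Fate V t} :
    (Event.retire : Event (Loc V t) Val) ∈ fateEvents r u σ f ↔ f ≠ .keep := by
  cases f with
  | keep =>
    simp only [fateEvents, aliveEvents, List.mem_cons, List.mem_append, mem_flatMap_slotEvents]
    simp
  | finalize => simp [fateEvents]
  | rake v p => simp [fateEvents]
  | compress v p v' p' => simp [fateEvents]

theorem read_mem_fateEvents {r : ℕ} {u : V} {σ : Slots V t} {f : Fate V t} {l : Loc V t}
    (hl : (Event.read l : Event (Loc V t) Val) ∈ fateEvents r u σ f) :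
    ∃ j v p, σ u j = some (v, p) ∧ l = .leaf r v := by
  cases f with
  | keep =>
    simp only [fateEvents, aliveEvents, List.mem_cons, List.mem_append, mem_flatMap_slotEvents,
      List.not_mem_nil, or_false, reduceCtorEq, false_or, Event.read.injEq, and_false,
      exists_false] at hl
    obtain ⟨j, v, p, e, h1⟩ := hl
    exact ⟨j, v, p, e, h1⟩
  | finalize => simp [fateEvents] at hl
  | rake v p => simp [fateEvents] at hl
  | compress v p v' p' => simp [fateEvents] at hl

/-- The slots that a survivor writes are its own empty slots and the partner slots of its filled
ones. Symmetry of the table makes these locations distinct. -/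
theorem nodup_written_fateEvents (hs : IsForest ρ s) (r : ℕ) (u : V) :
    ((fateEvents r u s.2 (fate s.2 h u)).filterMap Event.written).Nodup := by
  cases hf : fate s.2 h u with
  | keep =>
    let loc : Fin t → Loc V t := fun j => match s.2 u j with
      | some (v, p) => .adj (r + 1) v p
      | none => .adj (r + 1) u j
    have h1 : ∀ js : List (Fin t), (js.flatMap (fun j => slotEvents r u (j, s.2 u j))).filterMap
        Event.written = js.map loc := by
      intro js
      induction js with
      | nil => rfl
      | cons j js ih =>
        simp only [List.flatMap_cons, List.filterMap_append, ih, List.map_cons, loc]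
        cases s.2 u j with
        | none => rfl
        | some x => rfl
    have hinj : Function.Injective loc := by
      intro j j' hjj
      simp only [loc] at hjj
      cases hj : s.2 u j with
      | none =>
        cases hj' : s.2 u j' with
        | none => simpa [hj, hj'] using hjj
        | some x' =>
          simp only [hj, hj', Loc.adj.injEq, true_and] at hjj
          have := hs.symm hj'
          simp [← hjj.1, ← hjj.2, hj] at this
      | some x =>
        cases hj' : s.2 u j' with
        | none =>
          simp only [hj, hj', Loc.adj.injEq, true_and] at hjj
          have := hs.symm hj
          simp [hjj.1, hjj.2, hj'] at this
        | some x' =>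
          simp only [hj, hj', Loc.adj.injEq, true_and] at hjj
          have : x = x' := Prod.ext hjj.1 hjj.2
          subst this
          exact (hs.slot_inj hj hj').2
    have h2 : (fateEvents r u s.2 .keep).filterMap Event.written =
        (List.finRange t).map loc ++ [.leaf (r + 1) u] := by
      simp only [fateEvents, aliveEvents]
      rw [List.filterMap_cons_none rfl, List.filterMap_append, h1]
      rfl
    rw [h2, List.nodup_append]
    refine ⟨(List.nodup_finRange t).map hinj, by simp, ?_⟩
    intro a ha b hb
    obtain ⟨j, -, rfl⟩ := List.mem_map.mp ha
    rw [List.mem_singleton] at hb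
    subst hb
    simp only [loc]
    cases s.2 u j with
    | none => simp
    | some x => simp
  | finalize => exact List.nodup_singleton (Loc.del u)
  | rake v p =>
    change [Loc.adj (r + 1) v p, Loc.del u].Nodup
    simp
  | compress v p v' p' =>
    obtain ⟨-, -, ⟨i, i', hii, e1, e2, hall⟩, -⟩ := hs.fate_compress hf
    have hne : v = v' → ¬ p = p' := by
      rintro rfl rfl
      exact hii (hs.slot_inj e1 e2).2
    change [Loc.adj (r + 1) v p, Loc.adj (r + 1) v' p', Loc.del u].Nodup
    simpa using hne

/-- The situation `S` at the beginning of round `r` represents the state `s`. -/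
structure Matches (S : Config V (Loc V t) Val) (r : ℕ) (s : State V t) : Prop where
  procs : S.procs = s.1
  memory : Represents S.memory r s

namespace Matches

variable {heads : ℕ → V → Bool} {r : ℕ} {S : Config V (Loc V t) Val}

theorem write_mem_iff (hS : Matches S r s) (hs : IsForest ρ s) {u : V} (hu : u ∈ s.1) {l : Loc V t}
    {v : Val l} :
    Event.write l v ∈ roundTrace (computeRound heads) r S u ↔
      Event.write l v ∈ fateEvents r u s.2 (fate s.2 (heads r) u) := by
  obtain ⟨pre, h1, -, h3⟩ := trace_computeRound (heads := heads) hS.memory hs hu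
  rw [roundTrace, h3, List.mem_append]
  refine ⟨?_, Or.inr⟩
  rintro (hp | hp)
  · rcases h1 _ hp with h | ⟨j, h⟩ | h | ⟨j, v, p, -, h⟩ <;> simp at h
  · exact hp

theorem retire_mem_iff (hS : Matches S r s) (hs : IsForest ρ s) {u : V} (hu : u ∈ s.1) :
    Event.retire ∈ roundTrace (computeRound heads) r S u ↔ fate s.2 (heads r) u ≠ .keep := by
  obtain ⟨pre, h1, -, h3⟩ := trace_computeRound (heads := heads) hS.memory hs hu
  rw [roundTrace, h3, List.mem_append, retire_mem_fateEvents]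
  refine ⟨?_, Or.inr⟩
  rintro (hp | hp)
  · rcases h1 _ hp with h | ⟨j, h⟩ | h | ⟨j, v, p, -, h⟩ <;> simp at h
  · exact hp

theorem read_mem (hS : Matches S r s) (hs : IsForest ρ s) {u : V} (hu : u ∈ s.1) {l : Loc V t}
    (hl : Event.read l ∈ roundTrace (computeRound heads) r S u) :
    (∃ j, l = .adj r u j) ∨ l = .leaf r u ∨ ∃ j v p, s.2 u j = some (v, p) ∧ l = .leaf r v := by
  obtain ⟨pre, h1, -, h3⟩ := trace_computeRound (heads := heads) hS.memory hs hu
  rw [roundTrace, h3, List.mem_append] at hl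
  rcases hl with hp | hp
  · rcases h1 _ hp with h | ⟨j, h⟩ | h | ⟨j, v, p, e, h⟩
    · simp at h
    · exact Or.inl ⟨j, by simpa using h⟩
    · exact Or.inr (Or.inl (by simpa using h))
    · exact Or.inr (Or.inr ⟨j, v, p, e, by simpa using h⟩)
  · exact Or.inr (Or.inr (read_mem_fateEvents hp))

theorem length_le (hS : Matches S r s) (hs : IsForest ρ s) {u : V} (hu : u ∈ s.1) :
    (roundTrace (computeRound heads) r S u).length ≤ 6 * t + 14 := by
  obtain ⟨pre, -, h2, h3⟩ := trace_computeRound (heads := heads) hS.memory hs hu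
  have := length_fateEvents_le r u s.2 (fate s.2 (heads r) u)
  rw [roundTrace, h3, List.length_append]
  omega

theorem nodup_written (hS : Matches S r s) (hs : IsForest ρ s) {u : V} (hu : u ∈ s.1) :
    ((roundTrace (computeRound heads) r S u).filterMap Event.written).Nodup := by
  obtain ⟨pre, h1, -, h3⟩ := trace_computeRound (heads := heads) hS.memory hs hu
  have hpre : pre.filterMap Event.written = [] := by
    rw [List.filterMap_eq_nil_iff]
    intro e he
    rcases h1 e he with rfl | ⟨j, rfl⟩ | rfl | ⟨j, v, p, -, rfl⟩ <;> rfl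
  rw [roundTrace, h3, List.filterMap_append, hpre, List.nil_append]
  exact nodup_written_fateEvents hs r u

/-- A next-round slot of `x` can be written only by the current neighbor in that slot, or by `x`
itself if the slot is empty; leaf flags and deletion records are written by their own vertex. The
value is also determined, which later resolves the arbitrary choice among writes in `nextConfig`. -/
theorem writer_unique (hS : Matches S r s) (hs : IsForest ρ s) {u w : V} (hu : u ∈ s.1)
    (hw : w ∈ s.1) {l : Loc V t} {a b : Val l}
    (ha : Event.write l a ∈ roundTrace (computeRound heads) r S u)
    (hb : Event.write l b ∈ roundTrace (computeRound heads) r S w) : u = w ∧ a = b := by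
  rw [hS.write_mem_iff hs hu] at ha
  rw [hS.write_mem_iff hs hw] at hb
  cases l with
  | adj i x q =>
    obtain ⟨-, h2, h3⟩ := write_adj_mem hs ha
    obtain ⟨-, h2', h3'⟩ := write_adj_mem hs hb
    refine ⟨?_, h2.trans h2'.symm⟩
    rcases h3 with ⟨rfl, h3⟩ | ⟨j, h3⟩ <;> rcases h3' with ⟨rfl, h3'⟩ | ⟨j', h3'⟩
    · rfl
    · simp [h3] at h3'
    · simp [h3] at h3'
    · have := h3.symm.trans h3'
      simp only [Option.some.injEq, Prod.mk.injEq] at this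
      exact this.1
  | leaf i x =>
    obtain ⟨-, rfl, -, h2⟩ := write_leaf_mem ha
    obtain ⟨-, rfl, -, h2'⟩ := write_leaf_mem hb
    exact ⟨rfl, h2.trans h2'.symm⟩
  | del x =>
    have h1 := (write_del_mem ha).1
    have h2 := (write_del_mem hb).1
    subst h1; subst h2
    refine ⟨rfl, ?_⟩
    cases hf : fate s.2 (heads r) x with
    | keep => exact absurd hf (write_del_mem ha).2
    | finalize => rw [hf] at ha hb; simp [fateEvents] at ha hb; exact ha.trans hb.symm
    | rake v p => rw [hf] at ha hb; simp [fateEvents] at ha hb; exact ha.trans hb.symm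
    | compress v p v' p' =>
      rw [hf] at ha hb; simp [fateEvents] at ha hb; exact ha.trans hb.symm

theorem memory_of_write (hS : Matches S r s) (hs : IsForest ρ s) {u : V} (hu : u ∈ s.1)
    {l : Loc V t} {a : Val l} (ha : Event.write l a ∈ fateEvents r u s.2 (fate s.2 (heads r) u)) :
    (nextConfig (computeRound heads) r S).memory l = some a := by
  have ha' := (hS.write_mem_iff (heads := heads) hs hu).mpr ha
  have hex : ∃ v : Val l, ∃ p ∈ S.procs, Event.write l v ∈ roundTrace (computeRound heads) r S p :=
    ⟨a, u, hS.procs ▸ hu, ha'⟩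
  simp only [nextConfig, dif_pos hex, Option.some.injEq]
  obtain ⟨w, hw, hv⟩ := hex.choose_spec
  exact (hS.writer_unique hs (hS.procs ▸ hw) hu hv ha').2

theorem memory_of_forall_not_write (hS : Matches S r s) (hs : IsForest ρ s) {l : Loc V t}
    (hl : ∀ u ∈ s.1, ∀ a : Val l, Event.write l a ∉ fateEvents r u s.2 (fate s.2 (heads r) u)) :
    (nextConfig (computeRound heads) r S).memory l = S.memory l := by
  simp only [nextConfig]
  rw [dif_neg]
  rintro ⟨a, u, hu, ha⟩
  rw [hS.procs] at hu
  exact hl u hu a ((hS.write_mem_iff hs hu).mp ha)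

/-- Every slot and leaf flag of a survivor has a writer, so its new content is the one prescribed by
`nextState`. All adjacency and leaf writes carry the index `r + 1`, and only deleted vertices record
a deletion, so the locations needed later remain fresh. -/
theorem next (hS : Matches S r s) (hs : IsForest ρ s) :
    Matches (nextConfig (computeRound heads) r S) (r + 1) (nextState s (heads r)) where
  procs := by
    ext u
    rw [IsForest.mem_next]
    simp only [nextConfig, Finset.mem_filter, hS.procs]
    refine and_congr_right fun hu => ?_
    rw [hS.retire_mem_iff hs hu, not_not]
  memory := by
    constructor
    · intro u hu j
      obtain ⟨hu, hk⟩ := IsForest.mem_next.mp hu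
      have hnew : (nextState s (heads r)).2 u j = newSlot s.2 (heads r) u j := by
        simp [nextState, hu, hk]
      rw [hnew]
      cases hj : s.2 u j with
      | none => exact hS.memory_of_write hs hu (mem_write_adj_none hk hj)
      | some x => exact hS.memory_of_write hs (hs.alive' hj) (mem_write_adj_some hs hj)
    · intro u hu
      obtain ⟨hu, hk⟩ := IsForest.mem_next.mp hu
      apply hS.memory_of_write hs hu
      rw [← countP_holdsNonleaf hs hu hk, hk]
      simp [fateEvents, aliveEvents]
    · intro i hi u j
      rw [hS.memory_of_forall_not_write hs, hS.memory.adj_fresh i (by omega)]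
      intro w hw a ha
      have := (write_adj_mem hs ha).1
      omega
    · intro i hi u
      rw [hS.memory_of_forall_not_write hs, hS.memory.leaf_fresh i (by omega)]
      intro w hw a ha
      have := (write_leaf_mem ha).1
      omega
    · intro u hu
      obtain ⟨hu, hk⟩ := IsForest.mem_next.mp hu
      rw [hS.memory_of_forall_not_write hs, hS.memory.del_fresh u hu]
      intro w hw a ha
      obtain ⟨rfl, h2⟩ := write_del_mem ha
      exact h2 hk

end Matches

/-! ## Runs -/

/-- The state at the beginning of round `r`, when contraction starts in `s`. -/
noncomputable def stateAt (s : State V t) (heads : ℕ → V → Bool) : ℕ → State V t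
  | 0 => s
  | r + 1 => nextState (stateAt s heads r) (heads r)

theorem IsForest.stateAt (hs : IsForest ρ s) (heads : ℕ → V → Bool) (r : ℕ) :
    IsForest ρ (stateAt s heads r) := by
  induction r with
  | zero => exact hs
  | succ r ih => exact ih.next

/-- The initial state of tree contraction. -/
def initState [Fintype V] {F : SimpleGraph V} (L : AdjacencyLists F t) : State V t :=
  (Finset.univ, L.slot)

variable [Fintype V] {F : SimpleGraph V}

/-- The only place where acyclicity of the graph enters: it supplies the ranking that stays fixed
for the whole run. -/
theorem exists_isForest_initState (hF : F.IsAcyclic) (L : AdjacencyLists F t) :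
    ∃ ρ : V → ℕ, IsForest ρ (initState L) := by
  obtain ⟨ρ, h1, h2⟩ := exists_ranking hF
  have hadj : ∀ {u j v p}, L.slot u j = some (v, p) → F.Adj u v :=
    fun e => (L.adj_iff _ _).mpr ⟨_, _, e⟩
  refine ⟨ρ, h1, fun e => L.symm _ _ _ _ e, fun e => (hadj e).ne.symm, ?_, fun _ => by simp [initState]⟩
  intro u j j' v v' p p' e e' hlt hlt'
  obtain rfl := h2 u v v' (hadj e) (hadj e') hlt hlt'
  exact L.unique _ _ _ _ _ _ e e'

theorem matches_input (L : AdjacencyLists F t) : Matches (input L) 0 (initState L) where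
  procs := rfl
  memory := by
    constructor
    · intro u _ j; rfl
    · intro u _; rfl
    · intro i hi u j
      cases i with
      | zero => omega
      | succ i => rfl
    · intro i hi u
      cases i with
      | zero => omega
      | succ i => rfl
    · intro u _; rfl

theorem matches_configAt (L : AdjacencyLists F t) (hs : IsForest ρ (initState L))
    (heads : ℕ → V → Bool) (r : ℕ) :
    Matches (configAt (computeRound heads) (input L) r) r (stateAt (initState L) heads r) := by
  induction r with
  | zero => exact matches_input L
  | succ r ih => exact ih.next (hs.stateAt heads r)

theorem activeAt_eq (L : AdjacencyLists F t) (hs : IsForest ρ (initState L))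
    (heads : ℕ → V → Bool) (r : ℕ) :
    activeAt (computeRound heads) (input L) r = (stateAt (initState L) heads r).1 :=
  (matches_configAt L hs heads r).procs

theorem legal_computeRound (L : AdjacencyLists F t) (hs : IsForest ρ (initState L))
    (heads : ℕ → V → Bool) : Legal (computeRound heads) (input L) := by
  intro r p hp
  have hM := matches_configAt L hs heads r
  have hf := hs.stateAt heads r
  rw [activeAt_eq L hs] at hp
  refine ⟨?_, ?_, hM.nodup_written hf hp, ?_⟩
  · intro l hl
    rcases hM.read_mem hf hp hl with ⟨j, rfl⟩ | rfl | ⟨j, v, q, e, rfl⟩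
    · rw [memoryAt, hM.memory.adj p hp]; simp
    · rw [memoryAt, hM.memory.leaf p hp]; simp
    · rw [memoryAt, hM.memory.leaf v (hf.alive' e)]; simp
  · intro l v hw
    have hw' := (hM.write_mem_iff hf hp).mp hw
    cases l with
    | adj i w q =>
      rw [(write_adj_mem hf hw').1]
      exact hM.memory.adj_fresh _ (by omega) _ _
    | leaf i w =>
      rw [(write_leaf_mem hw').1]
      exact hM.memory.leaf_fresh _ (by omega) _
    | del w =>
      rw [(write_del_mem hw').1]
      exact hM.memory.del_fresh _ hp
  · intro q hq hqp l v w hv hw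
    rw [activeAt_eq L hs] at hq
    exact hqp (hM.writer_unique hf hq hp hw hv).1

theorem costAt_le (L : AdjacencyLists F t) (hs : IsForest ρ (initState L))
    (heads : ℕ → V → Bool) (r : ℕ) {p : V} (hp : p ∈ activeAt (computeRound heads) (input L) r) :
    costAt (computeRound heads) (input L) r p ≤ 6 * t + 14 := by
  rw [activeAt_eq L hs] at hp
  exact (matches_configAt L hs heads r).length_le (hs.stateAt heads r) hp

/-- A computation is affected only if its vertex or adjacency list differs, or the leaf flag of a
neighbor differs. -/
theorem affected_imp {F' : SimpleGraph V} {ρ' : V → ℕ} (L : AdjacencyLists F t)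
    (L' : AdjacencyLists F' t) (hs : IsForest ρ (initState L)) (hs' : IsForest ρ' (initState L'))
    (heads : ℕ → V → Bool) (r : ℕ) {p : V}
    (hp : Affected (computeRound heads) (input L) (input L') r p)
    (hA : p ∈ (stateAt (initState L) heads r).1 ↔ p ∈ (stateAt (initState L') heads r).1)
    (hσ : (stateAt (initState L) heads r).2 p = (stateAt (initState L') heads r).2 p) :
    ∃ j v q, (stateAt (initState L) heads r).2 p j = some (v, q) ∧
      ¬ (deg (stateAt (initState L) heads r).2 v = 1 ↔
        deg (stateAt (initState L') heads r).2 v = 1) := by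
  have hM := matches_configAt L hs heads r
  have hM' := matches_configAt L' hs' heads r
  have hf := hs.stateAt heads r
  have hf' := hs'.stateAt heads r
  rw [Affected, activeAt_eq L hs, activeAt_eq L' hs'] at hp
  rcases hp with hp | ⟨hp, hp', l, hl, hne⟩
  · rcases hp with ⟨h1, h2⟩ | ⟨h1, h2⟩
    · exact absurd (hA.mp h1) h2
    · exact absurd (hA.mpr h1) h2
  have hl' : (∃ j, l = .adj r p j) ∨ l = .leaf r p ∨
      ∃ j v q, (stateAt (initState L) heads r).2 p j = some (v, q) ∧ l = .leaf r v := by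
    rcases hl with hl | hl
    · exact hM.read_mem hf hp hl
    · rcases hM'.read_mem hf' hp' hl with h | h | ⟨j, v, q, e, h⟩
      · exact Or.inl h
      · exact Or.inr (Or.inl h)
      · exact Or.inr (Or.inr ⟨j, v, q, by rw [hσ]; exact e, h⟩)
  simp only [memoryAt] at hne
  rcases hl' with ⟨j, rfl⟩ | rfl | ⟨j, v, q, e, rfl⟩
  · rw [hM.memory.adj p hp, hM'.memory.adj p hp', hσ] at hne
    exact absurd rfl hne
  · rw [hM.memory.leaf p hp, hM'.memory.leaf p hp', deg_congr hσ] at hne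
    exact absurd rfl hne
  · refine ⟨j, v, q, e, fun hiff => hne ?_⟩
    have e' : (stateAt (initState L') heads r).2 p j = some (v, q) := by rw [← hσ]; exact e
    rw [hM.memory.leaf v (hf.alive' e), hM'.memory.leaf v (hf'.alive' e')]
    simp only [hiff]

end Execution

end TreeContraction

namespace TreeContraction
open RoundBased RoundBased.Prog

/-! ## Propagation of differences between two runs -/

section Dirty

variable {V : Type} {t : ℕ}

/-- `v` is a neighbor of `u`. -/
def Linked (σ : Slots V t) (u v : V) : Prop := ∃ j q, σ u j = some (v, q)

theorem IsForest.linked_symm [LinearOrder V] {ρ : V → ℕ} {s : State V t} (hs : IsForest ρ s)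
    {u v : V} (h : Linked s.2 u v) : Linked s.2 v u := by
  obtain ⟨j, q, e⟩ := h
  exact ⟨q, j, hs.symm e⟩

theorem linked_congr {σ σ' : Slots V t} {u v : V} (h : σ u = σ' u) :
    Linked σ u v ↔ Linked σ' u v := by
  simp [Linked, h]

/-- `v` has no neighbor of higher rank in `K`. -/
def IsRoot (ρ : V → ℕ) (s : State V t) (K : Finset V) (v : V) : Prop :=
  ∀ x, Linked s.2 v x → ρ v < ρ x → x ∉ K

/-- The alive part of `K` has at most one root; for forests this means that it is connected. -/
def Rooted (ρ : V → ℕ) (s : State V t) (K : Finset V) : Prop :=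
  ∀ v ∈ K, v ∈ s.1 → IsRoot ρ s K v → ∀ w ∈ K, w ∈ s.1 → IsRoot ρ s K w → v = w

variable [LinearOrder V] {ρ : V → ℕ} {s : State V t}

/-- A root after the round is either an old root or a child of a deleted old root: a parent in `K`
that survived would still be its parent, and a grandparent in `K` would have become its parent by
compression. As the old root is unique, two new roots could only be two children of the same deleted
root. -/
theorem Rooted.next {K : Finset V} {h : V → Bool} (hs : IsForest ρ s) (hK : Rooted ρ s K) :
    Rooted ρ (nextState s h) K := by
  have key : ∀ v ∈ K, v ∈ (nextState s h).1 → IsRoot ρ (nextState s h) K v →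
      ∃ x ∈ K, x ∈ s.1 ∧ IsRoot ρ s K x ∧ (x = v ∨ (Linked s.2 v x ∧ fate s.2 h x ≠ .keep)) := by
    intro v hvK hv hroot
    obtain ⟨hv1, hv2⟩ := IsForest.mem_next.mp hv
    by_cases hr : IsRoot ρ s K v
    · exact ⟨v, hvK, hv1, hr, Or.inl rfl⟩
    · unfold IsRoot at hr
      push Not at hr
      obtain ⟨x, ⟨j, a, e⟩, hlt, hxK⟩ := hr
      have hfx : fate s.2 h x ≠ .keep := by
        intro hfx
        exact hroot x ⟨j, a, hs.next_slot.mpr ⟨hv1, hv2, Or.inl ⟨e, hfx⟩⟩⟩ hlt hxK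
      refine ⟨x, hxK, hs.alive' e, ?_, Or.inr ⟨⟨j, a, e⟩, hfx⟩⟩
      rintro w ⟨b, q, e'⟩ hlt' hwK
      have hab : a ≠ b := by
        rintro rfl
        have := (hs.symm e).symm.trans e'
        simp only [Option.some.injEq, Prod.mk.injEq] at this
        rw [← this.1] at hlt'
        omega
      exact hroot w ⟨j, q, hs.next_slot.mpr ⟨hv1, hv2, Or.inr ⟨x, a, b, e, e', hab, hfx⟩⟩⟩
        (hlt.trans hlt') hwK
  intro v hvK hv hvr w hwK hw hwr
  obtain ⟨x, hx, hx1, hx2, hx3⟩ := key v hvK hv hvr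
  obtain ⟨y, hy, hy1, hy2, hy3⟩ := key w hwK hw hwr
  obtain rfl := hK x hx hx1 hx2 y hy hy1 hy2
  obtain ⟨hv1, hv2⟩ := IsForest.mem_next.mp hv
  obtain ⟨hw1, hw2⟩ := IsForest.mem_next.mp hw
  rcases hx3 with rfl | ⟨⟨j, a, e⟩, hf⟩
  · rcases hy3 with rfl | ⟨-, hf⟩
    · rfl
    · exact absurd hv2 hf
  · rcases hy3 with rfl | ⟨⟨j', a', e'⟩, -⟩
    · exact absurd hw2 hf
    -- Two different neighbors of the compressed vertex become adjacent, so the lower-ranked one is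
    -- not a root.
    · by_cases haa : a = a'
      · subst haa
        have := (hs.symm e).symm.trans (hs.symm e')
        simp only [Option.some.injEq, Prod.mk.injEq] at this
        exact this.1
      · by_contra hne
        rcases lt_or_gt_of_ne (fun hr => hne (hs.inj hr) : ρ v ≠ ρ w) with hlt | hlt
        · exact hvr w ⟨j, j', hs.next_slot.mpr
            ⟨hv1, hv2, Or.inr ⟨x, a, a', e, hs.symm e', haa, hf⟩⟩⟩ hlt hwK
        · exact hwr v ⟨j', j, hs.next_slot.mpr
            ⟨hw1, hw2, Or.inr ⟨x, a', a, e', hs.symm e, Ne.symm haa, hf⟩⟩⟩ hlt hvK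

/-- A root in `N` must rank above its neighbor `y` in `K`. It is then the only higher neighbor of
`y`, so `y` was the root of `K`. Hence a root in `N` is the parent of the old root, which determines
it and prevents the old root from remaining a root. -/
theorem Rooted.union {K N : Finset V} (hs : IsForest ρ s) (hK : Rooted ρ s K)
    (hN : ∀ p ∈ N, p ∉ K ∧ ∃ y ∈ K, Linked s.2 p y) : Rooted ρ s (K ∪ N) := by
  have hmono : ∀ v, IsRoot ρ s (K ∪ N) v → IsRoot ρ s K v :=
    fun v hv x h1 h2 h3 => hv x h1 h2 (Finset.mem_union_left _ h3)
  have hparent : ∀ p ∈ N, IsRoot ρ s (K ∪ N) p →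
      ∃ y ∈ K, y ∈ s.1 ∧ IsRoot ρ s K y ∧ ∃ j q, s.2 y j = some (p, q) ∧ ρ y < ρ p := by
    intro p hp hr
    obtain ⟨hpK, y, hyK, hl⟩ := hN p hp
    have hpy : ρ y < ρ p := by
      by_contra hle
      have hne : ρ p ≠ ρ y := fun h' => hpK (hs.inj h' ▸ hyK)
      exact hr y hl (by omega) (Finset.mem_union_left _ hyK)
    obtain ⟨q, j, e⟩ := hl
    have e' := hs.symm e
    refine ⟨y, hyK, hs.alive e', ?_, j, q, e', hpy⟩
    rintro x ⟨i, r, ex⟩ hlt hxK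
    obtain rfl := hs.up e' ex hpy hlt
    have := e'.symm.trans ex
    simp only [Option.some.injEq, Prod.mk.injEq] at this
    exact hpK (this.1 ▸ hxK)
  have hmix : ∀ v ∈ K, v ∈ s.1 → IsRoot ρ s (K ∪ N) v → ∀ w ∈ N, IsRoot ρ s (K ∪ N) w →
      v = w := by
    intro v hv hv1 hvr w hw hwr
    obtain ⟨y, hy, hy1, hyr, j, q, e, hlt⟩ := hparent w hw hwr
    obtain rfl := hK v hv hv1 (hmono v hvr) y hy hy1 hyr
    exact absurd (Finset.mem_union_right _ hw) (hvr w ⟨j, q, e⟩ hlt)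
  intro v hv hv1 hvr w hw hw1 hwr
  rcases Finset.mem_union.mp hv with hv | hv <;> rcases Finset.mem_union.mp hw with hw | hw
  · exact hK v hv hv1 (hmono v hvr) w hw hw1 (hmono w hwr)
  · exact hmix v hv hv1 hvr w hw hwr
  · exact (hmix w hw hw1 hwr v hv hvr).symm
  · obtain ⟨y, hy, hy1, hyr, j, q, e, hlt⟩ := hparent v hv hvr
    obtain ⟨y', hy', hy1', hyr', j', q', e', hlt'⟩ := hparent w hw hwr
    obtain rfl := hK y hy hy1 hyr y' hy' hy1' hyr'
    obtain rfl := hs.up e e' hlt hlt'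
    have := e.symm.trans e'
    simp only [Option.some.injEq, Prod.mk.injEq] at this
    exact this.1

/-- A vertex without neighbors in a connected set is its only alive vertex. -/
theorem Rooted.eq_of_isolated {K : Finset V} (hs : IsForest ρ s) (hK : Rooted ρ s K) {y : V}
    (hy : y ∈ K) (hy1 : y ∈ s.1) (hiso : ∀ z ∈ K, ¬ Linked s.2 y z) :
    ∀ z ∈ K, z ∈ s.1 → z = y := by
  intro z hz hz1
  by_contra hne
  -- An alive vertex of highest rank other than `y` is not a root, since the isolated vertex `y`
  -- already is one. Its parent in `K` would rank higher still or be `y`; both are impossible.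
  obtain ⟨w, hw, hmax⟩ := Finset.exists_max_image (K.filter (fun z => z ∈ s.1 ∧ z ≠ y)) ρ
    ⟨z, by simp [hz, hz1, hne]⟩
  simp only [Finset.mem_filter] at hw hmax
  obtain ⟨hwK, hw1, hwy⟩ := hw
  have hyr : IsRoot ρ s K y := fun x hl _ hx => hiso x hx hl
  have hnr : ¬ IsRoot ρ s K w := fun hr => hwy (hK w hwK hw1 hr y hy hy1 hyr)
  unfold IsRoot at hnr
  push Not at hnr
  obtain ⟨x, hl, hlt, hxK⟩ := hnr
  by_cases hxy : x = y
  · subst hxy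
    exact hiso w hwK (hs.linked_symm hl)
  · obtain ⟨j, q, e⟩ := hl
    have := hmax x ⟨hxK, hs.alive' e, hxy⟩
    omega

/-! ### Dirty sets, their frontiers and their growth -/

variable [Fintype V]

open Classical in
/-- The set of neighbors of `u`. -/
noncomputable def linkedSet (σ : Slots V t) (u : V) : Finset V :=
  Finset.univ.filter (Linked σ u)

theorem mem_linkedSet {σ : Slots V t} {u v : V} : v ∈ linkedSet σ u ↔ Linked σ u v := by
  simp [linkedSet]

theorem card_linkedSet_le (σ : Slots V t) (u : V) : (linkedSet σ u).card ≤ deg σ u := by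
  classical
  have hsub : (linkedSet σ u).image some ⊆
      (Finset.univ.filter (fun j => (σ u j).isSome)).image
        (fun j => (σ u j).map Prod.fst) := by
    intro x hx
    obtain ⟨v, hv, rfl⟩ := Finset.mem_image.mp hx
    obtain ⟨j, q, e⟩ := mem_linkedSet.mp hv
    exact Finset.mem_image.mpr ⟨j, by simp [e], by simp [e]⟩
  have := (Finset.card_le_card hsub).trans Finset.card_image_le
  rwa [Finset.card_image_of_injective _ (Option.some_injective V)] at this

open Classical in
/-- The neighbors of `y` outside `D`. -/
noncomputable def outside (σ : Slots V t) (D : Finset V) (y : V) : Finset V :=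
  Finset.univ.filter (fun p => p ∉ D ∧ Linked σ p y)

theorem mem_outside {σ : Slots V t} {D : Finset V} {y p : V} :
    p ∈ outside σ D y ↔ p ∉ D ∧ Linked σ p y := by
  simp [outside]

open Classical in
/-- The vertices of `K` with a neighbor outside `D`. -/
noncomputable def frontier (σ : Slots V t) (D K : Finset V) : Finset V :=
  K.filter (fun y => (outside σ D y).Nonempty)

theorem mem_frontier {σ : Slots V t} {D K : Finset V} {y : V} :
    y ∈ frontier σ D K ↔ y ∈ K ∧ ∃ p ∉ D, Linked σ p y := by
  rw [frontier, Finset.mem_filter]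
  simp only [Finset.Nonempty, mem_outside]

open Classical in
/-- The vertices of `D` together with all neighbors of `Y`. -/
noncomputable def spread (σ : Slots V t) (D Y : Finset V) : Finset V :=
  D ∪ Y.biUnion (outside σ D)

theorem mem_spread {σ : Slots V t} {D Y : Finset V} {p : V} :
    p ∈ spread σ D Y ↔ p ∈ D ∨ (p ∉ D ∧ ∃ y ∈ Y, Linked σ p y) := by
  simp only [spread, Finset.mem_union, Finset.mem_biUnion, mem_outside]
  tauto

theorem subset_spread (σ : Slots V t) (D Y : Finset V) : D ⊆ spread σ D Y :=
  fun _ hp => mem_spread.mpr (Or.inl hp)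

/-- The vertices of `D` with label `l`. -/
def block (D : Finset V) (lab : V → V) (l : V) : Finset V := D.filter (fun u => lab u = l)

theorem mem_block {D : Finset V} {lab : V → V} {l u : V} :
    u ∈ block D lab l ↔ u ∈ D ∧ lab u = l := by
  simp [block]

/-- Two states agree outside `D`, and `D` is divided into at most `Λ.card` blocks that are
connected in both states and have at most two vertices with neighbors outside `D`. -/
structure Dirty (ρ ρ' : V → ℕ) (s s' : State V t) (Λ D : Finset V) : Prop where
  alive_iff : ∀ u, u ∉ D → (u ∈ s.1 ↔ u ∈ s'.1)
  slot_eq : ∀ u, u ∉ D → s.2 u = s'.2 u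
  blocks : ∃ lab : V → V, (∀ u ∈ D, lab u ∈ Λ) ∧ ∀ l ∈ Λ,
    Rooted ρ s (block D lab l) ∧ Rooted ρ' s' (block D lab l) ∧
      (frontier s.2 D (block D lab l)).card ≤ 2

/-- If `y` has degree at most two and at least two neighbors outside `D`, then it is the only
alive vertex of its block. -/
theorem Rooted.eq_of_two_outside {σ : Slots V t} {D K : Finset V} (hs : IsForest ρ s)
    (hK : Rooted ρ s K) (hKD : K ⊆ D) {y : V} (hy : y ∈ K) (hd : deg s.2 y ≤ 2)
    (hσ : ∀ p, p ∉ D → σ p = s.2 p) (h2 : 2 ≤ (outside σ D y).card) :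
    ∀ z ∈ K, z ∈ s.1 → z = y := by
  have hsub : outside σ D y ⊆ linkedSet s.2 y := by
    intro p hp
    obtain ⟨h1, h3⟩ := mem_outside.mp hp
    exact mem_linkedSet.mpr (hs.linked_symm ((linked_congr (hσ p h1)).mp h3))
  obtain ⟨p, hp⟩ : (outside σ D y).Nonempty := Finset.card_pos.mp (by omega)
  obtain ⟨j, q, e⟩ := mem_linkedSet.mp (hsub hp)
  refine hK.eq_of_isolated hs hy (hs.alive e) fun z hz hl => ?_
  -- A neighbor inside the block would be a third neighbor of `y`, so `y` is isolated within its
  -- block.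
  have hss : insert z (outside σ D y) ⊆ linkedSet s.2 y := by
    intro x hx
    rcases Finset.mem_insert.mp hx with rfl | hx
    · exact mem_linkedSet.mpr hl
    · exact hsub hx
  have hz' : z ∉ outside σ D y := fun hz' => (mem_outside.mp hz').1 (hKD hz)
  have := (Finset.card_le_card hss).trans (card_linkedSet_le s.2 y)
  rw [Finset.card_insert_of_notMem hz'] at this
  omega

variable {ρ' : V → ℕ} {s' : State V t} {Λ D : Finset V}

theorem Dirty.card_frontier_le (hD : Dirty ρ ρ' s s' Λ D) :
    (frontier s.2 D D).card ≤ 2 * Λ.card := by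
  classical
  obtain ⟨lab, h1, h2⟩ := hD.blocks
  have hsub : frontier s.2 D D ⊆ Λ.biUnion (fun l => frontier s.2 D (block D lab l)) := by
    intro y hy
    obtain ⟨hyD, hp⟩ := mem_frontier.mp hy
    exact Finset.mem_biUnion.mpr ⟨lab y, h1 y hyD, mem_frontier.mpr ⟨mem_block.mpr ⟨hyD, rfl⟩, hp⟩⟩
  calc (frontier s.2 D D).card ≤ _ := Finset.card_le_card hsub
    _ ≤ ∑ l ∈ Λ, (frontier s.2 D (block D lab l)).card := Finset.card_biUnion_le
    _ ≤ ∑ _l ∈ Λ, 2 := Finset.sum_le_sum fun l hl => (h2 l hl).2.2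
    _ = 2 * Λ.card := by simp [mul_comm]

/-- Links from outside `D` are read off the lists of clean vertices, on which the runs agree. A
degree bound in either run therefore suffices. -/
theorem Dirty.card_outside_le (hD : Dirty ρ ρ' s s' Λ D) (hs : IsForest ρ s)
    (hs' : IsForest ρ' s') {y : V} (hy : deg s.2 y ≤ 2 ∨ deg s'.2 y ≤ 2) :
    (outside s.2 D y).card ≤ 2 := by
  rcases hy with hy | hy
  · refine le_trans (Finset.card_le_card fun p hp => ?_) ((card_linkedSet_le s.2 y).trans hy)
    exact mem_linkedSet.mpr (hs.linked_symm (mem_outside.mp hp).2)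
  · refine le_trans (Finset.card_le_card fun p hp => ?_) ((card_linkedSet_le s'.2 y).trans hy)
    obtain ⟨h1, h2⟩ := mem_outside.mp hp
    exact mem_linkedSet.mpr (hs'.linked_symm ((linked_congr (hD.slot_eq p h1)).mp h2))

/-- Spreading along vertices of degree at most two adds a bounded number of vertices. -/
theorem Dirty.card_spread_le (hD : Dirty ρ ρ' s s' Λ D) (hs : IsForest ρ s)
    (hs' : IsForest ρ' s') {Y : Finset V} (hYD : Y ⊆ D)
    (hY : ∀ y ∈ Y, deg s.2 y ≤ 2 ∨ deg s'.2 y ≤ 2) :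
    (spread s.2 D Y).card ≤ D.card + 4 * Λ.card := by
  classical
  have hsub : Y.biUnion (outside s.2 D) ⊆ (Y ∩ frontier s.2 D D).biUnion (outside s.2 D) := by
    intro p hp
    obtain ⟨y, hy, hpy⟩ := Finset.mem_biUnion.mp hp
    obtain ⟨h1, h2⟩ := mem_outside.mp hpy
    exact Finset.mem_biUnion.mpr ⟨y, Finset.mem_inter.mpr
      ⟨hy, mem_frontier.mpr ⟨hYD hy, p, h1, h2⟩⟩, hpy⟩
  have h1 : (Y.biUnion (outside s.2 D)).card ≤ 4 * Λ.card := by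
    calc (Y.biUnion (outside s.2 D)).card ≤ _ := Finset.card_le_card hsub
      _ ≤ ∑ y ∈ Y ∩ frontier s.2 D D, (outside s.2 D y).card := Finset.card_biUnion_le
      _ ≤ ∑ _y ∈ Y ∩ frontier s.2 D D, 2 := Finset.sum_le_sum fun y hy =>
          hD.card_outside_le hs hs' (hY y (Finset.mem_inter.mp hy).1)
      _ = 2 * (Y ∩ frontier s.2 D D).card := by simp [mul_comm]
      _ ≤ 2 * (frontier s.2 D D).card := by
          have := Finset.card_le_card (Finset.inter_subset_right : Y ∩ frontier s.2 D D ⊆ _)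
          omega
      _ ≤ 4 * Λ.card := by have := hD.card_frontier_le; omega
  have := Finset.card_union_le D (Y.biUnion (outside s.2 D))
  unfold spread
  omega

/-- The point is that no block gets more than two frontier vertices. A frontier vertex in `Y` leaves
the frontier, because all its outside neighbors become dirty. With one such neighbor it is replaced
one for one. With two, its degree bound makes it the only alive vertex of its block, and the new
frontier lies in these two neighbors. -/
theorem Dirty.spread (hD : Dirty ρ ρ' s s' Λ D) (hs : IsForest ρ s)
    (hs' : IsForest ρ' s') {Y : Finset V} (hYD : Y ⊆ D)
    (hY : ∀ y ∈ Y, deg s.2 y ≤ 2 ∨ deg s'.2 y ≤ 2) :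
    Dirty ρ ρ' s s' Λ (spread s.2 D Y) := by
  classical
  obtain ⟨lab, h1, h2⟩ := hD.blocks
  set D₁ := TreeContraction.spread s.2 D Y with hD₁
  have hDD : D ⊆ D₁ := subset_spread _ _ _
  have hpick : ∀ p, ∃ y, p ∈ D₁ → p ∉ D → y ∈ Y ∧ Linked s.2 p y := by
    intro p
    by_cases hp : p ∈ D₁ ∧ p ∉ D
    · rcases mem_spread.mp hp.1 with h | ⟨-, y, hy, hl⟩
      · exact absurd h hp.2
      · exact ⟨y, fun _ _ => ⟨hy, hl⟩⟩
    · exact ⟨p, fun h3 h4 => absurd ⟨h3, h4⟩ hp⟩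
  choose pick hpick using hpick
  refine ⟨fun u hu => hD.alive_iff u fun h => hu (hDD h),
    fun u hu => hD.slot_eq u fun h => hu (hDD h),
    -- A new vertex joins the block of a chosen vertex of `Y` that reached it.
    fun u => if u ∈ D then lab u else lab (pick u), ?_, ?_⟩
  · intro u hu
    by_cases huD : u ∈ D
    · simpa [huD] using h1 u huD
    · simpa [huD] using h1 _ (hYD (hpick u hu huD).1)
  · intro l hl
    obtain ⟨hr, hr', hfr⟩ := h2 l hl
    set K := block D lab l with hK
    set T := (D₁ \ D).filter (fun p => lab (pick p) = l) with hT
    have hKT : block D₁ (fun u => if u ∈ D then lab u else lab (pick u)) l = K ∪ T := by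
      ext u
      simp only [mem_block, hK, hT, Finset.mem_union, Finset.mem_filter, Finset.mem_sdiff]
      by_cases huD : u ∈ D
      · simp [huD, hDD huD]
      · simp [huD]
    have hKD : K ⊆ D := fun u hu => (mem_block.mp hu).1
    have hTK : ∀ p ∈ T, p ∉ D ∧ pick p ∈ Y ∧ pick p ∈ K ∧ Linked s.2 p (pick p) := by
      intro p hp
      simp only [hT, Finset.mem_filter, Finset.mem_sdiff] at hp
      obtain ⟨⟨hp1, hp2⟩, hp3⟩ := hp
      obtain ⟨h3, h4⟩ := hpick p hp1 hp2
      exact ⟨hp2, h3, mem_block.mpr ⟨hYD h3, hp3⟩, h4⟩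
    rw [hKT]
    refine ⟨hr.union hs fun p hp => ?_, hr'.union hs' fun p hp => ?_, ?_⟩
    · obtain ⟨h3, -, h4, h5⟩ := hTK p hp
      exact ⟨fun h => h3 (hKD h), _, h4, h5⟩
    · obtain ⟨h3, -, h4, h5⟩ := hTK p hp
      exact ⟨fun h => h3 (hKD h), _, h4, (linked_congr (hD.slot_eq p h3)).mp h5⟩
    · set Fr := frontier s.2 D K with hFr
      have hsub : frontier s.2 D₁ (K ∪ T) ⊆ (Fr \ Y) ∪ T := by
        intro y hy
        obtain ⟨hyK, p, hp, hl⟩ := mem_frontier.mp hy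
        have hpD : p ∉ D := fun h => hp (hDD h)
        rcases Finset.mem_union.mp hyK with hyK | hyT
        · refine Finset.mem_union_left _ (Finset.mem_sdiff.mpr
            ⟨mem_frontier.mpr ⟨hyK, p, hpD, hl⟩, fun hyY => hp ?_⟩)
          exact mem_spread.mpr (Or.inr ⟨hpD, y, hyY, hl⟩)
        · exact Finset.mem_union_right _ hyT
      have hTsub : T ⊆ (Fr ∩ Y).biUnion (outside s.2 D) := by
        intro p hp
        obtain ⟨h3, h4, h5, h6⟩ := hTK p hp
        exact Finset.mem_biUnion.mpr ⟨pick p, Finset.mem_inter.mpr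
          ⟨mem_frontier.mpr ⟨h5, p, h3, h6⟩, h4⟩, mem_outside.mpr ⟨h3, h6⟩⟩
      have hcard := (Finset.card_le_card hsub).trans (Finset.card_union_le _ _)
      by_cases hall : ∀ y ∈ Fr ∩ Y, (outside s.2 D y).card ≤ 1
      · have hTc : T.card ≤ (Fr ∩ Y).card := by
          calc T.card ≤ _ := Finset.card_le_card hTsub
            _ ≤ ∑ y ∈ Fr ∩ Y, (outside s.2 D y).card := Finset.card_biUnion_le
            _ ≤ ∑ _y ∈ Fr ∩ Y, 1 := Finset.sum_le_sum hall
            _ = (Fr ∩ Y).card := by simp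
        have := Finset.card_sdiff_add_card_inter Fr Y
        omega
      · push Not at hall
        obtain ⟨y, hy, hy2⟩ := hall
        obtain ⟨hyF, hyY⟩ := Finset.mem_inter.mp hy
        have hyK : y ∈ K := (mem_frontier.mp hyF).1
        -- Frontier vertices have a neighbor, hence are alive in both runs, so the run in which `y`
        -- has degree at most two may be used.
        have honly : ∀ z ∈ Fr, z = y := by
          intro z hz
          obtain ⟨hzK, p, hpD, hl⟩ := mem_frontier.mp hz
          rcases hY y hyY with hd | hd
          · obtain ⟨j, q, e⟩ := hl
            exact hr.eq_of_two_outside hs hKD hyK hd (fun _ _ => rfl) hy2 z hzK (hs.alive' e)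
          · obtain ⟨j, q, e⟩ := (linked_congr (hD.slot_eq p hpD)).mp hl
            exact hr'.eq_of_two_outside hs' hKD hyK hd (fun p hp => hD.slot_eq p hp) hy2 z hzK
              (hs'.alive' e)
        have hFY : Fr \ Y = ∅ := by
          rw [Finset.sdiff_eq_empty_iff_subset]
          intro z hz
          rw [honly z hz]; exact hyY
        have hTc : T.card ≤ 2 := by
          refine le_trans (Finset.card_le_card fun p hp => ?_)
            (hD.card_outside_le hs hs' (hY y hyY))
          obtain ⟨z, hz, hpz⟩ := Finset.mem_biUnion.mp (hTsub hp)
          rwa [honly z (Finset.mem_inter.mp hz).1] at hpz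
        rw [hFY] at hcard
        simp only [Finset.card_empty] at hcard
        omega

theorem fate_congr {σ σ' : Slots V t} {h : V → Bool} {u : V} (hu : σ u = σ' u)
    (hd : ∀ v, Linked σ u v → (deg σ v = 1 ↔ deg σ' v = 1)) : fate σ h u = fate σ' h u := by
  have hn := nbrs_congr hu
  have hmem : ∀ v p, (v, p) ∈ nbrs σ u → (deg σ v = 1 ↔ deg σ' v = 1) := by
    intro v p hv
    obtain ⟨j, e⟩ := mem_nbrs.mp hv
    exact hd v ⟨j, p, e⟩
  rw [fate, fate, ← hn]
  rcases hl : nbrs σ u with _ | ⟨⟨v, p⟩, _ | ⟨⟨v', p'⟩, _ | ⟨z, l⟩⟩⟩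
  · rfl
  · have h1 := hmem v p (by simp [hl])
    simp only [ne_eq, h1]
  · have h1 := hmem v p (by simp [hl])
    have h2 := hmem v' p' (by simp [hl])
    simp only [ne_eq, h1, h2]
  · rfl

/-- The vertices of `D` through which differences can spread in a round with coins `h`. -/
noncomputable def carriers (s s' : State V t) (h : V → Bool) (D : Finset V) : Finset V :=
  D.filter (fun y => fate s.2 h y ≠ .keep ∨ fate s'.2 h y ≠ .keep ∨
    ¬ (deg s.2 y = 1 ↔ deg s'.2 y = 1))

/-- `D` and the neighbors of its carriers. -/
noncomputable def halo (s s' : State V t) (h : V → Bool) (D : Finset V) : Finset V :=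
  spread s.2 D (carriers s s' h D)

/-- The new vertices of the halo that are deleted in one of the two runs. -/
noncomputable def relays (s s' : State V t) (h : V → Bool) (D : Finset V) : Finset V :=
  (halo s s' h D \ D).filter (fun y => fate s.2 h y ≠ .keep ∨ fate s'.2 h y ≠ .keep)

/-- A set outside of which the two runs agree after a round, if they agree outside `D` before. -/
noncomputable def nextDirty (s s' : State V t) (h : V → Bool) (D : Finset V) : Finset V :=
  spread s.2 (halo s s' h D) (relays s s' h D)

variable {h : V → Bool}

theorem mem_carriers {y : V} : y ∈ carriers s s' h D ↔ y ∈ D ∧ (fate s.2 h y ≠ .keep ∨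
    fate s'.2 h y ≠ .keep ∨ ¬ (deg s.2 y = 1 ↔ deg s'.2 y = 1)) := by
  simp [carriers]

theorem mem_relays {y : V} : y ∈ relays s s' h D ↔ (y ∈ halo s s' h D ∧ y ∉ D) ∧
    (fate s.2 h y ≠ .keep ∨ fate s'.2 h y ≠ .keep) := by
  simp [relays]

theorem subset_halo : D ⊆ halo s s' h D := subset_spread _ _ _

theorem halo_subset_nextDirty : halo s s' h D ⊆ nextDirty s s' h D := subset_spread _ _ _

/-! ### The dirty set over one round -/

section Step

variable (hD : Dirty ρ ρ' s s' Λ D) (hs : IsForest ρ s) (hs' : IsForest ρ' s')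
include hD hs hs'

/-- Only vertices of degree at most two are ever deleted, and a vertex whose leaf status differs is
a leaf in one of the runs. -/
theorem deg_le_two_of_mem_carriers {y : V} (hy : y ∈ carriers s s' h D) :
    deg s.2 y ≤ 2 ∨ deg s'.2 y ≤ 2 := by
  rcases (mem_carriers.mp hy).2 with h1 | h1 | h1
  · exact Or.inl (hs.deg_le_two_of_ne_keep h1)
  · exact Or.inr (hs'.deg_le_two_of_ne_keep h1)
  · by_contra hcon
    push Not at hcon
    exact h1 (by constructor <;> intro <;> omega)

theorem deg_le_two_of_mem_relays {y : V} (hy : y ∈ relays s s' h D) :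
    deg s.2 y ≤ 2 ∨ deg s'.2 y ≤ 2 := by
  rcases (mem_relays.mp hy).2 with h1 | h1
  · exact Or.inl (hs.deg_le_two_of_ne_keep h1)
  · exact Or.inr (hs'.deg_le_two_of_ne_keep h1)

theorem Dirty.halo : Dirty ρ ρ' s s' Λ (halo s s' h D) :=
  hD.spread hs hs' (Finset.filter_subset _ _) fun _ => deg_le_two_of_mem_carriers hD hs hs'

theorem card_halo_le : (halo s s' h D).card ≤ D.card + 4 * Λ.card :=
  hD.card_spread_le hs hs' (Finset.filter_subset _ _) fun _ =>
    deg_le_two_of_mem_carriers hD hs hs'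

theorem relays_subset_halo : relays s s' h D ⊆ TreeContraction.halo s s' h D :=
  fun _ hy => (mem_relays.mp hy).1.1

theorem card_nextDirty_le : (nextDirty s s' h D).card ≤ D.card + 8 * Λ.card := by
  have h1 := card_halo_le (h := h) hD hs hs'
  have h2 := (hD.halo (h := h) hs hs').card_spread_le hs hs' (relays_subset_halo hD hs hs')
    fun _ => deg_le_two_of_mem_relays hD hs hs'
  unfold nextDirty
  omega

/-- A dirty vertex with a clean neighbor survives the round in both runs. -/
theorem keep_of_linked_clean {x p : V} (hx : x ∈ nextDirty s s' h D)
    (hp : p ∉ nextDirty s s' h D) (hl : Linked s.2 p x) :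
    fate s.2 h x = .keep ∧ fate s'.2 h x = .keep := by
  have hp1 : p ∉ TreeContraction.halo s s' h D := fun h' => hp (halo_subset_nextDirty h')
  have hp0 : p ∉ D := fun h' => hp1 (subset_halo h')
  by_cases hx1 : x ∈ TreeContraction.halo s s' h D
  · by_contra hcon
    have hcon' : fate s.2 h x ≠ .keep ∨ fate s'.2 h x ≠ .keep := by tauto
    by_cases hx0 : x ∈ D
    · refine hp1 (mem_spread.mpr (Or.inr ⟨hp0, x, mem_carriers.mpr ⟨hx0, ?_⟩, hl⟩))
      tauto
    · exact hp (mem_spread.mpr (Or.inr ⟨hp1, x, mem_relays.mpr ⟨⟨hx1, hx0⟩, hcon'⟩, hl⟩))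
  -- Here `x` lies two steps from `D`, next to a relay `y` that is itself next to a carrier `z` in
  -- `D`. This is where spreading stops after two steps.
  · have hx0 : x ∉ D := fun h' => hx1 (subset_halo h')
    obtain ⟨y, hy, hxy⟩ : ∃ y ∈ relays s s' h D, Linked s.2 x y := by
      rcases mem_spread.mp hx with h' | ⟨-, h'⟩
      · exact absurd h' hx1
      · exact h'
    obtain ⟨⟨hy1, hy0⟩, hyf⟩ := mem_relays.mp hy
    obtain ⟨z, hz, hyz⟩ : ∃ z ∈ carriers s s' h D, Linked s.2 y z := by
      rcases mem_spread.mp hy1 with h' | ⟨-, h'⟩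
      · exact absurd h' hy0
      · exact h'
    have hzD := (mem_carriers.mp hz).1
    obtain ⟨b, c, e⟩ := hxy
    obtain ⟨i, a, ez⟩ := hyz
    -- The relay has the two distinct neighbors `z` and `x`, so its deletion is a compression and
    -- not a rake. Hence `x` is not a leaf and shows tails. Its list and its coin are the same in
    -- both runs, so it survives in both.
    have key : ∀ {ρ : V → ℕ} {s : State V t}, IsForest ρ s → s.2 x b = some (y, c) →
        s.2 y i = some (z, a) → fate s.2 h y ≠ .keep → deg s.2 x ≠ 1 ∧ h x = false := by
      intro ρ s hs e ez hf
      have e' := hs.symm e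
      cases hfy : fate s.2 h y with
      | keep => exact absurd hfy hf
      | finalize => simp [IsForest.fate_finalize hfy] at ez
      | rake v p =>
        obtain ⟨-, -, k, -, hall⟩ := IsForest.fate_rake hfy
        obtain rfl := hall _ _ e'
        obtain rfl := hall _ _ ez
        have := ez.symm.trans e'
        simp only [Option.some.injEq, Prod.mk.injEq] at this
        exact absurd (this.1 ▸ hzD) hx0
      | compress v p v' p' => exact (hs.fate_compress hfy).2.2.2 _ _ _ e'
    have hdeg := deg_congr (hD.slot_eq x hx0)
    have e2 : s'.2 x b = some (y, c) := by rw [← hD.slot_eq x hx0]; exact e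
    have hh : deg s.2 x ≠ 1 ∧ h x = false := by
      rcases hyf with hyf | hyf
      · exact key hs e ez hyf
      · have := key hs' e2 (by rw [← hD.slot_eq y hy0]; exact ez) hyf
        rwa [hdeg]
    exact ⟨hs.keep_of_tails e hh.1 hh.2, hs'.keep_of_tails e2 (hdeg ▸ hh.1) hh.2⟩

/-- A dirty vertex with differing leaf status is a carrier and pulls its clean neighbors into the
halo; a vertex outside `D` has the same list in both runs. -/
theorem leaf_iff_of_clean {p x : V} (hp : p ∉ TreeContraction.halo s s' h D)
    (hl : Linked s.2 p x) : deg s.2 x = 1 ↔ deg s'.2 x = 1 := by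
  by_contra hcon
  by_cases hx : x ∈ D
  · exact hp (mem_spread.mpr (Or.inr ⟨fun h' => hp (subset_halo h'), x,
      mem_carriers.mpr ⟨hx, Or.inr (Or.inr hcon)⟩, hl⟩))
  · rw [deg_congr (hD.slot_eq x hx)] at hcon
    exact hcon Iff.rfl

theorem fate_eq_of_clean {p : V} (hp : p ∉ TreeContraction.halo s s' h D) :
    fate s.2 h p = fate s'.2 h p :=
  fate_congr (hD.slot_eq p fun h' => hp (subset_halo h')) fun _ hl =>
    leaf_iff_of_clean hD hs hs' hp hl

/-- Fates can differ only inside the halo. The second spread adds the neighbors of those new halo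
vertices that are deleted, since such deletions rewrite slots. Afterwards every dirty vertex next to
a clean one survives in both runs, so clean lists are updated identically. An edge across the
boundary that arises by compression then comes from compressing a clean vertex, so its dirty end was
on the frontier already. -/
theorem Dirty.next : Dirty ρ ρ' (nextState s h) (nextState s' h) Λ (nextDirty s s' h D) := by
  have h2 : Dirty ρ ρ' s s' Λ (nextDirty s s' h D) :=
    (hD.halo hs hs').spread hs hs' (relays_subset_halo hD hs hs')
      fun _ => deg_le_two_of_mem_relays hD hs hs'
  have hf : ∀ p, p ∉ nextDirty s s' h D → fate s.2 h p = fate s'.2 h p :=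
    fun p hp => fate_eq_of_clean hD hs hs' fun h' => hp (halo_subset_nextDirty h')
  obtain ⟨lab, hl1, hl2⟩ := h2.blocks
  refine ⟨fun u hu => ?_, fun u hu => ?_, lab, hl1, fun l hl => ?_⟩
  · rw [IsForest.mem_next, IsForest.mem_next, h2.alive_iff u hu, hf u hu]
  · funext j
    have hnew : newSlot s.2 h u j = newSlot s'.2 h u j := by
      simp only [newSlot, ← h2.slot_eq u hu]
      cases e : s.2 u j with
      | none => rfl
      | some x =>
        have hfx : fate s.2 h x.1 = fate s'.2 h x.1 := by
          by_cases hx : x.1 ∈ nextDirty s s' h D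
          · obtain ⟨h3, h4⟩ := keep_of_linked_clean hD hs hs' hx hu ⟨j, x.2, e⟩
            rw [h3, h4]
          · exact hf _ hx
        simp only [hfx]
    simp only [nextState, hnew, h2.alive_iff u hu, hf u hu]
  · obtain ⟨hr, hr', hfr⟩ := hl2 l hl
    refine ⟨hr.next hs, hr'.next hs', le_trans (Finset.card_le_card fun y hy => ?_) hfr⟩
    obtain ⟨hyK, p, hp, j, q, e⟩ := mem_frontier.mp hy
    obtain ⟨-, -, ⟨h3, -⟩ | ⟨x, a, b, h3, h4, -, h5⟩⟩ := hs.next_slot.mp e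
    · exact mem_frontier.mpr ⟨hyK, p, hp, j, q, h3⟩
    · refine mem_frontier.mpr ⟨hyK, x, fun hx => ?_, b, q, h4⟩
      exact h5 (keep_of_linked_clean hD hs hs' hx hp ⟨j, a, h3⟩).1

end Step

end Dirty

end TreeContraction

namespace TreeContraction
open RoundBased RoundBased.Prog

/-! ## Progress in one round -/

section Progress

variable {V : Type} {t : ℕ} [LinearOrder V]

/-- `u` is deleted in this round whatever the coins show. -/
def Doomed (σ : Slots V t) (u : V) : Prop :=
  nbrs σ u = [] ∨ ∃ v p, nbrs σ u = [(v, p)] ∧ (deg σ v ≠ 1 ∨ u < v)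

/-- `u` is compressed between `v` and `w` in this round if the coins permit. -/
def Eligible (σ : Slots V t) (u v w : V) : Prop :=
  ∃ p q, nbrs σ u = [(v, p), (w, q)] ∧ deg σ v ≠ 1 ∧ deg σ w ≠ 1

theorem Doomed.fate_ne_keep {σ : Slots V t} {u : V} (hu : Doomed σ u) (h : V → Bool) :
    fate σ h u ≠ .keep := by
  rcases hu with hu | ⟨v, p, hu, hc⟩
  · simp [fate, hu]
  · simp [fate, hu, if_pos hc]

theorem Eligible.fate_ne_keep {σ : Slots V t} {u v w : V} (hu : Eligible σ u v w) {h : V → Bool}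
    (h1 : h u = true) (h2 : h v = false) (h3 : h w = false) : fate σ h u ≠ .keep := by
  obtain ⟨p, q, hu, hv, hw⟩ := hu
  simp [fate, hu, hv, hw, h1, h2, h3]

theorem Eligible.not_doomed {σ : Slots V t} {u v w : V} (hu : Eligible σ u v w) :
    ¬ Doomed σ u := by
  obtain ⟨p, q, hu, -, -⟩ := hu
  rintro (h | ⟨x, y, h, -⟩) <;> simp [hu] at h

theorem Eligible.unique {σ : Slots V t} {u v w v' w' : V} (h : Eligible σ u v w)
    (h' : Eligible σ u v' w') : v = v' ∧ w = w' := by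
  obtain ⟨p, q, hu, -, -⟩ := h
  obtain ⟨p', q', hu', -, -⟩ := h'
  have := hu.symm.trans hu'
  simp only [List.cons.injEq, Prod.mk.injEq, and_true] at this
  exact ⟨this.1.1, this.2.1⟩

theorem nbrs_of_leaf {σ : Slots V t} {x u : V} {b j : Fin t} (hd : deg σ x = 1)
    (e : σ x b = some (u, j)) : nbrs σ x = [(u, j)] := by
  have hl : (nbrs σ x).length = 1 := by rw [length_nbrs, hd]
  obtain ⟨y, hy⟩ := List.length_eq_one_iff.mp hl
  have : (u, j) ∈ nbrs σ x := mem_nbrs.mpr ⟨b, e⟩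
  rw [hy, List.mem_singleton] at this
  rw [hy, this]

variable {ρ : V → ℕ} {s : State V t}

theorem Eligible.ne (hs : IsForest ρ s) {u v w : V} (h : Eligible s.2 u v w) :
    v ≠ u ∧ w ≠ u ∧ v ≠ w := by
  obtain ⟨p, q, hu, -, -⟩ := h
  obtain ⟨-, j, j', hjj, e, e', -⟩ := hs.nbrs_pair hu
  refine ⟨hs.irrefl e, hs.irrefl e', ?_⟩
  rintro rfl
  exact hjj (hs.unique e e')

/-- A leaf fails to rake only if its neighbor is a smaller leaf, and that neighbor is then doomed
itself. -/
theorem doomed_of_leaf_nbr (hs : IsForest ρ s) {x u : V} {b j : Fin t} (hd : deg s.2 x = 1)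
    (e : s.2 x b = some (u, j)) (hu : ¬ Doomed s.2 u) : Doomed s.2 x := by
  refine Or.inr ⟨u, j, nbrs_of_leaf hd e, ?_⟩
  by_contra hcon
  push Not at hcon
  refine hu (Or.inr ⟨x, b, nbrs_of_leaf hcon.1 (hs.symm e), Or.inr ?_⟩)
  exact lt_of_le_of_ne hcon.2 (hs.irrefl e)

variable [Fintype V]

open Classical in
/-- The slots of `v` that hold a neighbor in `D`. -/
noncomputable def slotsIn (σ : Slots V t) (D : Finset V) (v : V) : Finset (Fin t) :=
  Finset.univ.filter (fun j => ∃ x q, σ v j = some (x, q) ∧ x ∈ D)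

theorem mem_slotsIn {σ : Slots V t} {D : Finset V} {v : V} {j : Fin t} :
    j ∈ slotsIn σ D v ↔ ∃ x q, σ v j = some (x, q) ∧ x ∈ D := by
  simp [slotsIn]

/-- The vertex in slot `j` of `v`. -/
def slotVertex (σ : Slots V t) (x : Σ _ : V, Fin t) : V :=
  match σ x.1 x.2 with
  | some (y, _) => y
  | none => x.1

/-- A forest on `D` has average degree at most two. -/
theorem sum_card_slotsIn_le (hs : IsForest ρ s) (D : Finset V) :
    ∑ v ∈ D, (slotsIn s.2 D v).card ≤ 2 * D.card := by
  classical
  rw [← Finset.card_sigma]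
  set E := D.sigma (slotsIn s.2 D) with hE
  have hmem : ∀ x ∈ E, x.1 ∈ D ∧ ∃ q, s.2 x.1 x.2 = some (slotVertex s.2 x, q) ∧
      slotVertex s.2 x ∈ D := by
    intro x hx
    obtain ⟨h1, h2⟩ := Finset.mem_sigma.mp hx
    obtain ⟨y, q, e, hy⟩ := mem_slotsIn.mp h2
    have : slotVertex s.2 x = y := by simp [slotVertex, e]
    exact ⟨h1, q, by rw [this]; exact e, by rw [this]; exact hy⟩
  -- Slots pointing upward are charged to their owner, slots pointing downward to the vertex they
  -- hold. In both cases the charge goes to the lower end of an edge, which has only one higher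
  -- neighbor.
  have h1 : (E.filter (fun x => ρ x.1 < ρ (slotVertex s.2 x))).card ≤ D.card := by
    refine Finset.card_le_card_of_injOn (fun x => x.1) (fun x hx => ?_) ?_
    · exact (hmem x (Finset.mem_filter.mp hx).1).1
    · intro x hx y hy hxy
      obtain ⟨hx1, hx2⟩ := Finset.mem_filter.mp hx
      obtain ⟨hy1, hy2⟩ := Finset.mem_filter.mp hy
      obtain ⟨-, q, e, -⟩ := hmem x hx1
      obtain ⟨-, q', e', -⟩ := hmem y hy1
      obtain ⟨x1, x2⟩ := x
      obtain ⟨y1, y2⟩ := y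
      simp only at hxy
      subst hxy
      obtain rfl := hs.up e e' hx2 hy2
      rfl
  have h2 : (E.filter (fun x => ¬ ρ x.1 < ρ (slotVertex s.2 x))).card ≤ D.card := by
    refine Finset.card_le_card_of_injOn (slotVertex s.2) (fun x hx => ?_) ?_
    · exact (hmem x (Finset.mem_filter.mp hx).1).2.choose_spec.2
    · intro x hx y hy hxy
      obtain ⟨hx1, hx2⟩ := Finset.mem_filter.mp hx
      obtain ⟨hy1, hy2⟩ := Finset.mem_filter.mp hy
      obtain ⟨-, q, e, -⟩ := hmem x hx1
      obtain ⟨-, q', e', -⟩ := hmem y hy1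
      have hne : ρ (slotVertex s.2 x) ≠ ρ x.1 := fun h => hs.irrefl e (hs.inj h)
      have hne' : ρ (slotVertex s.2 y) ≠ ρ y.1 := fun h => hs.irrefl e' (hs.inj h)
      rw [← hxy] at e' hy2 hne'
      obtain rfl := hs.up (hs.symm e) (hs.symm e') (by omega) (by omega)
      obtain ⟨h3, h4⟩ := hs.slot_inj e e'
      exact Sigma.ext h3 (heq_of_eq h4)
  have := Finset.card_filter_add_card_filter_not (s := E) (fun x => ρ x.1 < ρ (slotVertex s.2 x))
  omega

-- A doomed vertex has at most one neighbor, so at most one slot holds it.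
open Classical in
theorem sum_card_slotsIn_doomed_le (hs : IsForest ρ s) (D : Finset V) :
    ∑ v ∈ D, (slotsIn s.2 (D.filter (Doomed s.2)) v).card ≤ (D.filter (Doomed s.2)).card := by
  rw [← Finset.card_sigma]
  have hmem : ∀ x ∈ D.sigma (slotsIn s.2 (D.filter (Doomed s.2))),
      ∃ q, s.2 x.1 x.2 = some (slotVertex s.2 x, q) ∧
      slotVertex s.2 x ∈ D.filter (Doomed s.2) := by
    intro x hx
    obtain ⟨h1, h2⟩ := Finset.mem_sigma.mp hx
    obtain ⟨y, q, e, hy⟩ := mem_slotsIn.mp h2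
    have : slotVertex s.2 x = y := by simp [slotVertex, e]
    exact ⟨q, by rw [this]; exact e, by rw [this]; exact hy⟩
  refine Finset.card_le_card_of_injOn (slotVertex s.2) (fun x hx => (hmem x hx).choose_spec.2) ?_
  intro x hx y hy hxy
  obtain ⟨q, e, hd⟩ := hmem x hx
  obtain ⟨q', e', -⟩ := hmem y hy
  rw [← hxy] at e'
  have h1 := hs.symm e
  have h2 := hs.symm e'
  have : q = q' := by
    rcases (Finset.mem_filter.mp hd).2 with hn | ⟨v, p, hn, -⟩
    · have := mem_nbrs.mpr ⟨q, h1⟩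
      simp [hn] at this
    · obtain ⟨-, i, -, hall⟩ := IsForest.nbrs_singleton hn
      exact (hall _ _ h1).trans (hall _ _ h2).symm
  subst this
  obtain ⟨h3, h4⟩ := hs.slot_inj e e'
  exact Sigma.ext h3 (heq_of_eq h4)

open Classical in
/-- A constant fraction of the vertices that are not on the frontier of `D` are doomed or
eligible. -/
theorem card_le_of_isForest (hs : IsForest ρ s) (D : Finset V) :
    D.card ≤ 3 * (frontier s.2 D D).card + 6 * (D.filter (Doomed s.2)).card +
      (D.filter (fun u => ∃ v w, Eligible s.2 u v w)).card := by
  set Dm := D.filter (Doomed s.2) with hDm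
  -- The weights make every vertex reach 3. Away from the frontier and from doomed vertices, the
  -- degree alone does it from 3 upward. At degree 2 eligibility or a doomed leaf neighbor makes up
  -- the deficit; at degree 1 the neighbor is a doomed leaf. Summing, the degrees contribute at most
  -- `2 * D.card`, which leaves one copy of `D.card` on the left.
  have hpt : ∀ v ∈ D, 3 ≤ (slotsIn s.2 D v).card + 3 * (if v ∈ frontier s.2 D D then 1 else 0) +
      4 * (if Doomed s.2 v then 1 else 0) + (if ∃ x w, Eligible s.2 v x w then 1 else 0) +
      2 * (slotsIn s.2 Dm v).card := by
    intro v hv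
    by_cases hfr : v ∈ frontier s.2 D D
    · simp only [hfr, if_true]; omega
    by_cases hdm : Doomed s.2 v
    · simp only [hdm, if_true]; omega
    have hin : ∀ j x q, s.2 v j = some (x, q) → x ∈ D := by
      intro j x q e
      by_contra hx
      exact hfr (mem_frontier.mpr ⟨hv, x, hx, q, j, hs.symm e⟩)
    have hdeg : (slotsIn s.2 D v).card = deg s.2 v := by
      rw [deg]
      congr 1
      ext j
      rw [mem_slotsIn, Finset.mem_filter, Option.isSome_iff_exists]
      constructor
      · rintro ⟨x, q, e, -⟩; exact ⟨Finset.mem_univ _, _, e⟩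
      · rintro ⟨-, ⟨x, q⟩, e⟩; exact ⟨x, q, e, hin j x q e⟩
    have hleaf : ∀ j x q, s.2 v j = some (x, q) → deg s.2 x = 1 →
        1 ≤ (slotsIn s.2 Dm v).card := by
      intro j x q e hx
      refine Finset.card_pos.mpr ⟨j, mem_slotsIn.mpr ⟨x, q, e, ?_⟩⟩
      exact Finset.mem_filter.mpr ⟨hin j x q e, doomed_of_leaf_nbr hs hx (hs.symm e) hdm⟩
    rw [hdeg]
    have hlen := length_nbrs s.2 v
    rcases hl : nbrs s.2 v with _ | ⟨⟨x, p⟩, _ | ⟨⟨y, q⟩, _ | ⟨z, l⟩⟩⟩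
    · exact absurd (Or.inl hl) hdm
    · obtain ⟨hd1, j, e, -⟩ := IsForest.nbrs_singleton hl
      have hx : deg s.2 x = 1 := by
        by_contra hx
        exact hdm (Or.inr ⟨x, p, hl, Or.inl hx⟩)
      have := hleaf j x p e hx
      omega
    · obtain ⟨hd2, j, j', -, e, e', -⟩ := hs.nbrs_pair hl
      by_cases hx : deg s.2 x = 1
      · have := hleaf j x p e hx
        omega
      · by_cases hy : deg s.2 y = 1
        · have := hleaf j' y q e' hy
          omega
        · have : ∃ x w, Eligible s.2 v x w := ⟨x, y, p, q, hl, hx, hy⟩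
          simp only [this, if_true]
          omega
    · rw [hl] at hlen
      simp only [List.length_cons] at hlen
      omega
  have hsum := Finset.sum_le_sum hpt
  simp only [Finset.sum_add_distrib, ← Finset.mul_sum, ← Finset.card_filter] at hsum
  rw [Finset.sum_const, smul_eq_mul] at hsum
  have h1 := sum_card_slotsIn_le hs D
  have h2 : ∑ v ∈ D, (slotsIn s.2 Dm v).card ≤ Dm.card := sum_card_slotsIn_doomed_le hs D
  have h4 : (D.filter (fun v => Doomed s.2 v)).card = Dm.card := rfl
  have h3 : (D.filter (fun v => v ∈ frontier s.2 D D)).card ≤ (frontier s.2 D D).card :=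
    Finset.card_le_card fun v hv => (Finset.mem_filter.mp hv).2
  omega

end Progress

/-! ## Coins -/

section Coins

variable {V : Type}

/-- `f` depends only on the coins of the rounds before `r`. -/
def DependsBefore {α : Sort*} (r : ℕ) (f : (ℕ → V → Bool) → α) : Prop :=
  ∀ h h' : ℕ → V → Bool, (∀ i < r, h i = h' i) → f h = f h'

theorem DependsBefore.comp {α β : Sort*} {r : ℕ} {f : (ℕ → V → Bool) → α}
    (hf : DependsBefore r f) (g : α → β) : DependsBefore r (fun h => g (f h)) :=
  fun h h' e => congrArg g (hf h h' e)

theorem DependsBefore.comp₂ {α β γ : Sort*} {r : ℕ} {f : (ℕ → V → Bool) → α}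
    {f' : (ℕ → V → Bool) → β} (hf : DependsBefore r f) (hf' : DependsBefore r f')
    (g : α → β → γ) : DependsBefore r (fun h => g (f h) (f' h)) :=
  fun h h' e => by simp only [hf h h' e, hf' h h' e]

theorem DependsBefore.mono {α : Sort*} {r r' : ℕ} {f : (ℕ → V → Bool) → α}
    (hf : DependsBefore r f) (hr : r ≤ r') : DependsBefore r' f :=
  fun h h' e => hf h h' fun i hi => e i (hi.trans_le hr)

theorem dependsBefore_coins (r : ℕ) : DependsBefore (r + 1) (fun h : ℕ → V → Bool => h r) :=
  fun _ _ e => e r (Nat.lt_succ_self r)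

theorem dependsBefore_const {α : Sort*} (r : ℕ) (a : α) :
    DependsBefore (V := V) r (fun _ => a) := fun _ _ _ => rfl

variable {Ω : Type*} [MeasurableSpace Ω] {P : Measure Ω} {heads : Ω → ℕ → V → Bool}

/-- The coins are measurable, independent and fair. -/
structure FairCoins (P : Measure Ω) (heads : Ω → ℕ → V → Bool) : Prop where
  meas : ∀ i v, Measurable (fun ω => heads ω i v)
  indep : iIndepFun (fun (q : ℕ × V) (ω : Ω) => heads ω q.1 q.2) P
  fair : ∀ i v, P {ω | heads ω i v = true} = 1 / 2

variable [Fintype V]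

/-- Such a function factors through the finitely many coin tables of the first `r` rounds, where
every map is measurable. The value `true` filled in for later rounds is never looked at. -/
theorem FairCoins.measurable {α : Type*} [MeasurableSpace α] (hc : FairCoins P heads) {r : ℕ}
    {f : (ℕ → V → Bool) → α} (hf : DependsBefore r f) : Measurable (fun ω => f (heads ω)) := by
  let X : Ω → Fin r → V → Bool := fun ω i v => heads ω i v
  let g : (Fin r → V → Bool) → α :=
    fun x => f (fun i v => if hi : i < r then x ⟨i, hi⟩ v else true)
  have hX : Measurable X :=
    measurable_pi_lambda _ fun i => measurable_pi_lambda _ fun v => hc.meas i v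
  have hg : Measurable g := measurable_of_finite g
  have : (fun ω => f (heads ω)) = g ∘ X := by
    funext ω
    refine hf _ _ fun i hi => ?_
    funext v
    simp [X, hi]
  rw [this]
  exact hg.comp hX

theorem FairCoins.measurableSet (hc : FairCoins P heads) {r : ℕ}
    {Q : (ℕ → V → Bool) → Prop} (hQ : DependsBefore r Q) : MeasurableSet {ω | Q (heads ω)} :=
  measurableSet_setOfPred.mpr (hc.measurable hQ)

variable [IsProbabilityMeasure P]

/-- Three coins of round `r` show a given pattern with probability `1 / 8`, independently of the
earlier rounds. -/
theorem FairCoins.measure_pattern (hc : FairCoins P heads) {r : ℕ} {Q : (ℕ → V → Bool) → Prop}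
    (hQ : DependsBefore r Q) {u v w : V} (hvu : v ≠ u) (hwu : w ≠ u) (hvw : v ≠ w) :
    P.real {ω | Q (heads ω) ∧ heads ω r u = true ∧ heads ω r v = false ∧ heads ω r w = false} =
      P.real {ω | Q (heads ω)} / 8 := by
  classical
  have hhalf : ∀ v, P {ω | heads ω r v = false} = 1 / 2 := by
    intro v
    have h1 : {ω | heads ω r v = false} = {ω | heads ω r v = true}ᶜ := by ext ω; simp
    rw [h1, prob_compl_eq_one_sub (measurableSet_eq_fun (hc.meas r v) measurable_const), hc.fair]
    simp
  let S : Finset (ℕ × V) := Finset.range r ×ˢ Finset.univ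
  let T : Finset (ℕ × V) := {(r, u), (r, v), (r, w)}
  have hST : Disjoint S T := by
    rw [Finset.disjoint_left]
    rintro ⟨i, x⟩ hS hT
    simp only [S, T, Finset.mem_product, Finset.mem_range, Finset.mem_univ, and_true,
      Finset.mem_insert, Finset.mem_singleton, Prod.mk.injEq] at hS hT
    omega
  have hind := hc.indep.indepFun_finset S T hST (fun q => hc.meas q.1 q.2)
  let A : Set (S → Bool) :=
    {x | Q (fun i v => if hi : (i, v) ∈ S then x ⟨(i, v), hi⟩ else true)}
  let B : Set (T → Bool) := {x | x ⟨(r, u), by simp [T]⟩ = true ∧ x ⟨(r, v), by simp [T]⟩ = false ∧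
    x ⟨(r, w), by simp [T]⟩ = false}
  have hA : {ω | Q (heads ω)} = (fun ω (i : S) => heads ω i.1.1 i.1.2) ⁻¹' A := by
    ext ω
    simp only [Set.mem_ofPred_eq, Set.mem_preimage, A]
    refine iff_of_eq (hQ _ _ fun i hi => ?_)
    funext x
    have : (i, x) ∈ S := by simp [S, hi]
    simp [this]
  have hB : {ω | heads ω r u = true ∧ heads ω r v = false ∧ heads ω r w = false} =
      (fun ω (i : T) => heads ω i.1.1 i.1.2) ⁻¹' B := rfl
  have hprod : P {ω | Q (heads ω) ∧ heads ω r u = true ∧ heads ω r v = false ∧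
      heads ω r w = false} = P {ω | Q (heads ω)} *
        P {ω | heads ω r u = true ∧ heads ω r v = false ∧ heads ω r w = false} := by
    have := hind.measure_inter_preimage_eq_mul A B (Set.toFinite _).measurableSet
      (Set.toFinite _).measurableSet
    rw [← hA, ← hB] at this
    exact this
  have hpat : P {ω | heads ω r u = true ∧ heads ω r v = false ∧ heads ω r w = false} =
      1 / 2 * (1 / 2 * (1 / 2)) := by
    have := hc.indep.measure_inter_preimage_eq_mul T
      -- The prescribed outcome is heads exactly at `u`.
      (sets := fun q => {decide (q.2 = u)}) (fun _ _ => MeasurableSet.singleton _)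
    have hne : (r, u) ∉ ({(r, v), (r, w)} : Finset (ℕ × V)) := by
      simp [hvu.symm, hwu.symm]
    have hne' : (r, v) ∉ ({(r, w)} : Finset (ℕ × V)) := by simp [hvw]
    simp only [T] at this
    rw [Finset.prod_insert hne, Finset.prod_insert hne', Finset.prod_singleton] at this
    have e1 : ((fun ω => heads ω (r, u).1 (r, u).2) ⁻¹' {decide ((r, u).2 = u)}) =
        {ω | heads ω r u = true} := by ext ω; simp
    have e2 : ((fun ω => heads ω (r, v).1 (r, v).2) ⁻¹' {decide ((r, v).2 = u)}) =
        {ω | heads ω r v = false} := by ext ω; simp [hvu]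
    have e3 : ((fun ω => heads ω (r, w).1 (r, w).2) ⁻¹' {decide ((r, w).2 = u)}) =
        {ω | heads ω r w = false} := by ext ω; simp [hwu]
    rw [e1, e2, e3, hc.fair, hhalf, hhalf] at this
    rw [← this]
    congr 1
    ext ω
    simp [hvu, hwu]
  rw [Measure.real, Measure.real, hprod, hpat]
  rw [ENNReal.toReal_mul]
  norm_num
  ring

/-- The same factorization shows that only finitely many values occur; their sum serves as a bound.
-/
theorem FairCoins.integrable (hc : FairCoins P heads) {r : ℕ} {f : (ℕ → V → Bool) → ℕ}
    (hf : DependsBefore r f) : Integrable (fun ω => (f (heads ω) : ℝ)) P := by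
  classical
  let g : (Fin r → V → Bool) → ℕ :=
    fun x => f (fun i v => if hi : i < r then x ⟨i, hi⟩ v else true)
  have hfg : ∀ ω, f (heads ω) = g (fun i v => heads ω i v) := by
    intro ω
    refine hf _ _ fun i hi => ?_
    funext v
    simp [hi]
  refine Integrable.of_bound (C := ((∑ x, g x : ℕ) : ℝ)) ?_ (Filter.Eventually.of_forall fun ω => ?_)
  · exact (hc.measurable (hf.comp (fun n : ℕ => (n : ℝ)))).aestronglyMeasurable
  · rw [Real.norm_of_nonneg (Nat.cast_nonneg _), Nat.cast_le, hfg]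
    exact Finset.single_le_sum (f := g) (fun _ _ => Nat.zero_le _)
      (Finset.mem_univ (fun (i : Fin r) v => heads ω i v))

theorem integral_card_filter {α : Type*} [Fintype α] {Q : α → Ω → Prop}
    [∀ ω, DecidablePred fun x => Q x ω]
    (hQ : ∀ x, MeasurableSet {ω | Q x ω}) :
    ∫ ω, ((Finset.univ.filter (fun x => Q x ω)).card : ℝ) ∂P = ∑ x, P.real {ω | Q x ω} := by
  have h1 : ∀ ω, ((Finset.univ.filter (fun x => Q x ω)).card : ℝ) =
      ∑ x, ({ω | Q x ω}.indicator (fun _ => (1 : ℝ)) ω) := by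
    intro ω
    rw [Finset.card_filter, Nat.cast_sum]
    refine Finset.sum_congr rfl fun x _ => ?_
    by_cases hx : Q x ω <;> simp [hx]
  simp only [h1]
  rw [integral_finsetSum _ fun x _ => (integrable_const (1 : ℝ)).indicator (hQ x)]
  refine Finset.sum_congr rfl fun x _ => ?_
  rw [integral_indicator (hQ x)]
  simp

end Coins

end TreeContraction

namespace TreeContraction
open RoundBased RoundBased.Prog

/-! ## Expected sizes -/

section Expectation

variable {V : Type} {t : ℕ} [LinearOrder V] [Fintype V]
  {Ω : Type*} [MeasurableSpace Ω] {P : Measure Ω} [IsProbabilityMeasure P]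
  {heads : Ω → ℕ → V → Bool} {ρ ρ' : V → ℕ} {s s' : State V t}

theorem dependsBefore_stateAt (s : State V t) (r : ℕ) :
    DependsBefore r (fun h => stateAt s h r) := by
  induction r with
  | zero => exact fun _ _ _ => rfl
  | succ r ih => exact (ih.mono (Nat.le_succ r)).comp₂ (dependsBefore_coins r) nextState

open Classical in
/-- The expected number of alive vertices in a set with a small frontier shrinks by a constant
factor in each round, up to the number of vertices that are added to the set. -/
theorem FairCoins.integral_card_inter_succ_le (hc : FairCoins P heads) (hs : IsForest ρ s)
    {r m : ℕ} {D D' : (ℕ → V → Bool) → Finset V} (hD : DependsBefore r D)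
    (hD' : DependsBefore (r + 1) D') (hsub : ∀ h, D h ⊆ D' h)
    (hcard : ∀ h, (D' h).card ≤ (D h).card + 8 * m)
    (hfr : ∀ h, (frontier (stateAt s h r).2 (D h) (D h)).card ≤ 2 * m) :
    8 * ∫ ω, ((D' (heads ω) ∩ (stateAt s (heads ω) (r + 1)).1).card : ℝ) ∂P ≤
      7 * ∫ ω, ((D (heads ω) ∩ (stateAt s (heads ω) r).1).card : ℝ) ∂P + 70 * m := by
  let K : (ℕ → V → Bool) → Finset V := fun h => D h ∩ (stateAt s h r).1
  let X : (ℕ → V → Bool) → ℕ := fun h => (K h).card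
  let Y : (ℕ → V → Bool) → ℕ := fun h => (D' h ∩ (stateAt s h (r + 1)).1).card
  let Dm : (ℕ → V → Bool) → ℕ := fun h => ((K h).filter (Doomed (stateAt s h r).2)).card
  -- The neighbors of an eligible vertex depend on earlier coins. Ranging over all fixed triples
  -- `(u, v, w)` makes the three coins deterministic, so that they are independent of the event `Q`.
  let Q : V × V × V → (ℕ → V → Bool) → Prop := fun x h =>
    x.1 ∈ K h ∧ Eligible (stateAt s h r).2 x.1 x.2.1 x.2.2
  let R : V × V × V → (ℕ → V → Bool) → Prop := fun x h =>
    Q x h ∧ h r x.1 = true ∧ h r x.2.1 = false ∧ h r x.2.2 = false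
  let El : (ℕ → V → Bool) → ℕ := fun h => (Finset.univ.filter (fun x => Q x h)).card
  let Pt : (ℕ → V → Bool) → ℕ := fun h => (Finset.univ.filter (fun x => R x h)).card
  have hst := dependsBefore_stateAt s r
  have hK : DependsBefore r K := hD.comp₂ hst fun D s => D ∩ s.1
  have hX : DependsBefore r X := hK.comp Finset.card
  have hY : DependsBefore (r + 1) Y :=
    hD'.comp₂ (dependsBefore_stateAt s (r + 1)) fun D s => (D ∩ s.1).card
  have hDm : DependsBefore r Dm := hK.comp₂ hst fun K s => (K.filter (Doomed s.2)).card
  have hQ : ∀ x, DependsBefore r (Q x) := fun x =>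
    hK.comp₂ hst fun K s => x.1 ∈ K ∧ Eligible s.2 x.1 x.2.1 x.2.2
  have hR : ∀ x, DependsBefore (r + 1) (R x) := fun x =>
    ((hQ x).mono (Nat.le_succ r)).comp₂ (dependsBefore_coins r) fun q c =>
      q ∧ c x.1 = true ∧ c x.2.1 = false ∧ c x.2.2 = false
  have hEl : DependsBefore r El := fun h h' e => by
    have : ∀ x, Q x h = Q x h' := fun x => hQ x h h' e
    simp only [El, this]
  have hPt : DependsBefore (r + 1) Pt := fun h h' e => by
    have : ∀ x, R x h = R x h' := fun x => hR x h h' e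
    simp only [Pt, this]
  have hElPt : ∫ ω, (El (heads ω) : ℝ) ∂P = 8 * ∫ ω, (Pt (heads ω) : ℝ) ∂P := by
    have h1 := integral_card_filter (P := P) (Q := fun x ω => Q x (heads ω))
      (fun x => hc.measurableSet (hQ x))
    have h2 := integral_card_filter (P := P) (Q := fun x ω => R x (heads ω))
      (fun x => hc.measurableSet (hR x))
    simp only [El, Pt]
    rw [h1, h2, Finset.mul_sum]
    refine Finset.sum_congr rfl fun x _ => ?_
    by_cases hx : x.2.1 ≠ x.1 ∧ x.2.2 ≠ x.1 ∧ x.2.1 ≠ x.2.2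
    · have := hc.measure_pattern (hQ x) hx.1 hx.2.1 hx.2.2
      simp only [R]
      rw [this]
      ring
    -- A triple with a repetition is never eligible and contributes zero to both sides.
    · have hemp : ∀ h, ¬ Q x h := fun h hq => hx (hq.2.ne (hs.stateAt h r))
      have hemp' : ∀ h, ¬ R x h := fun h hq => hemp h hq.1
      simp [hemp, hemp']
  -- The structural count for the alive part of `D`: its frontier is contained in that of `D`,
  -- because linked vertices are alive.
  have hp1 : ∀ h, X h ≤ 6 * m + 6 * Dm h + El h := by
    intro h
    have hf := hs.stateAt h r
    have h1 := card_le_of_isForest hf (K h)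
    have h2 : (frontier (stateAt s h r).2 (K h) (K h)).card ≤ 2 * m := by
      refine le_trans (Finset.card_le_card fun y hy => ?_) (hfr h)
      obtain ⟨hyK, p, hp, j, q, e⟩ := mem_frontier.mp hy
      refine mem_frontier.mpr ⟨(Finset.mem_inter.mp hyK).1, p, fun hpD => hp ?_, j, q, e⟩
      exact Finset.mem_inter.mpr ⟨hpD, hf.alive e⟩
    have h3 : ((K h).filter (fun u => ∃ v w, Eligible (stateAt s h r).2 u v w)).card ≤ El h := by
      refine le_trans (Finset.card_le_card ?_)
        (Finset.card_image_le (s := Finset.univ.filter (fun x => Q x h)) (f := Prod.fst))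
      intro u hu
      obtain ⟨hu1, v, w, hu2⟩ := Finset.mem_filter.mp hu
      exact Finset.mem_image.mpr
        ⟨(u, v, w), Finset.mem_filter.mpr ⟨Finset.mem_univ _, hu1, hu2⟩, rfl⟩
    simp only [X, Dm] at *
    omega
  -- Survivors `A`, doomed vertices `B` and compressed eligible vertices `C` are disjoint parts of
  -- the alive part of `D`; the term `8 * m` pays for vertices new in `D'`.
  have hp2 : ∀ h, Y h + Dm h + Pt h ≤ X h + 8 * m := by
    intro h
    have hf := hs.stateAt h r
    set σ := (stateAt s h r).2 with hσ
    set A := (K h).filter (fun u => fate σ (h r) u = .keep) with hA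
    set B := (K h).filter (Doomed σ) with hB
    set C := (Finset.univ.filter (fun x => R x h)).image Prod.fst with hC
    have hCc : C.card = Pt h := by
      refine Finset.card_image_of_injOn ?_
      rintro ⟨u, v, w⟩ hx ⟨u', v', w'⟩ hy huu
      simp only at huu
      subst huu
      have hx' := (Finset.mem_filter.mp hx).2.1.2
      have hy' := (Finset.mem_filter.mp hy).2.1.2
      obtain ⟨rfl, rfl⟩ := hx'.unique hy'
      rfl
    have hCmem : ∀ u ∈ C, u ∈ K h ∧ fate σ (h r) u ≠ .keep ∧ ¬ Doomed σ u := by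
      intro u hu
      obtain ⟨x, hx, rfl⟩ := Finset.mem_image.mp hu
      obtain ⟨-, ⟨h1, h2⟩, h3, h4, h5⟩ := Finset.mem_filter.mp hx
      exact ⟨h1, h2.fate_ne_keep h3 h4 h5, h2.not_doomed⟩
    have hdis1 : Disjoint A B := by
      rw [Finset.disjoint_left]
      intro u hu hu'
      exact (Finset.mem_filter.mp hu').2.fate_ne_keep (h r) (Finset.mem_filter.mp hu).2
    have hdis2 : Disjoint (A ∪ B) C := by
      rw [Finset.disjoint_left]
      intro u hu hu'
      obtain ⟨-, h2, h3⟩ := hCmem u hu'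
      rcases Finset.mem_union.mp hu with hu | hu
      · exact h2 (Finset.mem_filter.mp hu).2
      · exact h3 (Finset.mem_filter.mp hu).2
    have hABC : A.card + B.card + C.card ≤ (K h).card := by
      rw [← Finset.card_union_of_disjoint hdis1, ← Finset.card_union_of_disjoint hdis2]
      refine Finset.card_le_card fun u hu => ?_
      rcases Finset.mem_union.mp hu with hu | hu
      · rcases Finset.mem_union.mp hu with hu | hu
        · exact (Finset.mem_filter.mp hu).1
        · exact (Finset.mem_filter.mp hu).1
      · exact (hCmem u hu).1
    have hYA : Y h ≤ A.card + 8 * m := by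
      have h1 : D' h ∩ (stateAt s h (r + 1)).1 ⊆ A ∪ (D' h \ D h) := by
        intro u hu
        obtain ⟨hu1, hu2⟩ := Finset.mem_inter.mp hu
        obtain ⟨hu3, hu4⟩ := IsForest.mem_next.mp hu2
        by_cases huD : u ∈ D h
        · exact Finset.mem_union_left _ (Finset.mem_filter.mpr
            ⟨Finset.mem_inter.mpr ⟨huD, hu3⟩, hu4⟩)
        · exact Finset.mem_union_right _ (Finset.mem_sdiff.mpr ⟨hu1, huD⟩)
      have h2 := (Finset.card_le_card h1).trans (Finset.card_union_le _ _)
      have h3 := Finset.card_sdiff_add_card_eq_card (hsub h)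
      have h4 := hcard h
      simp only [Y]
      omega
    have hBDm : Dm h = B.card := rfl
    simp only [X]
    omega
  have iX := hc.integrable hX
  have iY := hc.integrable hY
  have iDm := hc.integrable hDm
  have iEl := hc.integrable hEl
  have iPt := hc.integrable hPt
  have i1 : Integrable (fun ω => 6 * (m : ℝ) + 6 * (Dm (heads ω) : ℝ)) P :=
    (integrable_const _).add (iDm.const_mul 6)
  have i2 : Integrable (fun ω => (Y (heads ω) : ℝ) + (Dm (heads ω) : ℝ)) P := iY.add iDm
  have e1 : ∫ ω, (X (heads ω) : ℝ) ∂P ≤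
      6 * m + 6 * ∫ ω, (Dm (heads ω) : ℝ) ∂P + ∫ ω, (El (heads ω) : ℝ) ∂P := by
    have : ∫ ω, (X (heads ω) : ℝ) ∂P ≤
        ∫ ω, (6 * m + 6 * (Dm (heads ω) : ℝ) + (El (heads ω) : ℝ)) ∂P := by
      refine integral_mono iX (i1.add iEl) fun ω => ?_
      have := hp1 (heads ω)
      change (X (heads ω) : ℝ) ≤ 6 * (m : ℝ) + 6 * (Dm (heads ω) : ℝ) + (El (heads ω) : ℝ)
      exact_mod_cast this
    rwa [integral_add i1 iEl,
      integral_add (integrable_const _) (iDm.const_mul 6), integral_const, probReal_univ, one_smul,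
      integral_const_mul] at this
  have e2 : ∫ ω, (Y (heads ω) : ℝ) ∂P + ∫ ω, (Dm (heads ω) : ℝ) ∂P + ∫ ω, (Pt (heads ω) : ℝ) ∂P ≤
      ∫ ω, (X (heads ω) : ℝ) ∂P + 8 * m := by
    have : ∫ ω, ((Y (heads ω) : ℝ) + (Dm (heads ω) : ℝ) + (Pt (heads ω) : ℝ)) ∂P ≤
        ∫ ω, ((X (heads ω) : ℝ) + 8 * m) ∂P := by
      refine integral_mono (i2.add iPt) (iX.add (integrable_const _)) fun ω => ?_
      have := hp2 (heads ω)
      change (Y (heads ω) : ℝ) + (Dm (heads ω) : ℝ) + (Pt (heads ω) : ℝ) ≤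
        (X (heads ω) : ℝ) + 8 * (m : ℝ)
      exact_mod_cast this
    rwa [integral_add i2 iPt, integral_add iY iDm,
      integral_add iX (integrable_const _), integral_const, probReal_univ, one_smul] at this
  have e3 : 0 ≤ ∫ ω, (Dm (heads ω) : ℝ) ∂P := integral_nonneg fun ω => Nat.cast_nonneg _
  change 8 * ∫ ω, (Y (heads ω) : ℝ) ∂P ≤ 7 * ∫ ω, (X (heads ω) : ℝ) ∂P + 70 * m
  -- With the expected `El` equal to eight times the expected `Pt`, this is eight times `e2` plus
  -- `e1`; two copies of the expected `Dm` remain and are dropped as nonnegative.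
  linarith

/-- The expected number of alive vertices decays exponentially. -/
theorem FairCoins.integral_card_alive_le (hc : FairCoins P heads) (hs : IsForest ρ s) (r : ℕ) :
    ∫ ω, ((stateAt s (heads ω) r).1.card : ℝ) ∂P ≤ Fintype.card V * (7 / 8 : ℝ) ^ r := by
  classical
  induction r with
  | zero =>
    simp only [stateAt, integral_const, probReal_univ, one_smul, pow_zero, mul_one, Nat.cast_le]
    exact Finset.card_le_univ _
  | succ r ih =>
    -- With the whole vertex set as `D` and `D'` there is no frontier and no growth, so `m = 0` is
    -- allowed.
    have := hc.integral_card_inter_succ_le hs (r := r) (m := 0)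
      (dependsBefore_const r Finset.univ) (dependsBefore_const (r + 1) Finset.univ)
      (fun _ => subset_rfl) (fun _ => by simp) (fun h => by
        rw [Nat.mul_zero, Nat.le_zero, Finset.card_eq_zero, Finset.eq_empty_iff_forall_notMem]
        intro y hy
        obtain ⟨-, p, hp, -⟩ := mem_frontier.mp hy
        exact hp (Finset.mem_univ _))
    simp only [Finset.univ_inter] at this
    rw [pow_succ]
    norm_num at this ⊢
    linarith

/-- The dirty set at the beginning of round `r`. -/
noncomputable def dirtyAt (s s' : State V t) (D : Finset V) (h : ℕ → V → Bool) : ℕ → Finset V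
  | 0 => D
  | r + 1 => nextDirty (stateAt s h r) (stateAt s' h r) (h r) (dirtyAt s s' D h r)

theorem dependsBefore_dirtyAt (s s' : State V t) (D : Finset V) (r : ℕ) :
    DependsBefore r (fun h => dirtyAt s s' D h r) := by
  induction r with
  | zero => exact fun _ _ _ => rfl
  | succ r ih =>
    intro h h' e
    simp only [dirtyAt]
    have h1 : dirtyAt s s' D h r = dirtyAt s s' D h' r := ih h h' fun i hi => e i (hi.trans r.lt_succ_self)
    have h2 := dependsBefore_stateAt s r h h' fun i hi => e i (hi.trans r.lt_succ_self)
    have h3 := dependsBefore_stateAt s' r h h' fun i hi => e i (hi.trans r.lt_succ_self)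
    simp only at h2 h3
    rw [h1, h2, h3, e r r.lt_succ_self]

theorem Dirty.dirtyAt {Λ D : Finset V} (hD : Dirty ρ ρ' s s' Λ D) (hs : IsForest ρ s)
    (hs' : IsForest ρ' s') (h : ℕ → V → Bool) (r : ℕ) :
    Dirty ρ ρ' (stateAt s h r) (stateAt s' h r) Λ (dirtyAt s s' D h r) := by
  induction r with
  | zero => exact hD
  | succ r ih => exact ih.next (hs.stateAt h r) (hs'.stateAt h r)

/-- The frontier bound is recorded only for the first run; this carries it over to the second. -/
theorem Dirty.frontier_eq {Λ D : Finset V} (hD : Dirty ρ ρ' s s' Λ D) (K : Finset V) :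
    frontier s'.2 D K = frontier s.2 D K := by
  ext y
  simp only [mem_frontier]
  refine and_congr_right fun _ => exists_congr fun p => and_congr_right fun hp => ?_
  exact (linked_congr (hD.slot_eq p hp)).symm

open Classical in
/-- The expected number of alive dirty vertices is bounded by the number of blocks. -/
theorem FairCoins.integral_card_dirtyAt_le (hc : FairCoins P heads) {Λ D : Finset V}
    (hD : Dirty ρ ρ' s s' Λ D) (hs : IsForest ρ s) (hs' : IsForest ρ' s')
    (hDΛ : D.card ≤ Λ.card) (r : ℕ) :
    ∫ ω, ((dirtyAt s s' D (heads ω) r ∩ (stateAt s (heads ω) r).1).card : ℝ) ∂P ≤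
        70 * Λ.card ∧
      ∫ ω, ((dirtyAt s s' D (heads ω) r ∩ (stateAt s' (heads ω) r).1).card : ℝ) ∂P ≤
        70 * Λ.card := by
  induction r with
  | zero =>
    simp only [TreeContraction.dirtyAt, stateAt, integral_const, probReal_univ, one_smul]
    have h1 : ∀ A : Finset V, ((D ∩ A).card : ℝ) ≤ Λ.card := fun A =>
      Nat.cast_le.mpr ((Finset.card_le_card Finset.inter_subset_left).trans hDΛ)
    have h2 : (0 : ℝ) ≤ Λ.card := Nat.cast_nonneg _
    exact ⟨by linarith [h1 s.1], by linarith [h1 s'.1]⟩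
  | succ r ih =>
    have hd := dependsBefore_dirtyAt s s' D
    have hsub : ∀ h, TreeContraction.dirtyAt s s' D h r ⊆
        TreeContraction.dirtyAt s s' D h (r + 1) :=
      fun h => subset_halo.trans halo_subset_nextDirty
    have hcard : ∀ h, (TreeContraction.dirtyAt s s' D h (r + 1)).card ≤
        (TreeContraction.dirtyAt s s' D h r).card + 8 * Λ.card := fun h =>
      card_nextDirty_le (hD.dirtyAt hs hs' h r) (hs.stateAt h r) (hs'.stateAt h r)
    have hfr := fun h => (hD.dirtyAt hs hs' h r).card_frontier_le
    have h1 := hc.integral_card_inter_succ_le hs (hd r) (hd (r + 1)) hsub hcard hfr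
    have h2 := hc.integral_card_inter_succ_le hs' (hd r) (hd (r + 1)) hsub hcard
      (fun h => by rw [(hD.dirtyAt hs hs' h r).frontier_eq]; exact hfr h)
    -- The value 70 is the fixed point of the recursion `8 * a' ≤ 7 * a + 70`.
    exact ⟨by linarith [ih.1], by linarith [ih.2]⟩

end Expectation

end TreeContraction

namespace TreeContraction
open RoundBased RoundBased.Prog

/-! ## Numerical estimates -/

section Estimates

theorem seven_eighths_pow_le (R : ℕ) : (7 / 8 : ℝ) ^ R ≤ Real.exp (-(R / 8)) := by
  have h1 : (7 / 8 : ℝ) ≤ Real.exp (-(1 / 8)) := by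
    have := Real.add_one_le_exp (-(1 / 8) : ℝ)
    linarith
  calc (7 / 8 : ℝ) ^ R ≤ Real.exp (-(1 / 8)) ^ R := pow_le_pow_left₀ (by norm_num) h1 R
    _ = Real.exp (-(R / 8)) := by rw [← Real.exp_nat_mul]; congr 1; ring

/-- Logarithmically many rounds suffice with high probability. -/
theorem mul_pow_floor_le {n : ℕ} (hn : 2 ≤ n) {B c : ℝ} (hB : 24 ≤ B) (hc : 1 ≤ c) :
    (n : ℝ) * (7 / 8 : ℝ) ^ ⌊B * c * Real.log n⌋₊ ≤ (n : ℝ) ^ (-c) := by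
  have hn0 : (0 : ℝ) < n := by positivity
  -- This lower bound absorbs the loss of less than one round caused by the floor; the constant 24
  -- gives `R / 8 > 3 * c * log n - 1 / 8`, while `2 * c * log n` is needed.
  have hlog : 1 / 2 ≤ Real.log n := by
    have h1 : Real.log 2 ≤ Real.log n :=
      Real.log_le_log (by norm_num) (by exact_mod_cast hn)
    have := Real.log_two_gt_d9
    linarith
  have hfl := Nat.lt_floor_add_one (B * c * Real.log n)
  set R := ⌊B * c * Real.log n⌋₊
  have h1 : 24 * c * Real.log n ≤ B * c * Real.log n := by
    gcongr
  have h2 : Real.log n ≤ c * Real.log n := le_mul_of_one_le_left (by linarith) hc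
  calc (n : ℝ) * (7 / 8 : ℝ) ^ R ≤ Real.exp (Real.log n) * Real.exp (-(R / 8)) := by
        rw [Real.exp_log hn0]
        exact mul_le_mul_of_nonneg_left (seven_eighths_pow_le R) hn0.le
    _ = Real.exp (Real.log n - R / 8) := by rw [← Real.exp_add]; congr 1
    _ ≤ Real.exp (Real.log n * (-c)) := by
        apply Real.exp_le_exp.mpr
        nlinarith
    _ = (n : ℝ) ^ (-c) := by rw [Real.rpow_def_of_pos hn0]

theorem hasSum_geometric (n : ℝ) : HasSum (fun r : ℕ => n * (7 / 8 : ℝ) ^ r) (8 * n) := by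
  have := (hasSum_geometric_of_lt_one (r := (7 / 8 : ℝ)) (by norm_num) (by norm_num)).mul_left n
  rwa [show n * (1 - 7 / 8 : ℝ)⁻¹ = 8 * n by norm_num [mul_comm]] at this

theorem summable_min {n : ℝ} (hn : 0 ≤ n) (k : ℝ) (hk : 0 ≤ k) :
    Summable (fun r : ℕ => min k (n * (7 / 8 : ℝ) ^ r)) :=
  Summable.of_nonneg_of_le (fun r => le_min hk (by positivity)) (fun r => min_le_right _ _)
    (hasSum_geometric n).summable

/-- For `n ≤ k` the whole geometric series is at most `8 * n`, comparable with the right side. For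
`n > k` the sum is cut after about `8 * log (1 + n / k)` rounds: each earlier term is at most `k`,
and from there on a geometric series starting below `k` remains. -/
theorem tsum_min_le {n k : ℝ} (hn : 0 ≤ n) (hk : 0 < k) :
    ∑' r : ℕ, min k (n * (7 / 8 : ℝ) ^ r) ≤ 26 * (k * Real.log (1 + n / k)) := by
  have hx : 0 ≤ n / k := by positivity
  have hlog : n / k / (1 + n / k) ≤ Real.log (1 + n / k) := by
    have h1 := Real.one_sub_inv_le_log_of_pos (show 0 < 1 + n / k by positivity)
    have h2 : n / k / (1 + n / k) = 1 - (1 + n / k)⁻¹ := by field_simp; ring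
    rw [h2]; exact h1
  have hsum := summable_min hn k hk.le
  rcases le_or_gt n k with hnk | hnk
  · have h1 : ∑' r : ℕ, min k (n * (7 / 8 : ℝ) ^ r) ≤ 8 * n :=
      hsum.tsum_le_of_sum_le fun S => by
        refine (Finset.sum_le_sum fun r _ => min_le_right _ _).trans ?_
        exact sum_le_hasSum S (fun r _ => by positivity) (hasSum_geometric n)
    have h2 : n / 2 ≤ k * Real.log (1 + n / k) := by
      have h3 : k * (n / k / (1 + n / k)) ≤ k * Real.log (1 + n / k) :=
        mul_le_mul_of_nonneg_left hlog hk.le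
      refine le_trans ?_ h3
      have h4 : k * (n / k / (1 + n / k)) = n / (1 + n / k) := by field_simp
      have h5 : n / k ≤ 1 := (div_le_one hk).mpr hnk
      rw [h4]
      exact div_le_div_of_nonneg_left hn (by positivity) (by linarith)
    linarith
  · have hx1 : 1 ≤ n / k := (one_le_div hk).mpr hnk.le
    have hlog2 : 1 / 2 ≤ Real.log (1 + n / k) := by
      refine le_trans ?_ hlog
      rw [div_le_div_iff₀ (by norm_num) (by positivity)]
      linarith
    set l := Real.log (1 + n / k) with hl
    set R := ⌈8 * l⌉₊ with hR
    have hR1 : 8 * l ≤ R := Nat.le_ceil _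
    have hR2 : (R : ℝ) < 8 * l + 1 := Nat.ceil_lt_add_one (by linarith)
    have hpow : (7 / 8 : ℝ) ^ R ≤ (1 + n / k)⁻¹ := by
      refine (seven_eighths_pow_le R).trans ?_
      rw [← Real.exp_log (show 0 < (1 + n / k)⁻¹ by positivity), Real.log_inv]
      apply Real.exp_le_exp.mpr
      linarith
    have htail : n * (7 / 8 : ℝ) ^ R ≤ k := by
      refine (mul_le_mul_of_nonneg_left hpow hn).trans ?_
      rw [← div_eq_mul_inv, div_le_iff₀ (by positivity)]
      have : k * (1 + n / k) = k + n := by field_simp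
      linarith
    have h1 : ∑' r : ℕ, min k (n * (7 / 8 : ℝ) ^ (r + R)) ≤ 8 * k := by
      have hs' := (summable_nat_add_iff R).mpr hsum
      refine hs'.tsum_le_of_sum_le fun S => ?_
      refine (Finset.sum_le_sum fun r _ => (min_le_right _ _).trans ?_).trans
        (sum_le_hasSum S (fun r _ => ?_) (hasSum_geometric k))
      · rw [pow_add, mul_comm ((7 / 8 : ℝ) ^ r), ← mul_assoc]
        exact mul_le_mul_of_nonneg_right htail (by positivity)
      · positivity
    have h2 : ∑ r ∈ Finset.range R, min k (n * (7 / 8 : ℝ) ^ r) ≤ R * k := by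
      refine (Finset.sum_le_sum fun r _ => min_le_left _ _).trans ?_
      simp
    rw [← hsum.sum_add_tsum_nat_add R]
    -- Head and tail together are at most `(8 * l + 9) * k`, and `l ≥ 1 / 2` turns `9 * k` into `18
    -- * l * k`.
    nlinarith

end Estimates

/-! ## Bounds for runs -/

section Bounds

variable {V : Type} {t : ℕ} [LinearOrder V] [Fintype V]
  {Ω : Type*} [MeasurableSpace Ω] {P : Measure Ω} [IsProbabilityMeasure P]
  {heads : Ω → ℕ → V → Bool} {ρ ρ' : V → ℕ} {F F' : SimpleGraph V}

theorem FairCoins.lintegral_natCast (hc : FairCoins P heads) {r : ℕ} {f : (ℕ → V → Bool) → ℕ}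
    (hf : DependsBefore r f) :
    ∫⁻ ω, (f (heads ω) : ℝ≥0∞) ∂P = ENNReal.ofReal (∫ ω, (f (heads ω) : ℝ) ∂P) := by
  rw [ofReal_integral_eq_lintegral_ofReal (hc.integrable hf)
    (Filter.Eventually.of_forall fun ω => Nat.cast_nonneg _)]
  simp

/-- If the work in round `r` is at most `W` times a number with expectation at most `b r`, then the
expected total work is at most `W * ∑' r, b r`. -/
theorem FairCoins.lintegral_tsum_le (hc : FairCoins P heads) {W : ℕ} {T : Ω → ℕ → ℝ≥0∞}
    {f : ℕ → (ℕ → V → Bool) → ℕ} (hf : ∀ r, DependsBefore r (f r))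
    (hT : ∀ ω r, T ω r ≤ ((W * f r (heads ω) : ℕ) : ℝ≥0∞)) {b : ℕ → ℝ}
    (hb : ∀ r, ∫ ω, (f r (heads ω) : ℝ) ∂P ≤ b r) (hsum : Summable b) :
    ∫⁻ ω, ∑' r, T ω r ∂P ≤ ENNReal.ofReal (W * ∑' r, b r) := by
  have hb0 : ∀ r, 0 ≤ b r := fun r => (integral_nonneg fun ω => Nat.cast_nonneg _).trans (hb r)
  calc ∫⁻ ω, ∑' r, T ω r ∂P ≤ ∫⁻ ω, ∑' r, (W : ℝ≥0∞) * (f r (heads ω) : ℝ≥0∞) ∂P := by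
        refine lintegral_mono fun ω => ENNReal.tsum_le_tsum fun r => ?_
        simpa using hT ω r
    _ = ∑' r, ∫⁻ ω, (W : ℝ≥0∞) * (f r (heads ω) : ℝ≥0∞) ∂P := by
        refine lintegral_tsum fun r => (Measurable.const_mul ?_ _).aemeasurable
        exact hc.measurable ((hf r).comp (fun n : ℕ => (n : ℝ≥0∞)))
    _ = ∑' r, (W : ℝ≥0∞) * ∫⁻ ω, (f r (heads ω) : ℝ≥0∞) ∂P := by
        refine tsum_congr fun r => lintegral_const_mul _ ?_
        exact hc.measurable ((hf r).comp (fun n : ℕ => (n : ℝ≥0∞)))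
    _ ≤ ∑' r, (W : ℝ≥0∞) * ENNReal.ofReal (b r) := by
        refine ENNReal.tsum_le_tsum fun r => ?_
        rw [hc.lintegral_natCast (hf r)]
        gcongr
        exact hb r
    _ = ENNReal.ofReal (W * ∑' r, b r) := by
        rw [ENNReal.tsum_mul_left, ENNReal.ofReal_mul (Nat.cast_nonneg _),
          ENNReal.ofReal_natCast, ENNReal.ofReal_tsum_of_nonneg hb0 hsum]

theorem sum_costAt_le (L : AdjacencyLists F t) (hs : IsForest ρ (initState L))
    (h : ℕ → V → Bool) (r : ℕ) {S : Finset V} (hS : S ⊆ (stateAt (initState L) h r).1) :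
    ∑ p ∈ S, (costAt (computeRound h) (input L) r p : ℝ≥0∞) ≤
      (((6 * t + 14) * S.card : ℕ) : ℝ≥0∞) := by
  rw [← Nat.cast_sum, Nat.cast_le]
  refine (Finset.sum_le_card_nsmul S _ (6 * t + 14) fun p hp => ?_).trans (by simp [mul_comm])
  exact costAt_le L hs h r (by rw [activeAt_eq L hs]; exact hS hp)

theorem FairCoins.lintegral_initialWork_le (hc : FairCoins P heads) (L : AdjacencyLists F t)
    (hs : IsForest ρ (initState L)) :
    ∫⁻ ω, initialWork (computeRound (heads ω)) (input L) ∂P ≤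
      ENNReal.ofReal (((6 * t + 14 : ℕ) : ℝ) * (8 * Fintype.card V)) := by
  have := hc.lintegral_tsum_le (W := 6 * t + 14)
    (f := fun r h => (stateAt (initState L) h r).1.card)
    (T := fun ω r => ∑ p ∈ activeAt (computeRound (heads ω)) (input L) r,
      (costAt (computeRound (heads ω)) (input L) r p : ℝ≥0∞))
    (fun r => (dependsBefore_stateAt _ r).comp fun s => s.1.card)
    (fun ω r => by rw [activeAt_eq L hs]; exact sum_costAt_le L hs _ r subset_rfl)
    (fun r => hc.integral_card_alive_le hs r) (hasSum_geometric _).summable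
  rw [(hasSum_geometric _).tsum_eq] at this
  exact this

theorem stateAt_antitone (s : State V t) (h : ℕ → V → Bool) {r r' : ℕ} (hr : r ≤ r') :
    (stateAt s h r').1 ⊆ (stateAt s h r).1 := by
  induction r', hr using Nat.le_induction with
  | base => exact subset_rfl
  | succ m _ ih => exact (Finset.filter_subset _ _).trans ih

theorem roundComplexity_le (L : AdjacencyLists F t) (hs : IsForest ρ (initState L))
    {h : ℕ → V → Bool} {R : ℕ} (hR : (stateAt (initState L) h R).1 = ∅) :
    ((roundComplexity (computeRound h) (input L) : ℕ∞) : ℝ≥0∞) ≤ R := by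
  have hsub : {r : ℕ | (activeAt (computeRound h) (input L) r).Nonempty} ⊆ Set.Iio R := by
    intro r hr
    by_contra hle
    have := stateAt_antitone (initState L) h (not_lt.mp hle)
    rw [hR, Finset.subset_empty] at this
    change (activeAt (computeRound h) (input L) r).Nonempty at hr
    rw [activeAt_eq L hs, this] at hr
    exact Finset.not_nonempty_empty hr
  have h1 := Set.encard_le_encard hsub
  have h2 : (Set.Iio R).encard = R := by
    rw [← Finset.coe_range, Set.encard_coe_eq_coe_finsetCard, Finset.card_range]
  rw [h2] at h1
  have h3 : ((roundComplexity (computeRound h) (input L) : ℕ∞) : ℝ≥0∞) ≤ ((R : ℕ∞) : ℝ≥0∞) :=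
    ENat.toENNReal_le.mpr h1
  simpa using h3

theorem span_le (L : AdjacencyLists F t) (hs : IsForest ρ (initState L))
    {h : ℕ → V → Bool} {R : ℕ} (hR : (stateAt (initState L) h R).1 = ∅) :
    span (computeRound h) (input L) ≤ (((6 * t + 14) * R : ℕ) : ℝ≥0∞) := by
  rw [span, tsum_eq_sum (s := Finset.range R)]
  · rw [← Nat.cast_sum, Nat.cast_le]
    refine (Finset.sum_le_card_nsmul _ _ (6 * t + 14) fun r _ => ?_).trans (by simp [mul_comm])
    exact Finset.sup_le fun p hp => costAt_le L hs h r hp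
  · intro r hr
    have := stateAt_antitone (initState L) h (by simpa using hr : R ≤ r)
    rw [hR, Finset.subset_empty] at this
    rw [activeAt_eq L hs, this]
    simp

/-- With high probability no vertex is alive after logarithmically many rounds. -/
theorem FairCoins.measure_alive_le (hc : FairCoins P heads) (L : AdjacencyLists F t)
    (hs : IsForest ρ (initState L)) {B c : ℝ} (hB : 24 ≤ B) (hc1 : 1 ≤ c) :
    P {ω | (stateAt (initState L) (heads ω)
        ⌊B * c * Real.log (Fintype.card V)⌋₊).1 ≠ ∅} ≤
      ENNReal.ofReal ((Fintype.card V : ℝ) ^ (-c)) := by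
  set n := Fintype.card V with hn
  set R := ⌊B * c * Real.log n⌋₊ with hR
  -- For a single vertex the logarithm vanishes, but the claimed bound is 1.
  rcases eq_or_ne n 1 with h1 | h1
  · rw [h1]
    simpa using prob_le_one
  have hst := dependsBefore_stateAt (initState L) R
  have hm : MeasurableSet {ω | (stateAt (initState L) (heads ω) R).1 ≠ ∅} :=
    hc.measurableSet (hst.comp fun s => s.1 ≠ ∅)
  calc P {ω | (stateAt (initState L) (heads ω) R).1 ≠ ∅}
      = ∫⁻ ω, {ω | (stateAt (initState L) (heads ω) R).1 ≠ ∅}.indicator 1 ω ∂P :=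
        (lintegral_indicator_one hm).symm
    _ ≤ ∫⁻ ω, ((stateAt (initState L) (heads ω) R).1.card : ℝ≥0∞) ∂P := by
        refine lintegral_mono fun ω => ?_
        by_cases hω : (stateAt (initState L) (heads ω) R).1 = ∅
        · simp [hω]
        · have : 1 ≤ (stateAt (initState L) (heads ω) R).1.card :=
            Finset.card_pos.mpr (Finset.nonempty_iff_ne_empty.mpr hω)
          simpa [hω] using this
    _ = ENNReal.ofReal (∫ ω, ((stateAt (initState L) (heads ω) R).1.card : ℝ) ∂P) :=
        hc.lintegral_natCast (hst.comp fun s => s.1.card)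
    _ ≤ ENNReal.ofReal ((n : ℝ) ^ (-c)) := by
        apply ENNReal.ofReal_le_ofReal
        refine (hc.integral_card_alive_le hs R).trans ?_
        rcases Nat.eq_zero_or_pos n with h0 | h0
        · rw [← hn, h0]
          simp only [Nat.cast_zero, zero_mul]
          positivity
        · exact mul_pow_floor_le (by omega) hB hc1

theorem FairCoins.measure_roundComplexity_le (hc : FairCoins P heads) (L : AdjacencyLists F t)
    (hs : IsForest ρ (initState L)) {B c : ℝ} (hB : 24 ≤ B) (hc1 : 1 ≤ c) :
    P {ω | ENNReal.ofReal (B * c * Real.log (Fintype.card V)) <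
        ((roundComplexity (computeRound (heads ω)) (input L) : ℕ∞) : ℝ≥0∞)} ≤
      ENNReal.ofReal ((Fintype.card V : ℝ) ^ (-c)) := by
  refine (measure_mono fun ω hω => ?_).trans (hc.measure_alive_le L hs hB hc1)
  intro hR
  refine absurd hω (not_lt.mpr ((roundComplexity_le L hs hR).trans ?_))
  rw [← ENNReal.ofReal_natCast]
  refine ENNReal.ofReal_le_ofReal (Nat.floor_le ?_)
  exact mul_nonneg (mul_nonneg (by linarith) (by linarith)) (Real.log_natCast_nonneg _)

theorem FairCoins.measure_span_le (hc : FairCoins P heads) (L : AdjacencyLists F t)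
    (hs : IsForest ρ (initState L)) {B c : ℝ} (hB : 24 ≤ B) (hc1 : 1 ≤ c) :
    P {ω | ENNReal.ofReal ((((6 * t + 14 : ℕ) : ℝ) * B) * c * Real.log (Fintype.card V)) <
        span (computeRound (heads ω)) (input L)} ≤
      ENNReal.ofReal ((Fintype.card V : ℝ) ^ (-c)) := by
  refine (measure_mono fun ω hω => ?_).trans (hc.measure_alive_le L hs hB hc1)
  intro hR
  refine absurd hω (not_lt.mpr ((span_le L hs hR).trans ?_))
  rw [← ENNReal.ofReal_natCast]
  refine ENNReal.ofReal_le_ofReal ?_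
  have h1 : 0 ≤ B * c * Real.log (Fintype.card V) :=
    mul_nonneg (mul_nonneg (by linarith) (by linarith)) (Real.log_natCast_nonneg _)
  rw [Nat.cast_mul]
  calc ((6 * t + 14 : ℕ) : ℝ) * (⌊B * c * Real.log (Fintype.card V)⌋₊ : ℝ)
      ≤ ((6 * t + 14 : ℕ) : ℝ) * (B * c * Real.log (Fintype.card V)) :=
        mul_le_mul_of_nonneg_left (Nat.floor_le h1) (Nat.cast_nonneg _)
    _ = _ := by ring

/-- The vertices whose adjacency lists differ. -/
noncomputable def changedVertices (L : AdjacencyLists F t) (L' : AdjacencyLists F' t) : Finset V :=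
  Finset.univ.filter (fun u => L.slot u ≠ L'.slot u)

/-- Every changed vertex starts as a block of its own, so connectedness and the frontier bound are
trivial. -/
theorem dirty_changedVertices (L : AdjacencyLists F t) (L' : AdjacencyLists F' t) :
    Dirty ρ ρ' (initState L) (initState L') (changedVertices L L') (changedVertices L L') := by
  have hblock : ∀ l u, u ∈ block (changedVertices L L') id l → u = l :=
    fun l u hu => (mem_block.mp hu).2
  refine ⟨fun u _ => by simp [initState], fun u hu => ?_, id, fun u hu => hu, fun l _ => ⟨?_, ?_, ?_⟩⟩
  · by_contra hne
    exact hu (Finset.mem_filter.mpr ⟨Finset.mem_univ _, hne⟩)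
  · intro v hv _ _ w hw _ _
    rw [hblock l v hv, hblock l w hw]
  · intro v hv _ _ w hw _ _
    rw [hblock l v hv, hblock l w hw]
  · refine (Finset.card_le_one.mpr fun v hv w hw => ?_).trans one_le_two
    rw [hblock l v (mem_frontier.mp hv).1, hblock l w (mem_frontier.mp hw).1]

/-- A vertex on no inserted or deleted edge has the same neighbors in both graphs, and `SameSlots`
puts them in the same slots. So every changed vertex is an end of a changed edge. -/
theorem card_changedVertices_le (L : AdjacencyLists F t) (L' : AdjacencyLists F' t)
    (hL : SameSlots L L') :
    (changedVertices L L').card ≤ 2 * (symmDiff F.edgeSet F'.edgeSet).ncard := by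
  classical
  set E := (symmDiff F.edgeSet F'.edgeSet).toFinite.toFinset with hE
  have hsub : changedVertices L L' ⊆ E.biUnion Sym2.toFinset := by
    intro u hu
    by_contra hcon
    simp only [Finset.mem_biUnion, not_exists, not_and, Sym2.mem_toFinset] at hcon
    have hadj : ∀ v, F.Adj u v ↔ F'.Adj u v := by
      intro v
      by_contra hne
      refine hcon s(u, v) ?_ (by simp)
      simp only [hE, Set.Finite.mem_toFinset, Set.mem_symmDiff, SimpleGraph.mem_edgeSet]
      tauto
    refine (Finset.mem_filter.mp hu).2 (funext fun j => Option.ext fun x => ?_)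
    obtain ⟨v, p⟩ := x
    constructor
    · intro e
      have h1 : F.Adj u v := (L.adj_iff u v).mpr ⟨j, p, e⟩
      exact (hL u v j p h1 ((hadj v).mp h1)).mp e
    · intro e
      have h1 : F'.Adj u v := (L'.adj_iff u v).mpr ⟨j, p, e⟩
      exact (hL u v j p ((hadj v).mpr h1) h1).mpr e
  calc (changedVertices L L').card ≤ _ := Finset.card_le_card hsub
    _ ≤ ∑ e ∈ E, e.toFinset.card := Finset.card_biUnion_le
    _ ≤ ∑ _e ∈ E, 2 := Finset.sum_le_sum fun e _ => by
        rw [Sym2.card_toFinset]; split <;> omega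
    _ = 2 * (symmDiff F.edgeSet F'.edgeSet).ncard := by
        rw [Set.ncard_eq_toFinset_card _ (Set.toFinite _)]
        simp [hE, mul_comm]

/-- A vertex outside `D` has the same list and liveness in both runs, so only a neighbor's leaf flag
can affect it; such a neighbor is a carrier. -/
theorem affected_subset_halo (L : AdjacencyLists F t) (L' : AdjacencyLists F' t)
    (hs : IsForest ρ (initState L)) (hs' : IsForest ρ' (initState L')) (h : ℕ → V → Bool) (r : ℕ)
    {Λ D : Finset V}
    (hD : Dirty ρ ρ' (stateAt (initState L) h r) (stateAt (initState L') h r) Λ D) {p : V}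
    (hp : Affected (computeRound h) (input L) (input L') r p) :
    p ∈ halo (stateAt (initState L) h r) (stateAt (initState L') h r) (h r) D := by
  by_contra hcon
  have hpD : p ∉ D := fun h' => hcon (subset_halo h')
  obtain ⟨j, v, q, e, hne⟩ :=
    affected_imp L L' hs hs' h r hp (hD.alive_iff p hpD) (hD.slot_eq p hpD)
  exact hne (leaf_iff_of_clean hD (hs.stateAt h r) (hs'.stateAt h r) hcon ⟨j, q, e⟩)

-- In each round the affected computations are bounded in two ways: by the alive dirty vertices plus
-- the growth of the halo, which is `O(k)` in expectation, and by all alive vertices, which decay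
-- geometrically. The expectation of the minimum is at most the minimum of the expectations.
open Classical in
theorem FairCoins.lintegral_computationDistance_le (hc : FairCoins P heads)
    (L : AdjacencyLists F t) (L' : AdjacencyLists F' t)
    (hs : IsForest ρ (initState L)) (hs' : IsForest ρ' (initState L')) (hL : SameSlots L L')
    {k : ℕ} (hk : (symmDiff F.edgeSet F'.edgeSet).ncard ≤ k) :
    ∫⁻ ω, computationDistance (computeRound (heads ω)) (input L) (input L') ∂P ≤
      ENNReal.ofReal (((6 * t + 14 : ℕ) : ℝ) *
        ∑' r : ℕ, 296 * min (k : ℝ) (Fintype.card V * (7 / 8 : ℝ) ^ r)) := by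
  set Λ := changedVertices L L' with hΛ
  set s := initState L
  set s' := initState L'
  have hΛk : (Λ.card : ℝ) ≤ 2 * k := by
    have := (card_changedVertices_le L L' hL).trans (Nat.mul_le_mul_left 2 hk)
    exact_mod_cast this
  have hD₀ : Dirty ρ ρ' s s' Λ Λ := dirty_changedVertices L L'
  let D : ℕ → (ℕ → V → Bool) → Finset V := fun r h => dirtyAt s s' Λ h r
  let X : ℕ → (ℕ → V → Bool) → ℕ := fun r h => (D r h ∩ (stateAt s h r).1).card
  let X' : ℕ → (ℕ → V → Bool) → ℕ := fun r h => (D r h ∩ (stateAt s' h r).1).card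
  let A : ℕ → (ℕ → V → Bool) → ℕ := fun r h => (stateAt s h r).1.card
  let A' : ℕ → (ℕ → V → Bool) → ℕ := fun r h => (stateAt s' h r).1.card
  have hX : ∀ r, DependsBefore r (X r) := fun r =>
    (dependsBefore_dirtyAt s s' Λ r).comp₂ (dependsBefore_stateAt s r) fun D s => (D ∩ s.1).card
  have hX' : ∀ r, DependsBefore r (X' r) := fun r =>
    (dependsBefore_dirtyAt s s' Λ r).comp₂ (dependsBefore_stateAt s' r) fun D s => (D ∩ s.1).card
  have hA : ∀ r, DependsBefore r (A r) := fun r =>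
    (dependsBefore_stateAt s r).comp fun s => s.1.card
  have hA' : ∀ r, DependsBefore r (A' r) := fun r =>
    (dependsBefore_stateAt s' r).comp fun s => s.1.card
  let U : ℕ → (ℕ → V → Bool) → ℕ := fun r h => X r h + X' r h + 8 * Λ.card
  let U' : ℕ → (ℕ → V → Bool) → ℕ := fun r h => A r h + A' r h
  have hU : ∀ r, DependsBefore r (U r) := fun r =>
    (hX r).comp₂ (hX' r) fun a b => a + b + 8 * Λ.card
  have hU' : ∀ r, DependsBefore r (U' r) := fun r => (hA r).comp₂ (hA' r) fun a b => a + b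
  have hM : ∀ r, DependsBefore r (fun h => min (U r h) (U' r h)) := fun r =>
    (hU r).comp₂ (hU' r) min
  have haff : ∀ (S : Finset V) (B : Finset V) h r,
      S ⊆ B ∩ halo (stateAt s h r) (stateAt s' h r) (h r) (D r h) →
      S.card ≤ (D r h ∩ B).card + 4 * Λ.card := by
    intro S B h r hS
    have hD := hD₀.dirtyAt hs hs' h r
    have h1 := card_halo_le (h := h r) hD (hs.stateAt h r) (hs'.stateAt h r)
    set H := halo (stateAt s h r) (stateAt s' h r) (h r) (D r h) with hH
    have h2 : (H \ D r h).card + (D r h).card = H.card :=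
      Finset.card_sdiff_add_card_eq_card subset_halo
    have h3 : S ⊆ (D r h ∩ B) ∪ (H \ D r h) := by
      intro u hu
      obtain ⟨hu1, hu2⟩ := Finset.mem_inter.mp (hS hu)
      by_cases huD : u ∈ D r h
      · exact Finset.mem_union_left _ (Finset.mem_inter.mpr ⟨huD, hu1⟩)
      · exact Finset.mem_union_right _ (Finset.mem_sdiff.mpr ⟨hu2, huD⟩)
    have h4 := (Finset.card_le_card h3).trans (Finset.card_union_le _ _)
    change H.card ≤ (D r h).card + 4 * Λ.card at h1
    omega
  refine hc.lintegral_tsum_le (W := 6 * t + 14) (f := fun r h => min (U r h) (U' r h)) hM ?_ ?_ ?_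
  · intro ω r
    set h := heads ω
    rw [activeAt_eq L hs, activeAt_eq L' hs']
    set S := (stateAt s h r).1.filter (Affected (computeRound h) (input L) (input L') r) with hS
    set S' := (stateAt s' h r).1.filter (Affected (computeRound h) (input L) (input L') r) with hS'
    have h1 := sum_costAt_le L hs h r (S := S) (Finset.filter_subset _ _)
    have h2 := sum_costAt_le L' hs' h r (S := S') (Finset.filter_subset _ _)
    have hD := hD₀.dirtyAt hs hs' h r
    have h3 : S.card ≤ X r h + 4 * Λ.card := haff S _ h r fun p hp =>
      Finset.mem_inter.mpr ⟨(Finset.mem_filter.mp hp).1,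
        affected_subset_halo L L' hs hs' h r hD (Finset.mem_filter.mp hp).2⟩
    have h4 : S'.card ≤ X' r h + 4 * Λ.card := haff S' _ h r fun p hp =>
      Finset.mem_inter.mpr ⟨(Finset.mem_filter.mp hp).1,
        affected_subset_halo L L' hs hs' h r hD (Finset.mem_filter.mp hp).2⟩
    have h5 : S.card ≤ A r h := Finset.card_le_card (Finset.filter_subset _ _)
    have h6 : S'.card ≤ A' r h := Finset.card_le_card (Finset.filter_subset _ _)
    refine (add_le_add h1 h2).trans ?_
    rw [← Nat.cast_add, ← Nat.mul_add, Nat.cast_le]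
    refine Nat.mul_le_mul_left _ (le_min ?_ ?_)
    · simp only [U]; omega
    · simp only [U']; omega
  · intro r
    have iX := hc.integrable (hX r)
    have iX' := hc.integrable (hX' r)
    have iA := hc.integrable (hA r)
    have iA' := hc.integrable (hA' r)
    have h1 := hc.integral_card_dirtyAt_le hD₀ hs hs' le_rfl r
    have h2 := hc.integral_card_alive_le hs r
    have h3 := hc.integral_card_alive_le hs' r
    -- The factor is `296 = (70 + 70 + 8) * 2`: two runs, the halo growth in both, and two changed
    -- vertices per changed edge.
    have e1 : ∫ ω, (U r (heads ω) : ℝ) ∂P ≤ 296 * k := by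
      have : ∫ ω, (U r (heads ω) : ℝ) ∂P = ∫ ω, (X r (heads ω) : ℝ) ∂P +
          ∫ ω, (X' r (heads ω) : ℝ) ∂P + 8 * Λ.card := by
        have hi : Integrable (fun ω => (X r (heads ω) : ℝ) + (X' r (heads ω) : ℝ)) P := iX.add iX'
        rw [← integral_add iX iX']
        have := integral_add hi (integrable_const ((8 * Λ.card : ℕ) : ℝ))
        simp only [integral_const, probReal_univ, one_smul] at this
        simp only [U]
        push_cast at this ⊢
        exact this
      rw [this]
      have h4 := h1.1
      have h5 := h1.2
      change ∫ ω, (X r (heads ω) : ℝ) ∂P ≤ _ at h4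
      change ∫ ω, (X' r (heads ω) : ℝ) ∂P ≤ _ at h5
      linarith
    have e2 : ∫ ω, (U' r (heads ω) : ℝ) ∂P ≤ 296 * (Fintype.card V * (7 / 8 : ℝ) ^ r) := by
      have : ∫ ω, (U' r (heads ω) : ℝ) ∂P = ∫ ω, (A r (heads ω) : ℝ) ∂P +
          ∫ ω, (A' r (heads ω) : ℝ) ∂P := by
        rw [← integral_add iA iA']
        simp only [U']
        push_cast
        rfl
      rw [this]
      change ∫ ω, (A r (heads ω) : ℝ) ∂P ≤ _ at h2
      change ∫ ω, (A' r (heads ω) : ℝ) ∂P ≤ _ at h3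
      have h6 : (0 : ℝ) ≤ Fintype.card V * (7 / 8 : ℝ) ^ r := by positivity
      linarith
    rw [mul_min_of_nonneg _ _ (by norm_num : (0 : ℝ) ≤ 296)]
    refine le_min ((integral_mono (hc.integrable (hM r)) (hc.integrable (hU r))
      fun ω => ?_).trans e1) ((integral_mono (hc.integrable (hM r)) (hc.integrable (hU' r))
      fun ω => ?_).trans e2)
    · exact Nat.cast_le.mpr (min_le_left _ _)
    · exact Nat.cast_le.mpr (min_le_right _ _)
  · exact (summable_min (Nat.cast_nonneg _) _ (Nat.cast_nonneg _)).mul_left _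

end Bounds

end TreeContraction

/-! ### Choice of the constant and assembly -/

theorem mainTheorem2 (t : ℕ) :
    ∃ C : ℝ, 0 < C ∧
      ∀ (V : Type) [Fintype V] [LinearOrder V]
        (Ω : Type*) [MeasurableSpace Ω] (P : Measure Ω) [IsProbabilityMeasure P]
        (heads : Ω → ℕ → V → Bool)
        (_hmeas : ∀ i v, Measurable (fun ω => heads ω i v))
        (_hindep : iIndepFun (fun (q : ℕ × V) (ω : Ω) => heads ω q.1 q.2) P)
        (_hfair : ∀ i v, P {ω | heads ω i v = true} = 1 / 2)
        (F : SimpleGraph V) (_hF : F.IsAcyclic) (L : TreeContraction.AdjacencyLists F t),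
        -- every run is a legal round-based computation
        (∀ ω, RoundBased.Legal (TreeContraction.computeRound (heads ω))
          (TreeContraction.input L)) ∧
        -- initial work
        ∫⁻ ω, RoundBased.initialWork (TreeContraction.computeRound (heads ω))
            (TreeContraction.input L) ∂P ≤ ENNReal.ofReal (C * Fintype.card V) ∧
        -- number of rounds
        (∀ c : ℝ, 1 ≤ c →
          P {ω | ENNReal.ofReal (C * c * Real.log (Fintype.card V)) <
              ((RoundBased.roundComplexity (TreeContraction.computeRound (heads ω))
                (TreeContraction.input L) : ℕ∞) : ℝ≥0∞)} ≤
            ENNReal.ofReal ((Fintype.card V : ℝ) ^ (-c))) ∧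
        -- span
        (∀ c : ℝ, 1 ≤ c →
          P {ω | ENNReal.ofReal (C * c * Real.log (Fintype.card V)) <
              RoundBased.span (TreeContraction.computeRound (heads ω))
                (TreeContraction.input L)} ≤
            ENNReal.ofReal ((Fintype.card V : ℝ) ^ (-c))) ∧
        -- computation distance
        (∀ (F' : SimpleGraph V) (_hF' : F'.IsAcyclic) (L' : TreeContraction.AdjacencyLists F' t)
          (k : ℕ), TreeContraction.SameSlots L L' →
          (symmDiff F.edgeSet F'.edgeSet).ncard ≤ k →
          ∫⁻ ω, RoundBased.computationDistance (TreeContraction.computeRound (heads ω))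
              (TreeContraction.input L) (TreeContraction.input L') ∂P ≤
            ENNReal.ofReal (C * (k * Real.log (1 + Fintype.card V / k)))) := by
  set W : ℝ := ((6 * t + 14 : ℕ) : ℝ) with hW
  have hW1 : 14 ≤ W := by
    have : (14 : ℕ) ≤ 6 * t + 14 := by omega
    rw [hW]; exact_mod_cast this
  -- The distance needs `296 * 26 = 7696` after the factor `W`. The same constant covers the work,
  -- which needs 8, and the high-probability bounds, which need 24.
  refine ⟨W * 8000, by positivity, ?_⟩
  intro V _ _ Ω _ P _ heads hmeas hindep hfair F hF L
  have hc : TreeContraction.FairCoins P heads := ⟨hmeas, hindep, hfair⟩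
  obtain ⟨ρ, hs⟩ := TreeContraction.exists_isForest_initState hF L
  refine ⟨fun ω => TreeContraction.legal_computeRound L hs (heads ω), ?_, ?_, ?_, ?_⟩
  · refine (hc.lintegral_initialWork_le L hs).trans (ENNReal.ofReal_le_ofReal ?_)
    rw [← hW, mul_assoc]
    have : (0 : ℝ) ≤ Fintype.card V := Nat.cast_nonneg _
    exact mul_le_mul_of_nonneg_left (by linarith) (by linarith)
  · intro c hc1
    exact hc.measure_roundComplexity_le L hs (by linarith) hc1
  · intro c hc1
    exact hc.measure_span_le L hs (by norm_num) hc1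
  · intro F' hF' L' k hL hk
    obtain ⟨ρ', hs'⟩ := TreeContraction.exists_isForest_initState hF' L'
    refine (hc.lintegral_computationDistance_le L L' hs hs' hL hk).trans
      (ENNReal.ofReal_le_ofReal ?_)
    rw [← hW, mul_assoc, tsum_mul_left]
    refine mul_le_mul_of_nonneg_left ?_ (by linarith)
    have hn : (0 : ℝ) ≤ Fintype.card V := Nat.cast_nonneg _
    -- For `k = 0` every minimum is zero, and so is the right side, because of its factor `k`.
    rcases Nat.eq_zero_or_pos k with rfl | hk0
    · have h0 : ∀ r : ℕ, min ((0 : ℕ) : ℝ) (Fintype.card V * (7 / 8 : ℝ) ^ r) = 0 := fun r => by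
        rw [Nat.cast_zero]; exact min_eq_left (by positivity)
      rw [tsum_congr h0]
      simp
    · have hk1 : (0 : ℝ) < k := Nat.cast_pos.mpr hk0
      have h1 := TreeContraction.tsum_min_le hn hk1
      have h2 : 0 ≤ (k : ℝ) * Real.log (1 + Fintype.card V / k) :=
        mul_nonneg hk1.le (Real.log_nonneg (by
          have : (0 : ℝ) ≤ Fintype.card V / k := by positivity
          linarith))
      linarith
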